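/- Setting. Let $M_1$ be a closed Riemann surface with a Riemannian metric $g_1$ compatible with its complex structure (locally $g_1=\rho\,|dz|^2$), and fix a spin structure on $M_1$, i.e. a holomorphic line bundle $W$ with a holomorphic isomorphism $W\otimes W\simeq T^{(1,0)}M_1$. Let $\mathbb S$ be the real rank two spinor bundle underlying $W$, with the metric and the symplectic form $\omega_1$ induced by $g_1$ and its area form, and with the Clifford multiplication $\gamma$, $\gamma^i\gamma^j+\gamma^j\gamma^i=2\delta^{ij}$, determined by $\gamma(v^\flat)s\otimes s=|s|^2v$. For a real one-form $A$ on $M_1$ let $\nabla^A=\nabla^{\mathbb S}+\tfrac12A\otimes\gamma^1\gamma^2$, where $\nabla^{\mathbb S}$ is the spin connection of the Levi-Civita connection. Let $(M_2,g_2)$ be a flat Riemannian manifold (locally isometric to Euclidean space), $\varphi:M_1\to M_2$ a smooth map, and $\Lambda=\Lambda^+\oplus\Lambda^-$ a real Grassmann algebra with finitely many generators. On $E=\mathbb S^*\otimes\varphi^*TM_2\otimes\Lambda$ let $$(z_1\otimes y_1\otimes\lambda_1,\;z_2\otimes y_2\otimes\lambda_2)_E=\omega_1^*(z_1,z_2)\,g_2(y_1,y_2)\,\lambda_1\wedge\lambda_2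 ,$$ and let $D_A\psi=\gamma^k\nabla_{e_k}\psi$ be the twisted Dirac operator ($e_1,e_2$ an oriented orthonormal frame of $TM_1$, with $\nabla$ induced by $\nabla^A$ and the Levi-Civita connection of $g_2$, and $\gamma$ acting on $\mathbb S^*$ through the identification $s\mapsto\tilde s:=\omega_1(s,\cdot)$ with $\mathbb S$). Consider $$\mathcal A(\varphi,\psi)=\int_{M_1}\big(\|d\varphi\|^2+(\psi,D_A\psi)_E\big)\,dvol(g_1).$$ Let $\psi$ be a smooth odd section of $E$ and $s$ a smooth odd section of $\mathbb S\otimes\Lambda$. The first-order supersymmetry transformations are $$\delta_s\varphi=\psi(s),\qquad \delta_s\psi=\gamma(d\varphi)\tilde s=\gamma^k\tilde s\otimes d\varphi(e_k).$$ A supersymmetry variation is a smooth family $(\varphi_t,\psi_t)$, $t\in\mathbb R$, of odd sections $\psi_t$ of $E$ and of Grassmann extensions $\varphi_t$ of $\varphi$ (given by even sections $\xi_t$ of $\varphi^*TM_2\otimes\Lambda$, so that in isometric coordinates of $M_2$ one has $\varphi_t=\varphi+\xi_t$ and $d\varphi_t=d\varphi+\nabla\xi_t$), with $\varphi_0=\varphi$,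 $\psi_0=\psi$, $\dot\xi_0=\delta_s\varphi$ and $\dot\psi_0=\delta_s\psi$. Let $$\mathfrak q(\sigma_k\otimes e^k)=\tfrac12\sum_i\gamma^k\gamma^i\sigma_k\otimes e^i$$ be the projection of $\mathbb S\otimes T^*M_1$ onto its spin-$3/2$ part. Statement. 1. The family $\varphi_t=\varphi+t\,\delta_s\varphi$ (that is, $\xi_t=t\,\delta_s\varphi$), $\psi_t=\psi+t\,\delta_s\psi$ is a supersymmetry variation. 2. There is a smooth vector field $J$ on $M_1$ with values in $TM_1\otimes\Lambda^+$ such that for every supersymmetry variation, at every point of $M_1$, $$\frac{d}{dt}\Big|_{t=0}\Big(\|d\varphi_t\|^2+(\psi_t,D_A\psi_t)_E\Big)=\operatorname{div}J+4\sum_i\Big(\psi,\widetilde{\mathfrak q(\nabla^{\mathbb S}s)(e_i)}\otimes d\varphi(e_i)\Big)_E .$$ 3. $\mathfrak q(\nabla^{\mathbb S}s)=0$ if and only if $s$ is holomorphic, i.e. the real components of $s$ with respect to $\Lambda$ are holomorphic sections of $W$. 4. For every supersymmetry variation $\mathcal A(\varphi_t,\psi_t)\in\Lambda^+$ for all $t$;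 and if $s$ is holomorphic, then $\mathcal A$ is stationary: $$\frac{d}{dt}\Big|_{t=0}\mathcal A(\varphi_t,\psi_t)=0 .$$ -/

import Mathlib

open scoped Manifold ContDiff TensorProduct

noncomputable section

namespace SusyDirac

/-! ### Grassmann algebras and Grassmann extensions -/

section Grassmann

/-- The real Grassmann algebra `Λ` with `L` generators. -/
abbrev Grassmann (L : ℕ) : Type := ExteriorAlgebra ℝ (Fin L → ℝ)

/-- The standard basis of `Λ`, indexed by the finite sets of generators. -/
def grassmannBasis (L : ℕ) : Module.Basis (Finset (Fin L)) ℝ (Grassmann L) :=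
  (Pi.basisFun ℝ (Fin L)).ExteriorAlgebra

/-- `Λ` is a finite dimensional real vector space; we use the sup norm of the coordinates (all
norms are equivalent, so derivatives and integrals do not depend on this choice). -/
instance instNormedAddCommGroupGrassmann (L : ℕ) : NormedAddCommGroup (Grassmann L) :=
  NormedAddCommGroup.induced (Grassmann L) (Finset (Fin L) → ℝ)
    (grassmannBasis L).equivFun.toLinearMap (grassmannBasis L).equivFun.injective

instance instNormedSpaceGrassmann (L : ℕ) : NormedSpace ℝ (Grassmann L) :=
  NormedSpace.induced ℝ (Grassmann L) (Finset (Fin L) → ℝ) (grassmannBasis L).equivFun.toLinearMap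

instance instFiniteDimensionalGrassmann (L : ℕ) : FiniteDimensional ℝ (Grassmann L) :=
  Module.Finite.of_basis (grassmannBasis L)

instance instCompleteSpaceGrassmann (L : ℕ) : CompleteSpace (Grassmann L) :=
  FiniteDimensional.complete ℝ (Grassmann L)

/-- `Λ⁺` for `i = 0` and `Λ⁻` for `i = 1`. -/
def parityPart (L : ℕ) (i : ZMod 2) : Submodule ℝ (Grassmann L) :=
  CliffordAlgebra.evenOdd (0 : QuadraticForm ℝ (Fin L → ℝ)) i

variable {L : ℕ} {V : Type*} [AddCommGroup V] [Module ℝ V]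

/-- The elements of `V ⊗ Λ` of parity `i`, that is the image of `V ⊗ Λ^±`. -/
def HasParity (i : ZMod 2) (τ : V ⊗[ℝ] Grassmann L) : Prop :=
  τ ∈ LinearMap.range (LinearMap.lTensor V (parityPart L i).subtype)

/-- The component of an element of `V ⊗ Λ` along a linear functional on `Λ`:
`v ⊗ l ↦ ℓ l • v`. -/
def component (ℓ : Grassmann L →ₗ[ℝ] ℝ) : V ⊗[ℝ] Grassmann L →ₗ[ℝ] V :=
  (TensorProduct.rid ℝ V).toLinearMap ∘ₗ LinearMap.lTensor V ℓ

/-- The graded extension of a bilinear form: `(v ⊗ l, w ⊗ m) ↦ B v w • (l ∧ m)`. -/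
def gradedForm (B : V →ₗ[ℝ] V →ₗ[ℝ] ℝ) (a b : V ⊗[ℝ] Grassmann L) : Grassmann L :=
  TensorProduct.lid ℝ (Grassmann L)
    (TensorProduct.map (TensorProduct.lift B) (LinearMap.mul' ℝ (Grassmann L))
      (TensorProduct.tensorTensorTensorComm ℝ V (Grassmann L) V (Grassmann L) (a ⊗ₜ b)))

/-- Evaluation of a `V ⊗ Λ`-valued linear map on an element of `W ⊗ Λ`:
`α (w ⊗ l) = α w ∧ l`. -/
def gradedEval {W : Type*} [AddCommGroup W] [Module ℝ W]
    (α : W →ₗ[ℝ] V ⊗[ℝ] Grassmann L) : W ⊗[ℝ] Grassmann L →ₗ[ℝ] V ⊗[ℝ] Grassmann L :=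
  LinearMap.lTensor V (LinearMap.mul' ℝ (Grassmann L)) ∘ₗ
    (TensorProduct.assoc ℝ V (Grassmann L) (Grassmann L)).toLinearMap ∘ₗ
      LinearMap.rTensor (Grassmann L) α

end Grassmann

/-! ### Riemann surfaces with a compatible metric -/

section Surface

variable {M : Type*} [TopologicalSpace M] [ChartedSpace ℂ M]

/-- A Riemann surface is in particular a smooth real surface. -/
instance instIsManifoldReal [IsManifold 𝓘(ℂ) ω M] : IsManifold 𝓘(ℝ, ℂ) ∞ M := by
  apply isManifold_of_contDiffOn
  intro e e' he he'
  have h := (contDiffGroupoid ω 𝓘(ℂ)).compatible he he'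
  rw [contDiffGroupoid, mem_groupoid_of_pregroupoid] at h
  exact (ContDiffOn.restrict_scalars ℝ h.1).of_le le_top

/-- The derivative at `x` of a function on `M` with values in a normed space. -/
def dAt {G : Type*} [NormedAddCommGroup G] [NormedSpace ℝ G] (f : M → G) (x : M) :
    TangentSpace 𝓘(ℝ, ℂ) x →L[ℝ] G :=
  mfderiv 𝓘(ℝ, ℂ) 𝓘(ℝ, G) f x

/-- The vector of `T_x M` with coordinate `c` in the chart `z` at `p`; so `1` and `I` give the
coordinate vectors `∂/∂x¹` and `∂/∂x²` of `z = x¹ + i x²`. -/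
def coordVec (p x : M) : ℂ →L[ℝ] TangentSpace 𝓘(ℝ, ℂ) x :=
  (dAt (chartAt ℂ p) x).inverse

/-- The coordinate in the chart at `p` of a tangent vector at `x`. -/
def vecCoord (p x : M) : TangentSpace 𝓘(ℝ, ℂ) x →L[ℝ] ℂ :=
  dAt (chartAt ℂ p) x

/-- The two real coordinate directions of `ℂ`. -/
def direction : Fin 2 → ℂ := ![1, Complex.I]

variable [IsManifold 𝓘(ℂ) ω M]

/-- Smooth Riemannian metrics on the real surface underlying `M`. -/
abbrev SurfaceMetric (M : Type*) [TopologicalSpace M] [ChartedSpace ℂ M]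
    [IsManifold 𝓘(ℂ) ω M] :=
  Bundle.ContMDiffRiemannianMetric 𝓘(ℝ, ℂ) ∞ ℂ (fun x : M => TangentSpace 𝓘(ℝ, ℂ) x)

/-- The metric induces the given complex structure: `∂/∂x¹` and `∂/∂x²` are orthogonal and of the
same length. -/
def IsConformal (g : SurfaceMetric M) : Prop :=
  ∀ p : M, ∀ x ∈ (chartAt ℂ p).source,
    g.inner x (coordVec p x 1) (coordVec p x 1) =
        g.inner x (coordVec p x Complex.I) (coordVec p x Complex.I) ∧
      g.inner x (coordVec p x 1) (coordVec p x Complex.I) = 0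

/-- The density `√det g` of the Riemannian area in the chart at `p`. -/
def areaDensity (g : SurfaceMetric M) (p x : M) : ℝ :=
  Real.sqrt (g.inner x (coordVec p x 1) (coordVec p x 1) *
      g.inner x (coordVec p x Complex.I) (coordVec p x Complex.I) -
    g.inner x (coordVec p x 1) (coordVec p x Complex.I) ^ 2)

/-- A smooth partition of unity subordinate to the charts. -/
def chartPartition (M : Type*) [TopologicalSpace M] [ChartedSpace ℂ M]
    [IsManifold 𝓘(ℂ) ω M] [CompactSpace M] [T2Space M] :
    SmoothPartitionOfUnity M 𝓘(ℝ, ℂ) M Set.univ :=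
  (SmoothPartitionOfUnity.exists_isSubordinate_chartAt_source 𝓘(ℝ, ℂ) M).choose

/-- The integral `∫_M f dvol(g)`, computed with a partition of unity. -/
def surfaceIntegral [CompactSpace M] [T2Space M] (g : SurfaceMetric M) {G : Type*}
    [NormedAddCommGroup G] [NormedSpace ℝ G] (f : M → G) : G :=
  ∑ᶠ p : M, ∫ z in (chartAt ℂ p).target,
    (chartPartition M p ((chartAt ℂ p).symm z) * areaDensity g p ((chartAt ℂ p).symm z)) •
      f ((chartAt ℂ p).symm z)

/-- The conformal factor `ρ` of `g = ρ |dz|²` in the chart at `p`. -/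
def conformalFactor (g : SurfaceMetric M) (p x : M) : ℝ :=
  g.inner x (coordVec p x 1) (coordVec p x 1)

/-- An oriented orthonormal basis `e₁, e₂` of `T_x M` (for a conformal metric). -/
def orthoFrame (g : SurfaceMetric M) (x : M) (k : Fin 2) : TangentSpace 𝓘(ℝ, ℂ) x :=
  (Real.sqrt (conformalFactor g x x))⁻¹ • coordVec x x (direction k)

/-- The divergence `(√det g)⁻¹ ∂ₖ (√det g Jᵏ)` of a vector field. -/
def divergence (g : SurfaceMetric M) (J : (x : M) → TangentSpace 𝓘(ℝ, ℂ) x) (x : M) : ℝ :=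
  (areaDensity g x x)⁻¹ *
    (dAt (fun y => areaDensity g x y * (vecCoord x y (J y)).re) x (coordVec x x 1) +
      dAt (fun y => areaDensity g x y * (vecCoord x y (J y)).im) x (coordVec x x Complex.I))

/-- The divergence of a vector field with values in `TM ⊗ Λ`. -/
def gradedDivergence {L : ℕ} (g : SurfaceMetric M)
    (J : (x : M) → TangentSpace 𝓘(ℝ, ℂ) x ⊗[ℝ] Grassmann L) (x : M) : Grassmann L :=
  ∑ I, divergence g (fun y => component ((grassmannBasis L).coord I) (J y)) x •
    grassmannBasis L I

end Surface

/-! ### Spin structures and spinors -/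

/-- A spin structure on a Riemann surface: a holomorphic line bundle `W` with a holomorphic
isomorphism `W ⊗ W ≃ T^(1,0)M`, given by its transition functions. On a neighbourhood `dom p` of `p`
there is a frame `w_p` of `W` with `w_p ⊗ w_p = ∂/∂z_p`, where `z_p` is the chart at `p`, and
`w_p = root p q * w_q`. -/
structure SpinStructure (M : Type*) [TopologicalSpace M] [ChartedSpace ℂ M] where
  dom : M → Set M
  isOpen_dom : ∀ p, IsOpen (dom p)
  mem_dom : ∀ p, p ∈ dom p
  dom_subset : ∀ p, dom p ⊆ (chartAt ℂ p).source
  root : M → M → M → ℂ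
  root_sq : ∀ p q, ∀ x ∈ dom p ∩ dom q,
    root p q x ^ 2 = deriv (chartAt ℂ q ∘ (chartAt ℂ p).symm) (chartAt ℂ p x)
  root_mul : ∀ p q r, ∀ x ∈ dom p ∩ dom q ∩ dom r, root p q x * root q r x = root p r x
  continuousOn_root : ∀ p q, ContinuousOn (root p q) (dom p ∩ dom q)

section Spinor

variable {M : Type*} [TopologicalSpace M] [ChartedSpace ℂ M]

/-- The fibre at `x` of the real spinor bundle `𝕊` (the real bundle underlying `W`). An element is
given by its coordinate in the frame `w_x`; the same spinor `c` has the coordinate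
`root x p x * c` in the frame `w_p`, and the element with coordinate `c` in the frame `w_p` is
`root p x x * c`. -/
abbrev Spinor (_σ : SpinStructure M) (_x : M) : Type := ℂ

variable (σ : SpinStructure M) {L : ℕ}

/-- A section of `𝕊 ⊗ Λ` is smooth if its real components are smooth sections of `𝕊`. -/
def IsSmoothSpinor (s : (x : M) → Spinor σ x ⊗[ℝ] Grassmann L) : Prop :=
  ∀ (ℓ : Grassmann L →ₗ[ℝ] ℝ) (p : M), ContMDiffOn 𝓘(ℝ, ℂ) 𝓘(ℝ, ℂ) ∞
    (fun x => σ.root x p x * component ℓ (s x)) (σ.dom p)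

/-- A section of `𝕊 ⊗ Λ` is holomorphic if its real components are holomorphic sections of `W`. -/
def IsHolomorphicSpinor (s : (x : M) → Spinor σ x ⊗[ℝ] Grassmann L) : Prop :=
  ∀ (ℓ : Grassmann L →ₗ[ℝ] ℝ) (p : M), MDifferentiableOn 𝓘(ℂ) 𝓘(ℂ)
    (fun x => σ.root x p x * component ℓ (s x)) (σ.dom p)

variable [IsManifold 𝓘(ℂ) ω M] (g : SurfaceMetric M)

/-- The symplectic form `ω₁` on `𝕊`. The frame `w_x` has length `ρ^(1/4)`, since
`w_x ⊗ w_x = ∂/∂z`. -/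
def spinorForm (x : M) : Spinor σ x →ₗ[ℝ] Spinor σ x →ₗ[ℝ] ℝ :=
  LinearMap.mk₂ ℝ
    (fun a b : ℂ => Real.sqrt (conformalFactor g x x) * ((starRingEnd ℂ) a * b).im)
    (fun a b c => by simp; ring) (fun r a b => by simp; ring)
    (fun a b c => by simp; ring) (fun r a b => by simp; ring)

/-- Clifford multiplication `γ(v♭)` on `𝕊`, for a tangent vector `v`. It is characterized by
`γ(v♭) s ⊗ s = |s|² v`. In an orthonormal frame `γ¹ = diag(1, -1)` and `γ² = (0 1; 1 0)`, so
`γⁱ γʲ + γʲ γⁱ = 2 δⁱʲ`. -/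
def clifford (x : M) (v : TangentSpace 𝓘(ℝ, ℂ) x) : Spinor σ x →ₗ[ℝ] Spinor σ x :=
  LinearMap.mulLeft ℝ ((Real.sqrt (conformalFactor g x x) : ℂ) * vecCoord x x v) ∘ₗ
    Complex.conjAe.toLinearMap

/-- Clifford multiplication on `𝕊 ⊗ Λ`. -/
def gradedClifford (x : M) (v : TangentSpace 𝓘(ℝ, ℂ) x) :
    Spinor σ x ⊗[ℝ] Grassmann L →ₗ[ℝ] Spinor σ x ⊗[ℝ] Grassmann L :=
  LinearMap.rTensor (Grassmann L) (clifford σ g x v)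

/-- The symplectic dual of an element `s` of `𝕊 ⊗ Λ`, namely `ω₁(s, ·)`. -/
def symplecticDual (x : M) :
    Spinor σ x ⊗[ℝ] Grassmann L →ₗ[ℝ] Spinor σ x →ₗ[ℝ] Grassmann L :=
  TensorProduct.lift (LinearMap.smulRightₗ ∘ₗ spinorForm σ g x)

/-- The real one-forms on `M`. -/
abbrev OneForm (M : Type*) [TopologicalSpace M] [ChartedSpace ℂ M] :=
  (x : M) → TangentSpace 𝓘(ℝ, ℂ) x →L[ℝ] ℝ

/-- The connection form of `∇^A = ∇^S + (1/2) A ⊗ γ¹γ²` in the frame `w_x`, at `x`. Here `∇^S` is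
the spin connection induced by the Levi-Civita connection: for `g = ρ |dz|²` the latter is
`∇ ∂/∂z = (∂_z log ρ) dz ⊗ ∂/∂z`, hence `∇^S w_x = (1/2) (∂_z log ρ) dz ⊗ w_x`; and `γ¹γ²` is the
multiplication by `-i`. -/
def connectionForm (A : OneForm M) (x : M) (v : TangentSpace 𝓘(ℝ, ℂ) x) : ℂ :=
  let dlog := dAt (fun y => Real.log (conformalFactor g x y)) x
  (1 / 2 : ℂ) *
      ((1 / 2 : ℂ) * ((dlog (coordVec x x 1) : ℂ) -
        Complex.I * (dlog (coordVec x x Complex.I) : ℂ))) * vecCoord x x v -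
    (1 / 2 : ℂ) * (A x v : ℂ) * Complex.I

/-- The covariant derivative `∇^A_v s` of a section of `𝕊`. -/
def covSpinor (A : OneForm M) (s : (x : M) → Spinor σ x) (x : M)
    (v : TangentSpace 𝓘(ℝ, ℂ) x) : Spinor σ x :=
  dAt (fun y => σ.root y x y * s y) x v + connectionForm g A x v * s x

/-- The covariant derivative `∇^A_v s` of a section of `𝕊 ⊗ Λ`. -/
def gradedCovSpinor (A : OneForm M) (s : (x : M) → Spinor σ x ⊗[ℝ] Grassmann L) (x : M)
    (v : TangentSpace 𝓘(ℝ, ℂ) x) : Spinor σ x ⊗[ℝ] Grassmann L :=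
  ∑ I, covSpinor σ g A (fun y => component ((grassmannBasis L).coord I) (s y)) x v ⊗ₜ[ℝ]
    grassmannBasis L I

/-- The projection `𝔮` of `𝕊 ⊗ T*M` onto its spin-3/2 part,
`𝔮 (σₖ ⊗ eᵏ) = (1/2) γᵏ γⁱ σₖ ⊗ eⁱ`, in terms of the components with respect to `orthoFrame`. -/
def spinThreeHalf (x : M) (z : Fin 2 → Spinor σ x ⊗[ℝ] Grassmann L) (i : Fin 2) :
    Spinor σ x ⊗[ℝ] Grassmann L :=
  (1 / 2 : ℝ) • ∑ k, gradedClifford σ g x (orthoFrame g x k)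
    (gradedClifford σ g x (orthoFrame g x i) (z k))

/-- `𝔮 (∇^S s)` for the spin connection `∇^S`. -/
def qCov (s : (x : M) → Spinor σ x ⊗[ℝ] Grassmann L) (x : M) (i : Fin 2) :
    Spinor σ x ⊗[ℝ] Grassmann L :=
  spinThreeHalf σ g x (fun k => gradedCovSpinor σ g 0 s x (orthoFrame g x k)) i

end Spinor

/-! ### Flat target manifolds and twisted spinors -/

section Target

/-- The model Euclidean space. -/
abbrev Euc (n : ℕ) : Type := EuclideanSpace ℝ (Fin n)

variable {n : ℕ} {Y : Type*} [TopologicalSpace Y] [ChartedSpace (Euc n) Y]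
  [IsManifold 𝓘(ℝ, Euc n) ∞ Y]

/-- Smooth Riemannian metrics on the target manifold. -/
abbrev TargetMetric (n : ℕ) (Y : Type*) [TopologicalSpace Y] [ChartedSpace (Euc n) Y]
    [IsManifold 𝓘(ℝ, Euc n) ∞ Y] :=
  Bundle.ContMDiffRiemannianMetric 𝓘(ℝ, Euc n) ∞ (Euc n)
    (fun y : Y => TangentSpace 𝓘(ℝ, Euc n) y)

/-- The differential at `y` of a chart of `Y`. -/
def chartDeriv (a : OpenPartialHomeomorph Y (Euc n)) (y : Y) :
    TangentSpace 𝓘(ℝ, Euc n) y →L[ℝ] Euc n :=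
  mfderiv 𝓘(ℝ, Euc n) 𝓘(ℝ, Euc n) a y

/-- The chart `a` is an isometry onto an open subset of Euclidean space. -/
def IsIsometricChart (g : TargetMetric n Y) (a : OpenPartialHomeomorph Y (Euc n)) : Prop :=
  a ∈ IsManifold.maximalAtlas 𝓘(ℝ, Euc n) ∞ Y ∧
    ∀ y ∈ a.source, ∀ v w : TangentSpace 𝓘(ℝ, Euc n) y,
      g.inner y v w = inner ℝ (chartDeriv a y v) (chartDeriv a y w)

/-- A Riemannian manifold is flat if it is locally isometric to Euclidean space. -/
def IsFlat (g : TargetMetric n Y) : Prop :=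
  ∀ y : Y, ∃ a : OpenPartialHomeomorph Y (Euc n), y ∈ a.source ∧ IsIsometricChart g a

/-- An isometric chart at `y`. -/
def flatChart {g : TargetMetric n Y} (hg : IsFlat g) (y : Y) : OpenPartialHomeomorph Y (Euc n) :=
  (hg y).choose

/-- The metric as a bilinear form, extended to the Grassmann extension of the tangent space. -/
def targetForm {L : ℕ} (g : TargetMetric n Y) (y : Y)
    (a b : TangentSpace 𝓘(ℝ, Euc n) y ⊗[ℝ] Grassmann L) : Grassmann L :=
  gradedForm (g.inner y).toLinearMap₁₂ a b

/-- Smoothness on `U` of a section `ξ` of `f^*TY ⊗ Λ`, for a map `f` into `Y`: the real components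
are smooth sections of `f^*TY`. -/
def IsSmoothAlong {L : ℕ} {E H P : Type*} [NormedAddCommGroup E] [NormedSpace ℝ E]
    [TopologicalSpace H] (I : ModelWithCorners ℝ E H) [TopologicalSpace P] [ChartedSpace H P]
    (f : P → Y) (ξ : (q : P) → TangentSpace 𝓘(ℝ, Euc n) (f q) ⊗[ℝ] Grassmann L)
    (U : Set P) : Prop :=
  ∀ ℓ : Grassmann L →ₗ[ℝ] ℝ, ContMDiffOn I 𝓘(ℝ, Euc n).tangent ∞
    (fun q => (⟨f q, component ℓ (ξ q)⟩ : TangentBundle 𝓘(ℝ, Euc n) Y)) U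

variable {M : Type*} [TopologicalSpace M] [ChartedSpace ℂ M]

/-- The sections of `φ^*TY ⊗ Λ`. -/
abbrev FieldAlong (n L : ℕ) {M Y : Type*} [TopologicalSpace Y] [ChartedSpace (Euc n) Y]
    (φ : M → Y) :=
  (x : M) → TangentSpace 𝓘(ℝ, Euc n) (φ x) ⊗[ℝ] Grassmann L

/-- The fibre at `x` of the twisted spinor bundle `E_Λ = 𝕊* ⊗ φ^*TY ⊗ Λ`. -/
abbrev Twisted (n L : ℕ) {M Y : Type*} [TopologicalSpace M] [ChartedSpace ℂ M]
    [TopologicalSpace Y] [ChartedSpace (Euc n) Y] (σ : SpinStructure M) (φ : M → Y) (x : M) :=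
  Spinor σ x →ₗ[ℝ] TangentSpace 𝓘(ℝ, Euc n) (φ x) ⊗[ℝ] Grassmann L

/-- The pullback to `φ^*TY` of the Levi-Civita connection of a flat metric: it is the ordinary
derivative in an isometric chart. -/
def covAlong {g₂ : TargetMetric n Y} (hg₂ : IsFlat g₂) (φ : M → Y)
    (ξ : (x : M) → TangentSpace 𝓘(ℝ, Euc n) (φ x)) (x : M) (v : TangentSpace 𝓘(ℝ, ℂ) x) :
    TangentSpace 𝓘(ℝ, Euc n) (φ x) :=
  (chartDeriv (flatChart hg₂ (φ x)) (φ x)).inverse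
    (dAt (fun y => chartDeriv (flatChart hg₂ (φ x)) (φ y) (ξ y)) x v)

/-- The same connection on `φ^*TY ⊗ Λ`. -/
def gradedCovAlong {L : ℕ} {g₂ : TargetMetric n Y} (hg₂ : IsFlat g₂) (φ : M → Y)
    (ξ : FieldAlong n L φ) (x : M) (v : TangentSpace 𝓘(ℝ, ℂ) x) :
    TangentSpace 𝓘(ℝ, Euc n) (φ x) ⊗[ℝ] Grassmann L :=
  ∑ I, covAlong hg₂ φ (fun y => component ((grassmannBasis L).coord I) (ξ y)) x v ⊗ₜ[ℝ]
    grassmannBasis L I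

variable [IsManifold 𝓘(ℂ) ω M] (g₁ : SurfaceMetric M) (σ : SpinStructure M) {L : ℕ}

/-- The graded inner product `(·, ·)_E = ω₁* ⊗ φ^*g₂` on the fibre of `E_Λ`. Here
`ω₁*(𝔰¹, 𝔰²) = 1` for the dual basis of the orthonormal basis of `𝕊_x` obtained from the
coordinates `1, i` by dividing by the length `ρ^(1/4)` of `w_x`. -/
def twistedForm (g₂ : TargetMetric n Y) (φ : M → Y) (x : M) (α β : Twisted n L σ φ x) :
    Grassmann L :=
  (Real.sqrt (conformalFactor g₁ x x))⁻¹ •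
    (targetForm g₂ (φ x) (α (1 : ℂ)) (β Complex.I) - targetForm g₂ (φ x) (α Complex.I) (β (1 : ℂ)))

/-- Clifford multiplication on `𝕊* ⊗ φ^*TY ⊗ Λ`, where `𝕊` acts on `𝕊*` through the symplectic
identification: `γ(v♭) (ω₁(s, ·)) = ω₁(γ(v♭) s, ·) = - ω₁(s, γ(v♭) ·)`. -/
def twistedClifford (φ : M → Y) (x : M) (v : TangentSpace 𝓘(ℝ, ℂ) x) (α : Twisted n L σ φ x) :
    Twisted n L σ φ x :=
  -(α ∘ₗ clifford σ g₁ x v)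

/-- The covariant derivative on `𝕊* ⊗ φ^*TY ⊗ Λ` induced by `∇^A` and the Levi-Civita
connection of the target: `(∇_v ψ)(S) = ∇_v (ψ(S)) - ψ(∇^A_v S)`, evaluated on the local
sections `S = c w_x`. -/
def twistedCov {g₂ : TargetMetric n Y} (hg₂ : IsFlat g₂) (A : OneForm M) (φ : M → Y)
    (ψ : (x : M) → Twisted n L σ φ x) (x : M) (v : TangentSpace 𝓘(ℝ, ℂ) x) :
    Twisted n L σ φ x :=
  Complex.basisOneI.constr ℝ fun k =>
    gradedCovAlong hg₂ φ (fun y => ψ y (σ.root x y y * Complex.basisOneI k)) x v -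
      ψ x (connectionForm g₁ A x v * Complex.basisOneI k)

/-- The twisted Dirac operator `D_A ψ = γᵏ ∇_{eₖ} ψ`. -/
def dirac {g₂ : TargetMetric n Y} (hg₂ : IsFlat g₂) (A : OneForm M) (φ : M → Y)
    (ψ : (x : M) → Twisted n L σ φ x) (x : M) : Twisted n L σ φ x :=
  ∑ k, twistedClifford g₁ σ φ x (orthoFrame g₁ x k)
    (twistedCov g₁ σ hg₂ A φ ψ x (orthoFrame g₁ x k))

/-- The `Λ`-valued Lagrangian `‖dΦ‖² + (ψ, D_A ψ)_E`. The map `Φ` is the Grassmann extension of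
`φ` displaced by the section `ξ` of `φ^*TY ⊗ Λ⁺`: as the target is flat, `Φ = φ + ξ` in isometric
charts, whence `dΦ = dφ + ∇ξ`, and `TY` and its pullbacks are identified by parallel transport.
For `ξ = 0` this is `‖dφ‖² + (ψ, D_A ψ)_E`. -/
def lagrangian {g₂ : TargetMetric n Y} (hg₂ : IsFlat g₂) (A : OneForm M) (φ : M → Y)
    (ξ : FieldAlong n L φ) (ψ : (x : M) → Twisted n L σ φ x) (x : M) : Grassmann L :=
  let dΦ := fun k : Fin 2 =>
    (mfderiv 𝓘(ℝ, ℂ) 𝓘(ℝ, Euc n) φ x (orthoFrame g₁ x k)) ⊗ₜ[ℝ] (1 : Grassmann L) +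
      gradedCovAlong hg₂ φ ξ x (orthoFrame g₁ x k)
  (∑ k, targetForm g₂ (φ x) (dΦ k) (dΦ k)) +
    twistedForm g₁ σ g₂ φ x (ψ x) (dirac g₁ σ hg₂ A φ ψ x)

/-- The functional `∫ (‖dΦ‖² + (ψ, D_A ψ)_E) dvol(g₁)`. -/
def action [CompactSpace M] [T2Space M] {g₂ : TargetMetric n Y} (hg₂ : IsFlat g₂)
    (A : OneForm M) (φ : M → Y) (ξ : FieldAlong n L φ) (ψ : (x : M) → Twisted n L σ φ x) :
    Grassmann L :=
  surfaceIntegral g₁ (lagrangian g₁ σ hg₂ A φ ξ ψ)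

/-- Smooth sections of `E_Λ`: the contraction with each local frame of `𝕊` is smooth. -/
def IsSmoothTwisted (φ : M → Y) (ψ : (x : M) → Twisted n L σ φ x) : Prop :=
  ∀ (p : M) (c : ℂ), IsSmoothAlong 𝓘(ℝ, ℂ) φ (fun x => ψ x (σ.root p x x * c)) (σ.dom p)

/-- The tensor product `s̃ ⊗ Z` in `E_Λ`, with `s̃` the symplectic dual of `s`. -/
def dualTensor (φ : M → Y) (x : M) (s : Spinor σ x ⊗[ℝ] Grassmann L)
    (Z : TangentSpace 𝓘(ℝ, Euc n) (φ x)) : Twisted n L σ φ x :=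
  TensorProduct.mk ℝ _ (Grassmann L) Z ∘ₗ symplecticDual σ g₁ x s

/-- The supersymmetry transformation `δφ = ψ(s)`. -/
def susyMap (φ : M → Y) (ψ : (x : M) → Twisted n L σ φ x)
    (s : (x : M) → Spinor σ x ⊗[ℝ] Grassmann L) : FieldAlong n L φ :=
  fun x => gradedEval (ψ x) (s x)

/-- The supersymmetry transformation `δψ = γ(dφ) s̃ = γᵏ s̃ ⊗ dφ(eₖ)`. -/
def susySpinor (φ : M → Y) (s : (x : M) → Spinor σ x ⊗[ℝ] Grassmann L) (x : M) :
    Twisted n L σ φ x :=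
  ∑ k, dualTensor g₁ σ φ x (gradedClifford σ g₁ x (orthoFrame g₁ x k) (s x))
    (mfderiv 𝓘(ℝ, ℂ) 𝓘(ℝ, Euc n) φ x (orthoFrame g₁ x k))

/-- The term `(ψ, 𝔮(∇s)~ (grad φ))_E = ∑ᵢ (ψ, (𝔮(∇s)(eᵢ))~ ⊗ dφ(eᵢ))_E`. -/
def qTerm (g₂ : TargetMetric n Y) (φ : M → Y) (ψ : (x : M) → Twisted n L σ φ x)
    (s : (x : M) → Spinor σ x ⊗[ℝ] Grassmann L) (x : M) : Grassmann L :=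
  ∑ i, twistedForm g₁ σ g₂ φ x (ψ x)
    (dualTensor g₁ σ φ x (qCov σ g₁ s x i)
      (mfderiv 𝓘(ℝ, ℂ) 𝓘(ℝ, Euc n) φ x (orthoFrame g₁ x i)))

/-- A smooth one-parameter variation `(Ξ_t, Ψ_t)` of `(φ, ψ)`, by even displacements of `φ` and by
odd twisted spinors, which to first order is given by the supersymmetry transformations. -/
structure IsSusyVariation (φ : M → Y) (ψ : (x : M) → Twisted n L σ φ x)
    (s : (x : M) → Spinor σ x ⊗[ℝ] Grassmann L)
    (Ξ : ℝ → FieldAlong n L φ) (Ψ : ℝ → (x : M) → Twisted n L σ φ x) : Prop where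
  smooth_map : IsSmoothAlong (𝓘(ℝ, ℝ).prod 𝓘(ℝ, ℂ)) (fun q : ℝ × M => φ q.2)
    (fun q => Ξ q.1 q.2) Set.univ
  smooth_spinor : ∀ (p : M) (c : ℂ), IsSmoothAlong (𝓘(ℝ, ℝ).prod 𝓘(ℝ, ℂ))
    (fun q : ℝ × M => φ q.2) (fun q => Ψ q.1 q.2 (σ.root p q.2 q.2 * c)) (Set.univ ×ˢ σ.dom p)
  even_map : ∀ t x, HasParity 0 (Ξ t x)
  odd_spinor : ∀ t x c, HasParity 1 (Ψ t x c)
  map_zero : Ξ 0 = 0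
  spinor_zero : Ψ 0 = ψ
  deriv_map : ∀ (x : M) (ℓ : TangentSpace 𝓘(ℝ, Euc n) (φ x) ⊗[ℝ] Grassmann L →ₗ[ℝ] ℝ),
    HasDerivAt (fun t => ℓ (Ξ t x)) (ℓ (susyMap σ φ ψ s x)) 0
  deriv_spinor : ∀ (x : M) (c : Spinor σ x)
    (ℓ : TangentSpace 𝓘(ℝ, Euc n) (φ x) ⊗[ℝ] Grassmann L →ₗ[ℝ] ℝ),
    HasDerivAt (fun t => ℓ (Ψ t x c)) (ℓ (susySpinor g₁ σ φ s x c)) 0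

end Target

end SusyDirac

end

open scoped Manifold ContDiff TensorProduct

set_option linter.unusedSectionVars false

noncomputable section

/-! Everything except the last integration is local. Take a holomorphic coordinate z, the frame w of
the spinor bundle with w ⊗ w = ∂/∂z, and an isometric chart of the target. Writing a, b for the two
real components of ψ along one target coordinate, the Lagrangian becomes ρ⁻¹ times the sum over
target coordinates of |∂φ|² + a(∂₁b − ∂₂a) + b(∂₁a + ∂₂b) (`lagrangian_eq`). No connection survives.
On the target side, coordinate changes between isometric charts have vanishing second derivative
(`fderiv_fderiv_eq_zero_of_isometry`). On the spinor side, a connection adds only multiples of a²,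
b² and ab + ba, which vanish for odd a, b (`spinDensity_connection`). So both A and the spin
connection drop out of the action.

Let s, t be the components of the supersymmetry parameter. Then δφ = as + bt, while δψ has
components (∂₁φ)t − (∂₂φ)s and (∂₁φ)s + (∂₂φ)t. The product rule, together with the exchange of odd
factors, is the identity `variation_eq_divergence`: the variation is the divergence of a current
plus twice an expression linear in s₁ − t₂ and t₁ + s₂, where indices denote partial derivatives.
These two are the Cauchy-Riemann expressions of s + it. The product γᵏγⁱ is complex linear and makes
𝔮(∇s) a multiple of ∂̄s; the spin connection form is of type (1,0) and is not seen by it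
(`contract_qCov`). Hence 𝔮(∇s) vanishes exactly for holomorphic s, and a comparison of constants
(`qTerm_eq`) gives the factor 4.

The local formulas glue because the transition functions of the spin structure, being continuous
square roots of holomorphic functions, are holomorphic, and because the current density has the
transformation law of ρJ (`currentDensity_change`). For holomorphic s the derivative of the
Lagrangian is then a divergence. A partition of unity reduces its integral to integrals of partial
derivatives of compactly supported functions in the plane, which are zero
(`surfaceIntegral_divergence`). Compactness permits differentiation under the integral sign
(`hasDerivAt_surfaceIntegral`), and parity passes through derivatives and integrals because it is a
linear condition. -/

namespace SusyDirac

/-! ### Grassmann algebra: signs, parity and coordinates of V ⊗ Λ. -/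

section GrassmannAlgebra

variable {L : ℕ}

theorem ι_mul_swap (v w : Fin L → ℝ) :
    ExteriorAlgebra.ι ℝ v * ExteriorAlgebra.ι ℝ w =
      -(ExteriorAlgebra.ι ℝ w * ExteriorAlgebra.ι ℝ v) :=
  eq_neg_of_add_eq_zero_left (ExteriorAlgebra.ι_add_mul_swap v w)

theorem ι_mul_of_odd (v : Fin L → ℝ) {a : Grassmann L} (ha : a ∈ parityPart L 1) :
    a * ExteriorAlgebra.ι ℝ v = -(ExteriorAlgebra.ι ℝ v * a) := by
  induction a, ha using CliffordAlgebra.odd_induction with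
  | ι w => exact ι_mul_swap w v
  | add x y hx hy ihx ihy => rw [add_mul, mul_add, ihx, ihy, neg_add]
  | ι_mul_ι_mul m₁ m₂ x hx ih =>
    have h1 := ι_mul_swap m₁ v
    have h2 := ι_mul_swap m₂ v
    change ExteriorAlgebra.ι ℝ m₁ * ExteriorAlgebra.ι ℝ m₂ * x * _ =
      -(_ * (ExteriorAlgebra.ι ℝ m₁ * ExteriorAlgebra.ι ℝ m₂ * x))
    rw [mul_assoc, ih, mul_neg, ← mul_assoc, mul_assoc (ExteriorAlgebra.ι ℝ m₁), h2, mul_neg,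
      ← mul_assoc, h1]
    simp only [neg_mul, neg_neg, mul_assoc]

/-- Odd elements of the Grassmann algebra anticommute. -/
theorem odd_mul_odd {a b : Grassmann L} (ha : a ∈ parityPart L 1) (hb : b ∈ parityPart L 1) :
    a * b = -(b * a) := by
  induction a, ha using CliffordAlgebra.odd_induction with
  | ι w => rw [← neg_eq_iff_eq_neg]; exact (ι_mul_of_odd w hb).symm
  | add x y hx hy ihx ihy => rw [add_mul, mul_add, ihx, ihy, neg_add]
  | ι_mul_ι_mul m₁ m₂ x hx ih =>
    have h1 := ι_mul_of_odd m₁ hb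
    have h2 := ι_mul_of_odd m₂ hb
    change ExteriorAlgebra.ι ℝ m₁ * ExteriorAlgebra.ι ℝ m₂ * x * b =
      -(b * (ExteriorAlgebra.ι ℝ m₁ * ExteriorAlgebra.ι ℝ m₂ * x))
    rw [mul_assoc, ih, ← mul_assoc b, ← mul_assoc b, h1, neg_mul, mul_assoc _ b, h2]
    simp only [neg_neg, mul_neg, mul_assoc]

theorem odd_mul_self {a : Grassmann L} (ha : a ∈ parityPart L 1) : a * a = 0 := by
  have h := odd_mul_odd ha ha
  have h2 : (2 : ℝ) • (a * a) = 0 := by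
    rw [two_smul]; nth_rewrite 1 [h]; exact neg_add_cancel _
  exact (smul_eq_zero.mp h2).resolve_left two_ne_zero

theorem mul_mem_parityPart {i j : ZMod 2} {a b : Grassmann L} (ha : a ∈ parityPart L i)
    (hb : b ∈ parityPart L j) : a * b ∈ parityPart L (i + j) :=
  CliffordAlgebra.evenOdd_mul_le _ i j (Submodule.mul_mem_mul ha hb)

/-- The sum 1 + 1 in `ZMod 2` reduces to 0 by computation, so no transport between parities is
needed. -/
theorem odd_mul_odd_mem {a b : Grassmann L} (ha : a ∈ parityPart L 1)
    (hb : b ∈ parityPart L 1) : a * b ∈ parityPart L 0 :=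
  mul_mem_parityPart (i := 1) (j := 1) ha hb

theorem one_mem_parityPart : (1 : Grassmann L) ∈ parityPart L 0 :=
  SetLike.GradedOne.one_mem (A := CliffordAlgebra.evenOdd (0 : QuadraticForm ℝ (Fin L → ℝ)))

/-- The coordinate of an element of `V ⊗ Λ` along a linear functional on `V`. -/
def contract {V : Type*} [AddCommGroup V] [Module ℝ V] (f : V →ₗ[ℝ] ℝ) :
    V ⊗[ℝ] Grassmann L →ₗ[ℝ] Grassmann L :=
  (TensorProduct.lid ℝ (Grassmann L)).toLinearMap ∘ₗ LinearMap.rTensor (Grassmann L) f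

variable {V : Type*} [AddCommGroup V] [Module ℝ V]

@[simp] theorem contract_tmul (f : V →ₗ[ℝ] ℝ) (v : V) (l : Grassmann L) :
    contract f (v ⊗ₜ[ℝ] l) = f v • l := by simp [contract]

@[simp] theorem component_tmul (ℓ : Grassmann L →ₗ[ℝ] ℝ) (v : V) (l : Grassmann L) :
    component ℓ (v ⊗ₜ[ℝ] l) = ℓ l • v := by simp [component]

/-- Both sides pair τ with f ⊗ ℓ. This trades the real components, in which smoothness is defined,
for the Λ-valued coordinates, in which products are computed. -/
theorem apply_contract (ℓ : Grassmann L →ₗ[ℝ] ℝ) (f : V →ₗ[ℝ] ℝ) (τ : V ⊗[ℝ] Grassmann L) :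
    ℓ (contract f τ) = f (component ℓ τ) := by
  induction τ with
  | zero => simp
  | tmul v l => simp [mul_comm]
  | add a b ha hb => simp [ha, hb]

theorem HasParity.contract_mem {i : ZMod 2} {τ : V ⊗[ℝ] Grassmann L} (h : HasParity i τ)
    (f : V →ₗ[ℝ] ℝ) : contract f τ ∈ parityPart L i := by
  obtain ⟨τ, rfl⟩ := h
  induction τ with
  | zero => simp
  | tmul v l => simpa using Submodule.smul_mem _ _ l.2
  | add a b ha hb => simpa using Submodule.add_mem _ ha hb

theorem hasParity_tmul {i : ZMod 2} (v : V) {l : Grassmann L} (h : l ∈ parityPart L i) :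
    HasParity i (v ⊗ₜ[ℝ] l) :=
  ⟨v ⊗ₜ ⟨l, h⟩, by simp⟩

theorem HasParity.add {i : ZMod 2} {a b : V ⊗[ℝ] Grassmann L} (ha : HasParity i a)
    (hb : HasParity i b) : HasParity i (a + b) := Submodule.add_mem _ ha hb

theorem HasParity.smul {i : ZMod 2} (r : ℝ) {a : V ⊗[ℝ] Grassmann L} (ha : HasParity i a) :
    HasParity i (r • a) := Submodule.smul_mem _ _ ha

theorem hasParity_sum {ι : Type*} (t : Finset ι) {i : ZMod 2} {a : ι → V ⊗[ℝ] Grassmann L}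
    (ha : ∀ k ∈ t, HasParity i (a k)) : HasParity i (∑ k ∈ t, a k) := Submodule.sum_mem _ ha

theorem hasParity_zero (i : ZMod 2) : HasParity i (0 : V ⊗[ℝ] Grassmann L) := Submodule.zero_mem _

theorem sum_coord_smul (l : Grassmann L) :
    ∑ I, (grassmannBasis L).coord I l • grassmannBasis L I = l :=
  (grassmannBasis L).sum_repr l

theorem sum_component_tmul (τ : V ⊗[ℝ] Grassmann L) :
    ∑ I, component ((grassmannBasis L).coord I) τ ⊗ₜ[ℝ] grassmannBasis L I = τ := by
  induction τ with
  | zero => simp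
  | tmul v l =>
    simp_rw [component_tmul, TensorProduct.smul_tmul]
    rw [← TensorProduct.tmul_sum, sum_coord_smul]
  | add a b ha hb =>
    simp_rw [map_add, TensorProduct.add_tmul, Finset.sum_add_distrib]
    rw [ha, hb]

theorem tensor_ext_component {a b : V ⊗[ℝ] Grassmann L}
    (h : ∀ I, component ((grassmannBasis L).coord I) a =
      component ((grassmannBasis L).coord I) b) : a = b := by
  rw [← sum_component_tmul a, ← sum_component_tmul b]; simp [h]

theorem contract_comp {V' : Type*} [AddCommGroup V'] [Module ℝ V'] (f : V' →ₗ[ℝ] ℝ)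
    (T : V →ₗ[ℝ] V') (τ : V ⊗[ℝ] Grassmann L) :
    contract f (LinearMap.rTensor (Grassmann L) T τ) = contract (f ∘ₗ T) τ := by
  induction τ with
  | zero => simp
  | tmul v l => simp
  | add a b ha hb => simp [ha, hb]

theorem contract_add (f f' : V →ₗ[ℝ] ℝ) (τ : V ⊗[ℝ] Grassmann L) :
    contract (f + f') τ = contract f τ + contract f' τ := by
  simp [contract, LinearMap.rTensor_add]

theorem contract_smul (r : ℝ) (f : V →ₗ[ℝ] ℝ) (τ : V ⊗[ℝ] Grassmann L) :
    contract (r • f) τ = r • contract f τ := by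
  simp [contract, LinearMap.rTensor_smul]

/-- The bilinear extension of a form which is a sum of products of functionals. -/
theorem gradedForm_eq_sum {ι : Type*} [Fintype ι] (B : V →ₗ[ℝ] V →ₗ[ℝ] ℝ) (f : ι → V →ₗ[ℝ] ℝ)
    (hB : ∀ v w, B v w = ∑ i, f i v * f i w) (a b : V ⊗[ℝ] Grassmann L) :
    gradedForm B a b = ∑ i, contract (f i) a * contract (f i) b := by
  induction a with
  | zero => simp [gradedForm]
  | add a a' ha ha' =>
    have : gradedForm B (a + a') b = gradedForm B a b + gradedForm B a' b := by
      simp [gradedForm, TensorProduct.add_tmul]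
    rw [this, ha, ha', ← Finset.sum_add_distrib]
    simp [add_mul]
  | tmul v l =>
    induction b with
    | zero => simp [gradedForm]
    | add b b' hb hb' =>
      have : gradedForm B (v ⊗ₜ l) (b + b') = gradedForm B (v ⊗ₜ l) b +
          gradedForm B (v ⊗ₜ l) b' := by
        simp [gradedForm, TensorProduct.tmul_add]
      rw [this, hb, hb', ← Finset.sum_add_distrib]
      simp [mul_add]
    | tmul w m =>
      simp [gradedForm, hB, Finset.sum_smul, smul_smul]
      exact Finset.sum_congr rfl fun i _ => by rw [mul_comm]

theorem contract_gradedEval {W : Type*} [AddCommGroup W] [Module ℝ W]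
    (α : W →ₗ[ℝ] V ⊗[ℝ] Grassmann L) (f : V →ₗ[ℝ] ℝ) (w : W) (l : Grassmann L) :
    contract f (gradedEval α (w ⊗ₜ l)) = contract f (α w) * l := by
  simp only [gradedEval, LinearMap.comp_apply, LinearMap.rTensor_tmul]
  induction α w with
  | zero => simp
  | add a b ha hb =>
    simp only [TensorProduct.add_tmul, map_add, add_mul, LinearEquiv.coe_coe] at ha hb ⊢
    rw [ha, hb]
  | tmul v m => simp

theorem hasParity_gradedEval {W : Type*} [AddCommGroup W] [Module ℝ W]
    {α : W →ₗ[ℝ] V ⊗[ℝ] Grassmann L} (hα : ∀ w, HasParity 1 (α w)) {τ : W ⊗[ℝ] Grassmann L}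
    (hτ : HasParity 1 τ) : HasParity 0 (gradedEval α τ) := by
  obtain ⟨τ, rfl⟩ := hτ
  induction τ with
  | zero => simpa using hasParity_zero 0
  | add a b ha hb => simpa using ha.add hb
  | tmul w l =>
    obtain ⟨u, hu⟩ := hα w
    simp only [gradedEval, LinearMap.comp_apply, LinearMap.rTensor_tmul, LinearMap.lTensor_tmul,
      ← hu]
    clear hu
    induction u with
    | zero => simpa using hasParity_zero 0
    | add a b ha hb => simpa [TensorProduct.add_tmul] using ha.add hb
    | tmul v m => simpa using hasParity_tmul v (odd_mul_odd_mem m.2 l.2)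

end GrassmannAlgebra

end SusyDirac

namespace SusyDirac

/-! ### Vector fields along maps, read in charts. -/

section TangentCharts

open Filter Topology

variable {E : Type*} [NormedAddCommGroup E] [NormedSpace ℝ E]
  {N : Type*} [TopologicalSpace N] [ChartedSpace E N] [IsManifold 𝓘(ℝ, E) ∞ N]
  {a : OpenPartialHomeomorph N E}

theorem contMDiffAt_of_mem_maximalAtlas (ha : a ∈ IsManifold.maximalAtlas 𝓘(ℝ, E) ∞ N) {y : N}
    (hy : y ∈ a.source) : ContMDiffAt 𝓘(ℝ, E) 𝓘(ℝ, E) ∞ a y :=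
  (contMDiffOn_of_mem_maximalAtlas ha).contMDiffAt (a.open_source.mem_nhds hy)

theorem contMDiffAt_symm_of_mem_maximalAtlas (ha : a ∈ IsManifold.maximalAtlas 𝓘(ℝ, E) ∞ N)
    {z : E} (hz : z ∈ a.target) : ContMDiffAt 𝓘(ℝ, E) 𝓘(ℝ, E) ∞ a.symm z :=
  (contMDiffOn_symm_of_mem_maximalAtlas ha).contMDiffAt (a.open_target.mem_nhds hz)

theorem mdifferentiable_of_mem_maximalAtlas (ha : a ∈ IsManifold.maximalAtlas 𝓘(ℝ, E) ∞ N) :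
    a.MDifferentiable 𝓘(ℝ, E) 𝓘(ℝ, E) :=
  ⟨(contMDiffOn_of_mem_maximalAtlas ha).mdifferentiableOn (by simp),
    (contMDiffOn_symm_of_mem_maximalAtlas ha).mdifferentiableOn (by simp)⟩

theorem isInvertible_mfderiv_chart (ha : a ∈ IsManifold.maximalAtlas 𝓘(ℝ, E) ∞ N) {y : N}
    (hy : y ∈ a.source) : (mfderiv 𝓘(ℝ, E) 𝓘(ℝ, E) a y).IsInvertible :=
  ⟨(mdifferentiable_of_mem_maximalAtlas ha).mfderiv hy, rfl⟩

theorem mfderiv_symm_mfderiv_chart (ha : a ∈ IsManifold.maximalAtlas 𝓘(ℝ, E) ∞ N) {y : N}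
    (hy : y ∈ a.source) (v : TangentSpace 𝓘(ℝ, E) y) :
    mfderiv 𝓘(ℝ, E) 𝓘(ℝ, E) a.symm (a y) (mfderiv 𝓘(ℝ, E) 𝓘(ℝ, E) a y v) = v :=
  DFunLike.congr_fun
    ((mdifferentiable_of_mem_maximalAtlas ha).symm_comp_deriv hy) v

variable {F H P : Type*} [NormedAddCommGroup F] [NormedSpace ℝ F] [TopologicalSpace H]
  {J : ModelWithCorners ℝ F H} [TopologicalSpace P] [ChartedSpace H P]

theorem contMDiffAt_vectorBundle_model {f : P → E} {w : P → E} {q : P} :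
    ContMDiffAt J 𝓘(ℝ, E).tangent ∞ (fun q => (⟨f q, w q⟩ : TangentBundle 𝓘(ℝ, E) E)) q ↔
      ContMDiffAt J 𝓘(ℝ, E) ∞ f q ∧ ContMDiffAt J 𝓘(ℝ, E) ∞ w q := by
  rw [Bundle.contMDiffAt_totalSpace]
  simp

/-- A section of the pullback of a tangent bundle is smooth if and only if its coordinates in a
chart are. -/
theorem contMDiffAt_tangentBundle_iff (ha : a ∈ IsManifold.maximalAtlas 𝓘(ℝ, E) ∞ N)
    {f : P → N} {v : (q : P) → TangentSpace 𝓘(ℝ, E) (f q)} {q : P} (hq : f q ∈ a.source)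
    (hf : ContMDiffAt J 𝓘(ℝ, E) ∞ f q) :
    ContMDiffAt J 𝓘(ℝ, E).tangent ∞ (fun q => (⟨f q, v q⟩ : TangentBundle 𝓘(ℝ, E) N)) q ↔
      ContMDiffAt J 𝓘(ℝ, E) ∞ (fun q => (mfderiv 𝓘(ℝ, E) 𝓘(ℝ, E) a (f q) (v q) : E)) q := by
  have hev : ∀ᶠ q' in 𝓝 q, f q' ∈ a.source :=
    hf.continuousAt (a.open_source.mem_nhds hq)
  constructor
  · intro h
    -- The tangent map of the chart is smooth over the chart's source, so composing it with the
    -- section gives a smooth map into the trivial bundle; the converse composes with the tangent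
    -- map of the inverse chart.
    have h1 := (contMDiffOn_of_mem_maximalAtlas ha).contMDiffOn_tangentMapWithin
      (m := ∞) (by simp) a.open_source.uniqueMDiffOn
    have h2 := (h1.contMDiffAt (x := (⟨f q, v q⟩ : TangentBundle 𝓘(ℝ, E) N))
      ((a.open_source.preimage (FiberBundle.continuous_proj E _)).mem_nhds hq)).comp q h
    have h3 : ContMDiffAt J 𝓘(ℝ, E).tangent ∞
        (fun q => (⟨a (f q), mfderiv 𝓘(ℝ, E) 𝓘(ℝ, E) a (f q) (v q)⟩ :
          TangentBundle 𝓘(ℝ, E) E)) q := by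
      refine h2.congr_of_eventuallyEq ?_
      filter_upwards [hev] with q' hq'
      simp only [Function.comp_apply, tangentMapWithin]
      rw [mfderivWithin_of_isOpen a.open_source hq']
    exact (contMDiffAt_vectorBundle_model.mp h3).2
  · intro h
    have h1 := (contMDiffOn_symm_of_mem_maximalAtlas ha).contMDiffOn_tangentMapWithin
      (m := ∞) (by simp) a.open_target.uniqueMDiffOn
    have h0 : ContMDiffAt J 𝓘(ℝ, E).tangent ∞
        (fun q => (⟨a (f q), mfderiv 𝓘(ℝ, E) 𝓘(ℝ, E) a (f q) (v q)⟩ :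
          TangentBundle 𝓘(ℝ, E) E)) q :=
      contMDiffAt_vectorBundle_model.mpr
        ⟨(contMDiffAt_of_mem_maximalAtlas ha hq).comp q hf, h⟩
    have h2 := (h1.contMDiffAt (x := (⟨a (f q), mfderiv 𝓘(ℝ, E) 𝓘(ℝ, E) a (f q) (v q)⟩ :
          TangentBundle 𝓘(ℝ, E) E))
      ((a.open_target.preimage (FiberBundle.continuous_proj E _)).mem_nhds
        (a.map_source hq))).comp q h0
    refine h2.congr_of_eventuallyEq ?_
    filter_upwards [hev] with q' hq'
    simp only [Function.comp_apply, tangentMapWithin]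
    rw [mfderivWithin_of_isOpen a.open_target (a.map_source hq'),
      mfderiv_symm_mfderiv_chart ha hq']
    rw [a.left_inv hq']

end TangentCharts

/-! ### Complex coordinates on the surface. -/

section SurfaceCharts

open Filter Topology

variable {M : Type*} [TopologicalSpace M] [ChartedSpace ℂ M] [IsManifold 𝓘(ℂ) ω M]

theorem chartAt_mem_maximalAtlas_real (p : M) :
    chartAt ℂ p ∈ IsManifold.maximalAtlas 𝓘(ℝ, ℂ) ∞ M :=
  IsManifold.chart_mem_maximalAtlas p

theorem isInvertible_vecCoord {p y : M} (hy : y ∈ (chartAt ℂ p).source) :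
    (vecCoord p y).IsInvertible :=
  isInvertible_mfderiv_chart (chartAt_mem_maximalAtlas_real p) hy

theorem vecCoord_coordVec {p y : M} (hy : y ∈ (chartAt ℂ p).source) (c : ℂ) :
    vecCoord p y (coordVec p y c) = c :=
  (isInvertible_vecCoord hy).self_apply_inverse c

theorem coordVec_vecCoord {p y : M} (hy : y ∈ (chartAt ℂ p).source)
    (v : TangentSpace 𝓘(ℝ, ℂ) y) : coordVec p y (vecCoord p y v) = v :=
  (isInvertible_vecCoord hy).inverse_apply_self v

theorem mdifferentiableAt_chart {p y : M} (hy : y ∈ (chartAt ℂ p).source) :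
    MDifferentiableAt 𝓘(ℝ, ℂ) 𝓘(ℝ, ℂ) (chartAt ℂ p) y :=
  (mdifferentiable_of_mem_maximalAtlas (chartAt_mem_maximalAtlas_real p)).mdifferentiableAt hy

theorem mdifferentiableAt_chart_symm {p : M} {z : ℂ} (hz : z ∈ (chartAt ℂ p).target) :
    MDifferentiableAt 𝓘(ℝ, ℂ) 𝓘(ℝ, ℂ) (chartAt ℂ p).symm z :=
  (mdifferentiable_of_mem_maximalAtlas (chartAt_mem_maximalAtlas_real p)).mdifferentiableAt_symm hz

variable {G : Type*} [NormedAddCommGroup G] [NormedSpace ℝ G]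

/-- Near y the function f factors through the chart at p, and the chain rule applies. `mfderiv` is
expressed in the preferred chart at y; here p is arbitrary, so one chart can serve a whole
neighbourhood. -/
theorem dAt_eq_fderiv {f : M → G} {p y : M} (hy : y ∈ (chartAt ℂ p).source)
    (hf : MDifferentiableAt 𝓘(ℝ, ℂ) 𝓘(ℝ, G) f y) (v : TangentSpace 𝓘(ℝ, ℂ) y) :
    dAt f y v = fderiv ℝ (f ∘ (chartAt ℂ p).symm) (chartAt ℂ p y) (vecCoord p y v) := by
  have hs := mdifferentiableAt_chart_symm ((chartAt ℂ p).map_source hy)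
  have hf' : MDifferentiableAt 𝓘(ℝ, ℂ) 𝓘(ℝ, G) f ((chartAt ℂ p).symm (chartAt ℂ p y)) := by
    rwa [(chartAt ℂ p).left_inv hy]
  have hc := hf'.comp _ hs
  have he : f =ᶠ[𝓝 y] (f ∘ (chartAt ℂ p).symm) ∘ chartAt ℂ p := by
    filter_upwards [(chartAt ℂ p).open_source.mem_nhds hy] with y' hy'
    simp [(chartAt ℂ p).left_inv hy']
  have := mfderiv_comp (I := 𝓘(ℝ, ℂ)) (I' := 𝓘(ℝ, ℂ)) (I'' := 𝓘(ℝ, G)) y hc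
    (mdifferentiableAt_chart hy)
  rw [dAt, he.mfderiv_eq, this, mfderiv_eq_fderiv]
  rfl

theorem dAt_coordVec {f : M → G} {p y : M} (hy : y ∈ (chartAt ℂ p).source)
    (hf : MDifferentiableAt 𝓘(ℝ, ℂ) 𝓘(ℝ, G) f y) (c : ℂ) :
    dAt f y (coordVec p y c) = fderiv ℝ (f ∘ (chartAt ℂ p).symm) (chartAt ℂ p y) c := by
  rw [dAt_eq_fderiv hy hf, vecCoord_coordVec hy]

theorem differentiableAt_chart_change {p q y : M} (hp : y ∈ (chartAt ℂ p).source)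
    (hq : y ∈ (chartAt ℂ q).source) :
    DifferentiableAt ℂ (chartAt ℂ q ∘ (chartAt ℂ p).symm) (chartAt ℂ p y) := by
  have h := (contDiffGroupoid ω 𝓘(ℂ)).compatible (chart_mem_atlas ℂ p) (chart_mem_atlas ℂ q)
  rw [contDiffGroupoid, mem_groupoid_of_pregroupoid] at h
  have h1 : ContDiffOn ℂ ω (chartAt ℂ q ∘ (chartAt ℂ p).symm)
      ((chartAt ℂ p).symm ≫ₕ chartAt ℂ q).source := by
    simpa [contDiffPregroupoid] using h.1
  refine (h1.contDiffAt (((chartAt ℂ p).symm ≫ₕ chartAt ℂ q).open_source.mem_nhds ?_)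
    ).differentiableAt (by simp)
  simp [hp, hq]

/-- The change of coordinates between two charts acts on tangent vectors by multiplication with
its complex derivative. -/
theorem vecCoord_eq_deriv_mul {p q y : M} (hp : y ∈ (chartAt ℂ p).source)
    (hq : y ∈ (chartAt ℂ q).source) (v : TangentSpace 𝓘(ℝ, ℂ) y) :
    vecCoord q y v =
      deriv (chartAt ℂ q ∘ (chartAt ℂ p).symm) (chartAt ℂ p y) * vecCoord p y v := by
  have h := dAt_eq_fderiv hp (mdifferentiableAt_chart hq) v
  change dAt (chartAt ℂ q) y v = _
  rw [h, (differentiableAt_chart_change hp hq).hasDerivAt.hasFDerivAt.restrictScalars ℝ |>.fderiv]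
  simp [mul_comm]

end SurfaceCharts

end SusyDirac

namespace SusyDirac

open Filter Topology

/-! ### Holomorphy of the transition functions of a spin structure. -/

section SquareRoot

/-- A continuous square root of a holomorphic function without zeros is holomorphic. -/
theorem hasDerivAt_of_sq {f h : ℂ → ℂ} {z h' : ℂ} (hf : ContinuousAt f z)
    (hsq : ∀ᶠ w in 𝓝 z, f w ^ 2 = h w) (hh : HasDerivAt h h' z) (h0 : f z ≠ 0) :
    HasDerivAt f (h' / (2 * f z)) z := by
  -- From (f w − f z)(f w + f z) = h w − h z, the slope of f is the slope of h divided by f w + f z,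
  -- which tends to 2 f z ≠ 0 by continuity.
  rw [hasDerivAt_iff_tendsto_slope] at hh ⊢
  have h1 : Tendsto (fun w => f w + f z) (𝓝[≠] z) (𝓝 (2 * f z)) := by
    have := (hf.tendsto.mono_left nhdsWithin_le_nhds : Tendsto f (𝓝[≠] z) _).add_const (f z)
    rwa [← two_mul] at this
  have h2 := hh.div h1 (mul_ne_zero two_ne_zero h0)
  refine h2.congr' ?_
  have h3 : ∀ᶠ w in 𝓝[≠] z, f w + f z ≠ 0 :=
    h1.eventually_ne (mul_ne_zero two_ne_zero h0)
  filter_upwards [h3, nhdsWithin_le_nhds hsq, self_mem_nhdsWithin] with w hw hw2 hwz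
  have hz := hsq.self_of_nhds
  have hwz' : w - z ≠ 0 := sub_ne_zero.mpr hwz
  simp only [Pi.div_apply, slope_def_field]
  rw [← hw2, ← hz]
  field_simp
  ring

end SquareRoot

section Roots

variable {M : Type*} [TopologicalSpace M] [ChartedSpace ℂ M] (σ : SpinStructure M)

theorem SpinStructure.dom_mem_nhds {p x : M} (hx : x ∈ σ.dom p) : σ.dom p ∈ 𝓝 x :=
  (σ.isOpen_dom p).mem_nhds hx

theorem deriv_chart_self {p x : M} (hx : x ∈ (chartAt ℂ p).source) :
    deriv (chartAt ℂ p ∘ (chartAt ℂ p).symm) (chartAt ℂ p x) = 1 := by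
  have : chartAt ℂ p ∘ (chartAt ℂ p).symm =ᶠ[𝓝 (chartAt ℂ p x)] id := by
    filter_upwards [(chartAt ℂ p).open_target.mem_nhds ((chartAt ℂ p).map_source hx)] with z hz
    simp [(chartAt ℂ p).right_inv hz]
  rw [this.deriv_eq, deriv_id]

/-- The square condition leaves a sign; the cocycle identity r · r = r removes it. -/
theorem root_self {p x : M} (hx : x ∈ σ.dom p) : σ.root p p x = 1 := by
  have h1 := σ.root_sq p p x ⟨hx, hx⟩
  rw [deriv_chart_self (σ.dom_subset p hx)] at h1
  have h2 := σ.root_mul p p p x ⟨⟨hx, hx⟩, hx⟩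
  rw [← h2, ← pow_two, h1]

theorem root_mul_root {p q x : M} (hp : x ∈ σ.dom p) (hq : x ∈ σ.dom q) :
    σ.root p q x * σ.root q p x = 1 := by
  rw [σ.root_mul p q p x ⟨⟨hp, hq⟩, hp⟩, root_self σ hp]

theorem root_ne_zero {p q x : M} (hp : x ∈ σ.dom p) (hq : x ∈ σ.dom q) : σ.root p q x ≠ 0 :=
  left_ne_zero_of_mul_eq_one (root_mul_root σ hp hq)

variable [IsManifold 𝓘(ℂ) ω M]

theorem vecCoord_coordVec_eq {p q x : M} (hp : x ∈ σ.dom p) (hq : x ∈ σ.dom q) (c : ℂ) :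
    vecCoord q x (coordVec p x c) = σ.root p q x ^ 2 * c := by
  rw [vecCoord_eq_deriv_mul (σ.dom_subset p hp) (σ.dom_subset q hq), σ.root_sq p q x ⟨hp, hq⟩,
    vecCoord_coordVec (σ.dom_subset p hp)]

theorem coordVec_eq_coordVec {p q x : M} (hp : x ∈ σ.dom p) (hq : x ∈ σ.dom q) (c : ℂ) :
    coordVec p x c = coordVec q x (σ.root p q x ^ 2 * c) := by
  rw [← vecCoord_coordVec_eq σ hp hq, coordVec_vecCoord (σ.dom_subset q hq)]

theorem exists_hasDerivAt_deriv_chart_change {p q y : M} (hp : y ∈ (chartAt ℂ p).source)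
    (hq : y ∈ (chartAt ℂ q).source) :
    ∃ d, HasDerivAt (deriv (chartAt ℂ q ∘ (chartAt ℂ p).symm)) d (chartAt ℂ p y) := by
  have hUo := ((chartAt ℂ p).symm ≫ₕ chartAt ℂ q).open_source
  have hz : chartAt ℂ p y ∈ ((chartAt ℂ p).symm ≫ₕ chartAt ℂ q).source := by simp [hp, hq]
  have hd : DifferentiableOn ℂ (chartAt ℂ q ∘ (chartAt ℂ p).symm)
      ((chartAt ℂ p).symm ≫ₕ chartAt ℂ q).source := by
    intro z hz
    have hz' : z ∈ (chartAt ℂ p).target ∧ (chartAt ℂ p).symm z ∈ (chartAt ℂ q).source := by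
      simpa using hz
    have := differentiableAt_chart_change (p := p) (q := q) (y := (chartAt ℂ p).symm z)
      ((chartAt ℂ p).map_target hz'.1) hz'.2
    rw [(chartAt ℂ p).right_inv hz'.1] at this
    exact this.differentiableWithinAt
  exact ⟨_, ((hd.deriv hUo).differentiableAt (hUo.mem_nhds hz)).hasDerivAt⟩

/-- A spin structure only asks for continuous roots. They are square roots of the nonvanishing
derivative of a holomorphic change of coordinate, and `hasDerivAt_of_sq` upgrades continuity to
complex differentiability. -/
theorem hasDerivAt_root {p q x : M} (hp : x ∈ σ.dom p) (hq : x ∈ σ.dom q) :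
    ∃ d, HasDerivAt (σ.root p q ∘ (chartAt ℂ p).symm) d (chartAt ℂ p x) := by
  have hps := σ.dom_subset p hp
  have hqs := σ.dom_subset q hq
  obtain ⟨d, hd⟩ := exists_hasDerivAt_deriv_chart_change hps hqs
  have hcs : ContinuousAt (chartAt ℂ p).symm (chartAt ℂ p x) :=
    (chartAt ℂ p).continuousAt_symm ((chartAt ℂ p).map_source hps)
  have hli := (chartAt ℂ p).left_inv hps
  have hnhds : σ.dom p ∩ σ.dom q ∈ 𝓝 x := inter_mem (σ.dom_mem_nhds hp) (σ.dom_mem_nhds hq)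
  refine ⟨_, hasDerivAt_of_sq (h := deriv (chartAt ℂ q ∘ (chartAt ℂ p).symm)) ?_ ?_
    hd ?_⟩
  · refine ContinuousAt.comp ?_ hcs
    rw [hli]
    exact (σ.continuousOn_root p q).continuousAt hnhds
  · have hev : ∀ᶠ z in 𝓝 (chartAt ℂ p x), (chartAt ℂ p).symm z ∈ σ.dom p ∩ σ.dom q :=
      hcs (by rwa [hli])
    filter_upwards [hev, (chartAt ℂ p).open_target.mem_nhds ((chartAt ℂ p).map_source hps)]
      with z hz hzt
    rw [Function.comp_apply, σ.root_sq p q _ hz, (chartAt ℂ p).right_inv hzt]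
  · simp only [Function.comp_apply, hli]
    exact root_ne_zero σ hp hq

theorem mdifferentiableAt_chart_complex {p x : M} (hp : x ∈ (chartAt ℂ p).source) :
    MDifferentiableAt 𝓘(ℂ) 𝓘(ℂ) (chartAt ℂ p) x := by
  have : IsManifold 𝓘(ℂ) 1 M := IsManifold.of_le (n := ω) le_top
  exact mdifferentiableAt_atlas (chart_mem_atlas ℂ p) hp

theorem contMDiffAt_root {p q x : M} (hp : x ∈ σ.dom p) (hq : x ∈ σ.dom q) :
    ContMDiffAt 𝓘(ℝ, ℂ) 𝓘(ℝ, ℂ) ∞ (σ.root p q) x := by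
  have hps := σ.dom_subset p hp
  have hcs : ContinuousAt (chartAt ℂ p).symm (chartAt ℂ p x) :=
    (chartAt ℂ p).continuousAt_symm ((chartAt ℂ p).map_source hps)
  have hli := (chartAt ℂ p).left_inv hps
  have hnhds : σ.dom p ∩ σ.dom q ∈ 𝓝 x := inter_mem (σ.dom_mem_nhds hp) (σ.dom_mem_nhds hq)
  have hev : ∀ᶠ z in 𝓝 (chartAt ℂ p x), (chartAt ℂ p).symm z ∈ σ.dom p ∩ σ.dom q :=
    hcs (by rwa [hli])
  have hd : ∀ᶠ z in 𝓝 (chartAt ℂ p x),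
      DifferentiableAt ℂ (σ.root p q ∘ (chartAt ℂ p).symm) z := by
    filter_upwards [hev, (chartAt ℂ p).open_target.mem_nhds ((chartAt ℂ p).map_source hps)]
      with z hz hzt
    obtain ⟨d, hd⟩ := hasDerivAt_root σ hz.1 hz.2
    rw [(chartAt ℂ p).right_inv hzt] at hd
    exact hd.differentiableAt
  -- Complex differentiability on a neighbourhood already gives analyticity, hence real smoothness.
  have h1 : ContDiffAt ℂ ω (σ.root p q ∘ (chartAt ℂ p).symm) (chartAt ℂ p x) :=
    (Complex.analyticAt_iff_eventually_differentiableAt.mpr hd).contDiffAt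
  have h2 : ContDiffAt ℝ ∞ (σ.root p q ∘ (chartAt ℂ p).symm) (chartAt ℂ p x) :=
    (h1.restrict_scalars ℝ).of_le le_top
  have h3 := h2.contMDiffAt.comp x
    (contMDiffAt_of_mem_maximalAtlas (chartAt_mem_maximalAtlas_real p) hps)
  refine h3.congr_of_eventuallyEq ?_
  filter_upwards [(chartAt ℂ p).open_source.mem_nhds hps] with y hy
  simp [(chartAt ℂ p).left_inv hy]

/-- The differential of a transition function of the spin structure is complex linear. -/
theorem dAt_root {p q r x : M} (hp : x ∈ σ.dom p) (hq : x ∈ σ.dom q) (hr : x ∈ σ.dom r) :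
    ∃ d : ℂ, ∀ c : ℂ, dAt (σ.root p q) x (coordVec r x c) = d * c := by
  obtain ⟨d, hd⟩ := hasDerivAt_root σ hp hq
  refine ⟨d * σ.root r p x ^ 2, fun c => ?_⟩
  rw [dAt_eq_fderiv (σ.dom_subset p hp) ((contMDiffAt_root σ hp hq).mdifferentiableAt (by simp)),
    vecCoord_coordVec_eq σ hr hp, (hd.hasFDerivAt.restrictScalars ℝ).fderiv]
  simp
  ring

theorem mdifferentiableAt_root {p q x : M} (hp : x ∈ σ.dom p) (hq : x ∈ σ.dom q) :
    MDifferentiableAt 𝓘(ℂ) 𝓘(ℂ) (σ.root p q) x := by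
  have hps := σ.dom_subset p hp
  obtain ⟨d, hd⟩ := hasDerivAt_root σ hp hq
  have h3 := hd.differentiableAt.mdifferentiableAt.comp x (mdifferentiableAt_chart_complex hps)
  refine h3.congr_of_eventuallyEq ?_
  filter_upwards [(chartAt ℂ p).open_source.mem_nhds hps] with y hy
  simp [(chartAt ℂ p).left_inv hy]

end Roots

/-! ### Conformal metrics in holomorphic coordinates. -/

section Metric

variable {M : Type*} [TopologicalSpace M] [ChartedSpace ℂ M] [IsManifold 𝓘(ℂ) ω M]
  (g : SurfaceMetric M)

theorem contMDiffAt_coordVec {p x : M} (hx : x ∈ (chartAt ℂ p).source) (c : ℂ) :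
    ContMDiffAt 𝓘(ℝ, ℂ) 𝓘(ℝ, ℂ).tangent ∞
      (fun y => (⟨y, coordVec p y c⟩ : TangentBundle 𝓘(ℝ, ℂ) M)) x := by
  refine (contMDiffAt_tangentBundle_iff (f := fun y => y) (chartAt_mem_maximalAtlas_real p) hx
    contMDiffAt_id).mpr ?_
  refine (contMDiffAt_const (c := c)).congr_of_eventuallyEq ?_
  filter_upwards [(chartAt ℂ p).open_source.mem_nhds hx] with y hy
  exact vecCoord_coordVec hy c

theorem contMDiffAt_conformalFactor {p x : M} (hx : x ∈ (chartAt ℂ p).source) :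
    ContMDiffAt 𝓘(ℝ, ℂ) 𝓘(ℝ, ℝ) ∞ (conformalFactor g p) x := by
  have : ContMDiffAt 𝓘(ℝ, ℂ) (𝓘(ℝ, ℂ).prod 𝓘(ℝ, ℝ)) ∞
      (fun m : M => Bundle.TotalSpace.mk' ℝ (E := Bundle.Trivial M ℝ) m
        (g.inner m (coordVec p m 1) (coordVec p m 1))) x := by
    apply ContMDiffAt.clm_bundle_apply₂ (F₁ := ℂ) (F₂ := ℂ)
    · exact g.contMDiff.contMDiffAt
    · exact contMDiffAt_coordVec hx 1
    · exact contMDiffAt_coordVec hx 1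
  rw [Bundle.contMDiffAt_totalSpace] at this
  exact this.2

theorem conformalFactor_pos {p x : M} (hx : x ∈ (chartAt ℂ p).source) :
    0 < conformalFactor g p x := by
  refine g.pos x _ fun h => ?_
  have := vecCoord_coordVec hx 1
  rw [h, map_zero] at this
  exact zero_ne_one this

variable {g}

theorem IsConformal.inner_eq (hg : IsConformal g) {p x : M} (hx : x ∈ (chartAt ℂ p).source)
    (c d : ℂ) : g.inner x (coordVec p x c) (coordVec p x d) =
      conformalFactor g p x * (c.re * d.re + c.im * d.im) := by
  obtain ⟨h1, h2⟩ := hg p x hx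
  have hc : ∀ c : ℂ, coordVec p x c = c.re • coordVec p x 1 + c.im • coordVec p x Complex.I := by
    intro c
    rw [← map_smul, ← map_smul, ← map_add]
    congr 1
    simp [Complex.re_add_im]
  have h3 : g.inner x (coordVec p x Complex.I) (coordVec p x 1) = 0 := by rw [g.symm, h2]
  rw [hc c, hc d]
  simp only [map_add, map_smul, add_apply, FunLike.coe_smul, Pi.smul_apply, smul_eq_mul, h2, h3,
    ← h1, conformalFactor]
  ring

theorem IsConformal.areaDensity_eq (hg : IsConformal g) {p x : M}
    (hx : x ∈ (chartAt ℂ p).source) : areaDensity g p x = conformalFactor g p x := by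
  rw [areaDensity, (hg p x hx).2, ← (hg p x hx).1]
  simp only [ne_eq, OfNat.ofNat_ne_zero, not_false_eq_true, zero_pow, sub_zero]
  exact Real.sqrt_mul_self (conformalFactor_pos g hx).le

theorem IsConformal.conformalFactor_eq (hg : IsConformal g) {p q x : M}
    (hp : x ∈ (chartAt ℂ p).source) (hq : x ∈ (chartAt ℂ q).source) :
    conformalFactor g p x = conformalFactor g q x *
      Complex.normSq (deriv (chartAt ℂ q ∘ (chartAt ℂ p).symm) (chartAt ℂ p x)) := by
  have h : coordVec p x 1 =
      coordVec q x (deriv (chartAt ℂ q ∘ (chartAt ℂ p).symm) (chartAt ℂ p x)) := by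
    rw [← coordVec_vecCoord hq (coordVec p x 1), vecCoord_eq_deriv_mul hp hq,
      vecCoord_coordVec hp, mul_one]
  rw [conformalFactor, h, hg.inner_eq hq, Complex.normSq_apply]

end Metric

end SusyDirac

namespace SusyDirac

open Filter Topology

/-! ### Local isometries of Euclidean space have vanishing second derivative. -/

section Isometry

variable {E : Type*} [NormedAddCommGroup E] [InnerProductSpace ℝ E] [FiniteDimensional ℝ E]

/-- The second derivative of a local isometry of Euclidean space vanishes. -/
theorem fderiv_fderiv_eq_zero_of_isometry {T : E → E} {z : E} (hT : ContDiffAt ℝ ∞ T z)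
    (hiso : ∀ᶠ z' in 𝓝 z, ∀ v w, inner ℝ (fderiv ℝ T z' v) (fderiv ℝ T z' w) = inner ℝ v w) :
    HasFDerivAt (fderiv ℝ T) (0 : E →L[ℝ] E →L[ℝ] E) z := by
  have hd : DifferentiableAt ℝ (fderiv ℝ T) z :=
    (hT.fderiv_right (m := 1) (by norm_cast)).differentiableAt (by simp)
  set D := fderiv ℝ (fderiv ℝ T) z with hD
  have hDf : HasFDerivAt (fderiv ℝ T) D z := hd.hasFDerivAt
  have hsymm : ∀ u v, D u v = D v u := by
    intro u v
    exact (hT.isSymmSndFDerivAt (by simpa using ENat.LEInfty.out)).eq u v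
  -- Obtained by differentiating ⟨dT v, dT w⟩ = ⟨v, w⟩ in the direction u.
  have hprod : ∀ u v w, inner ℝ (D u v) (fderiv ℝ T z w) +
      inner ℝ (D u w) (fderiv ℝ T z v) = 0 := by
    intro u v w
    have h1 : HasFDerivAt (fun z' => inner ℝ (fderiv ℝ T z' v) (fderiv ℝ T z' w)) _ z :=
      (hDf.clm_apply (hasFDerivAt_const v z)).inner ℝ (hDf.clm_apply (hasFDerivAt_const w z))
    have h2 : HasFDerivAt (fun z' => inner ℝ (fderiv ℝ T z' v) (fderiv ℝ T z' w))
        (0 : E →L[ℝ] ℝ) z := by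
      refine (hasFDerivAt_const (inner ℝ v w) z).congr_of_eventuallyEq ?_
      filter_upwards [hiso] with z' h using h v w
    have h3 := DFunLike.congr_fun (h1.unique h2) u
    simp [fderivInnerCLM_apply] at h3
    rw [real_inner_comm _ (D u w)]
    linarith
  -- The trilinear form ⟨D u v, dT w⟩ is symmetric in u, v and skew in v, w. Three cyclic
  -- permutations of the skew identity force it to vanish, as in the uniqueness proof for the
  -- Levi-Civita connection.
  have hC : ∀ u v w, inner ℝ (D u v) (fderiv ℝ T z w) = 0 := by
    intro u v w
    have e1 := hprod u v w
    have e2 := hprod w u v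
    have e3 := hprod v w u
    rw [hsymm u w] at e1
    rw [hsymm w v] at e2
    rw [hsymm v u] at e3
    linarith
  -- An injective endomorphism of a finite dimensional space is onto, so D u v is itself some dT w
  -- and is therefore orthogonal to itself.
  have hinj : Function.Injective (fderiv ℝ T z).toLinearMap := by
    rw [← LinearMap.ker_eq_bot, LinearMap.ker_eq_bot']
    intro v hv
    have h := hiso.self_of_nhds v v
    change fderiv ℝ T z v = 0 at hv
    rw [hv, inner_zero_left] at h
    exact inner_self_eq_zero.mp h.symm
  have hD0 : D = 0 := by
    ext u v
    obtain ⟨w, hw⟩ := LinearMap.surjective_of_injective hinj (D u v)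
    have h := hC u v w
    change fderiv ℝ T z w = D u v at hw
    rw [hw] at h
    simpa using h
  rwa [hD0] at hDf

end Isometry

/-! ### Isometric charts and the pulled-back flat connection. -/

section FlatCharts

variable {n L : ℕ} {Y : Type*} [TopologicalSpace Y] [ChartedSpace (Euc n) Y]
  [IsManifold 𝓘(ℝ, Euc n) ∞ Y] {g₂ : TargetMetric n Y}
  {a b : OpenPartialHomeomorph Y (Euc n)}

theorem flatChart_spec (hg₂ : IsFlat g₂) (y : Y) :
    y ∈ (flatChart hg₂ y).source ∧ IsIsometricChart g₂ (flatChart hg₂ y) :=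
  (hg₂ y).choose_spec

theorem IsIsometricChart.isInvertible (ha : IsIsometricChart g₂ a) {y : Y} (hy : y ∈ a.source) :
    (chartDeriv a y).IsInvertible :=
  isInvertible_mfderiv_chart ha.1 hy

theorem IsIsometricChart.contDiffAt_transition (ha : IsIsometricChart g₂ a)
    (hb : IsIsometricChart g₂ b) {y : Y} (hya : y ∈ a.source) (hyb : y ∈ b.source) :
    ContDiffAt ℝ ∞ (b ∘ a.symm) (a y) := by
  rw [← contMDiffAt_iff_contDiffAt]
  have h1 := contMDiffAt_symm_of_mem_maximalAtlas ha.1 (a.map_source hya)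
  have h2 : ContMDiffAt 𝓘(ℝ, Euc n) 𝓘(ℝ, Euc n) ∞ b (a.symm (a y)) := by
    rw [a.left_inv hya]
    exact contMDiffAt_of_mem_maximalAtlas hb.1 hyb
  exact h2.comp _ h1

theorem IsIsometricChart.chartDeriv_eq (ha : IsIsometricChart g₂ a)
    (hb : IsIsometricChart g₂ b) {y : Y} (hya : y ∈ a.source) (hyb : y ∈ b.source)
    (v : TangentSpace 𝓘(ℝ, Euc n) y) :
    chartDeriv b y v = fderiv ℝ (b ∘ a.symm) (a y) (chartDeriv a y v) := by
  have he : (b : Y → Euc n) =ᶠ[𝓝 y] (b ∘ a.symm) ∘ a := by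
    filter_upwards [a.open_source.mem_nhds hya] with y' hy'
    simp [a.left_inv hy']
  have h1 : MDifferentiableAt 𝓘(ℝ, Euc n) 𝓘(ℝ, Euc n) (b ∘ a.symm) (a y) :=
    ((ha.contDiffAt_transition hb hya hyb).differentiableAt (by simp)).mdifferentiableAt
  have h2 : MDifferentiableAt 𝓘(ℝ, Euc n) 𝓘(ℝ, Euc n) a y :=
    (contMDiffAt_of_mem_maximalAtlas ha.1 hya).mdifferentiableAt (by simp)
  have := mfderiv_comp (I := 𝓘(ℝ, Euc n)) (I' := 𝓘(ℝ, Euc n)) (I'' := 𝓘(ℝ, Euc n)) y h1 h2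
  rw [chartDeriv, he.mfderiv_eq, this, mfderiv_eq_fderiv]
  rfl

/-- At every point near a y the derivative of the transition is the derivative of one isometric
chart composed with the inverse of the other, hence preserves the inner product, and
`fderiv_fderiv_eq_zero_of_isometry` applies. This makes `covAlong` independent of the chart chosen
to define it. -/
theorem IsIsometricChart.hasFDerivAt_fderiv_transition (ha : IsIsometricChart g₂ a)
    (hb : IsIsometricChart g₂ b) {y : Y} (hya : y ∈ a.source) (hyb : y ∈ b.source) :
    HasFDerivAt (fderiv ℝ (b ∘ a.symm)) (0 : Euc n →L[ℝ] Euc n →L[ℝ] Euc n) (a y) := by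
  refine fderiv_fderiv_eq_zero_of_isometry (ha.contDiffAt_transition hb hya hyb) ?_
  have hS : (a.symm ≫ₕ b).source ∈ 𝓝 (a y) :=
    (a.symm ≫ₕ b).open_source.mem_nhds (by simp [hya, hyb])
  filter_upwards [hS] with z hz v w
  have hz' : z ∈ a.target ∧ a.symm z ∈ b.source := by simpa using hz
  set y' := a.symm z with hy'
  have hya' : y' ∈ a.source := a.map_target hz'.1
  have hzy : z = a y' := (a.right_inv hz'.1).symm
  have key : ∀ v, fderiv ℝ (b ∘ a.symm) z v = chartDeriv b y' ((chartDeriv a y').inverse v) := by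
    intro v
    rw [ha.chartDeriv_eq hb hya' hz'.2, ← hzy, (ha.isInvertible hya').self_apply_inverse]
  rw [key, key, ← hb.2 y' hz'.2, ha.2 y' hya', (ha.isInvertible hya').self_apply_inverse,
    (ha.isInvertible hya').self_apply_inverse]

/-- The coordinates in the chart `a` of an element of `T_y Y ⊗ Λ`. -/
def crd (a : OpenPartialHomeomorph Y (Euc n)) (y : Y) (i : Fin n) :
    TangentSpace 𝓘(ℝ, Euc n) y ⊗[ℝ] Grassmann L →ₗ[ℝ] Grassmann L :=
  contract ((EuclideanSpace.proj i : Euc n →L[ℝ] ℝ).toLinearMap ∘ₗ (chartDeriv a y).toLinearMap)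

theorem crd_tmul (a : OpenPartialHomeomorph Y (Euc n)) (y : Y) (i : Fin n)
    (v : TangentSpace 𝓘(ℝ, Euc n) y) (l : Grassmann L) :
    crd a y i (v ⊗ₜ l) = (chartDeriv a y v) i • l := by
  rw [crd, contract_tmul]
  rfl

theorem apply_crd (ℓ : Grassmann L →ₗ[ℝ] ℝ) (a : OpenPartialHomeomorph Y (Euc n)) (y : Y)
    (i : Fin n) (τ : TangentSpace 𝓘(ℝ, Euc n) y ⊗[ℝ] Grassmann L) :
    ℓ (crd a y i τ) = (chartDeriv a y (component ℓ τ)) i := by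
  rw [crd, apply_contract]
  rfl

theorem crd_eq_sum (a : OpenPartialHomeomorph Y (Euc n)) (y : Y)
    (i : Fin n) (τ : TangentSpace 𝓘(ℝ, Euc n) y ⊗[ℝ] Grassmann L) :
    crd a y i τ = ∑ I, (chartDeriv a y (component ((grassmannBasis L).coord I) τ)) i •
      grassmannBasis L I := by
  rw [← sum_coord_smul (crd a y i τ)]
  simp_rw [apply_crd]

theorem IsIsometricChart.targetForm_eq (ha : IsIsometricChart g₂ a) {y : Y} (hy : y ∈ a.source)
    (α β : TangentSpace 𝓘(ℝ, Euc n) y ⊗[ℝ] Grassmann L) :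
    targetForm g₂ y α β = ∑ i, crd a y i α * crd a y i β := by
  refine gradedForm_eq_sum _ _ (fun v w => ?_) α β
  change g₂.inner y v w = _
  rw [ha.2 y hy, PiLp.inner_apply]
  refine Finset.sum_congr rfl fun i _ => ?_
  simp [mul_comm]

section Smooth

variable {F H P : Type*} [NormedAddCommGroup F] [NormedSpace ℝ F] [TopologicalSpace H]
  {J : ModelWithCorners ℝ F H} [TopologicalSpace P] [ChartedSpace H P]

theorem contMDiffAt_euclidean_iff {w : P → Euc n} {q : P} :
    ContMDiffAt J 𝓘(ℝ, Euc n) ∞ w q ↔ ∀ i, ContMDiffAt J 𝓘(ℝ, ℝ) ∞ (fun q => w q i) q := by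
  constructor
  · intro h i
    exact (EuclideanSpace.proj (𝕜 := ℝ) i : Euc n →L[ℝ] ℝ).contMDiff.contMDiffAt.comp q h
  · intro h
    have h1 : ContMDiffAt J 𝓘(ℝ, Fin n → ℝ) ∞ (fun q => fun i => w q i) q :=
      contMDiffAt_pi_space.mpr h
    exact (EuclideanSpace.equiv (Fin n) ℝ).symm.toContinuousLinearMap.contMDiff.contMDiffAt.comp
      q h1

theorem contMDiffAt_grassmann_iff {w : P → Grassmann L} {q : P} :
    ContMDiffAt J 𝓘(ℝ, Grassmann L) ∞ w q ↔
      ∀ I, ContMDiffAt J 𝓘(ℝ, ℝ) ∞ (fun q => (grassmannBasis L).coord I (w q)) q := by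
  constructor
  · intro h I
    exact (LinearMap.toContinuousLinearMap
      ((grassmannBasis L).coord I)).contMDiff.contMDiffAt.comp q h
  · intro h
    have h1 : ContMDiffAt J 𝓘(ℝ, Grassmann L) ∞
        (fun q => ∑ I, (grassmannBasis L).coord I (w q) • grassmannBasis L I) q :=
      contMDiffAt_finsetSum fun I _ => (h I).smul contMDiffAt_const
    simpa only [sum_coord_smul] using h1

/-- A section of the Grassmann extension of a pullback of `TY` is smooth at a point. -/
def SmoothAlongAt (J : ModelWithCorners ℝ F H) (f : P → Y)
    (ξ : (q : P) → TangentSpace 𝓘(ℝ, Euc n) (f q) ⊗[ℝ] Grassmann L) (q : P) : Prop :=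
  ∀ ℓ : Grassmann L →ₗ[ℝ] ℝ, ContMDiffAt J 𝓘(ℝ, Euc n).tangent ∞
    (fun q => (⟨f q, component ℓ (ξ q)⟩ : TangentBundle 𝓘(ℝ, Euc n) Y)) q

theorem isSmoothAlong_iff {f : P → Y}
    {ξ : (q : P) → TangentSpace 𝓘(ℝ, Euc n) (f q) ⊗[ℝ] Grassmann L} {U : Set P} (hU : IsOpen U) :
    IsSmoothAlong J f ξ U ↔ ∀ q ∈ U, SmoothAlongAt J f ξ q :=
  ⟨fun h _ hq ℓ => (h ℓ).contMDiffAt (hU.mem_nhds hq),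
    fun h ℓ q hq => (h q hq ℓ).contMDiffWithinAt⟩

/-- Reduces smoothness of sections with values in TY ⊗ Λ to that of ordinary Λ-valued functions, on
which all later calculus is done. -/
theorem smoothAlongAt_iff (ha : a ∈ IsManifold.maximalAtlas 𝓘(ℝ, Euc n) ∞ Y) {f : P → Y}
    {ξ : (q : P) → TangentSpace 𝓘(ℝ, Euc n) (f q) ⊗[ℝ] Grassmann L} {q : P}
    (hf : ContMDiffAt J 𝓘(ℝ, Euc n) ∞ f q) (hq : f q ∈ a.source) :
    SmoothAlongAt J f ξ q ↔
      ∀ i, ContMDiffAt J 𝓘(ℝ, Grassmann L) ∞ (fun q => crd a (f q) i (ξ q)) q := by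
  constructor
  · intro h i
    refine contMDiffAt_grassmann_iff.mpr fun I => ?_
    have h1 := (contMDiffAt_tangentBundle_iff ha hq hf).mp (h ((grassmannBasis L).coord I))
    simp_rw [apply_crd]
    exact contMDiffAt_euclidean_iff.mp h1 i
  · intro h ℓ
    refine (contMDiffAt_tangentBundle_iff ha hq hf).mpr (contMDiffAt_euclidean_iff.mpr fun i => ?_)
    have h1 := (LinearMap.toContinuousLinearMap ℓ).contMDiff.contMDiffAt.comp q (h i)
    refine h1.congr_of_eventuallyEq (Eventually.of_forall fun q' => ?_)
    exact (apply_crd ℓ a (f q') i (ξ q')).symm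

end Smooth

section Connection

variable {M : Type*} [TopologicalSpace M] [ChartedSpace ℂ M] [IsManifold 𝓘(ℂ) ω M]
  (hg₂ : IsFlat g₂) {φ : M → Y}

/-- In the reference chart b the coordinate vector is dT, taken along a ∘ φ, applied to the
coordinate vector in a, with T = b ∘ a⁻¹. The product rule yields an extra term containing the
second derivative of T, which is zero; the remaining dT is undone by the inverse of the chart
derivative. -/
theorem IsIsometricChart.chartDeriv_covAlong (ha : IsIsometricChart g₂ a)
    {ξ : (x : M) → TangentSpace 𝓘(ℝ, Euc n) (φ x)} {x : M}
    (hφ : ContMDiffAt 𝓘(ℝ, ℂ) 𝓘(ℝ, Euc n) ∞ φ x) (hx : φ x ∈ a.source)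
    (hξ : MDifferentiableAt 𝓘(ℝ, ℂ) 𝓘(ℝ, Euc n) (fun y => chartDeriv a (φ y) (ξ y) : M → Euc n) x)
    (v : TangentSpace 𝓘(ℝ, ℂ) x) :
    chartDeriv a (φ x) (covAlong hg₂ φ ξ x v) =
      dAt (fun y => chartDeriv a (φ y) (ξ y) : M → Euc n) x v := by
  obtain ⟨hxb, hb⟩ := flatChart_spec hg₂ (φ x)
  set b := flatChart hg₂ (φ x) with hbdef
  set u : M → Euc n := fun y => chartDeriv a (φ y) (ξ y) with hu
  set T := b ∘ a.symm with hT
  have hxs := mem_chart_source ℂ x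
  have hev : (fun y => chartDeriv b (φ y) (ξ y) : M → Euc n) =ᶠ[𝓝 x]
      fun y => fderiv ℝ T (a (φ y)) (u y) := by
    have h1 := hφ.continuousAt ((a.open_source.inter b.open_source).mem_nhds ⟨hx, hxb⟩)
    filter_upwards [h1] with y hy
    exact ha.chartDeriv_eq hb hy.1 hy.2 (ξ y)
  have hs := mdifferentiableAt_chart_symm ((chartAt ℂ x).map_source hxs)
  have hli := (chartAt ℂ x).left_inv hxs
  have hv : HasFDerivAt (u ∘ (chartAt ℂ x).symm) (fderiv ℝ (u ∘ (chartAt ℂ x).symm)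
      (chartAt ℂ x x)) (chartAt ℂ x x) := by
    have : MDifferentiableAt 𝓘(ℝ, ℂ) 𝓘(ℝ, Euc n) u ((chartAt ℂ x).symm (chartAt ℂ x x)) := by
      rwa [hli]
    exact (mdifferentiableAt_iff_differentiableAt.mp (this.comp _ hs)).hasFDerivAt
  have hc : MDifferentiableAt 𝓘(ℝ, ℂ) 𝓘(ℝ, Euc n) (a ∘ φ) x :=
    ((contMDiffAt_of_mem_maximalAtlas ha.1 hx).comp x hφ).mdifferentiableAt (by simp)
  have hw : HasFDerivAt ((a ∘ φ) ∘ (chartAt ℂ x).symm) (fderiv ℝ ((a ∘ φ) ∘ (chartAt ℂ x).symm)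
      (chartAt ℂ x x)) (chartAt ℂ x x) := by
    have : MDifferentiableAt 𝓘(ℝ, ℂ) 𝓘(ℝ, Euc n) (a ∘ φ)
        ((chartAt ℂ x).symm (chartAt ℂ x x)) := by rwa [hli]
    exact (mdifferentiableAt_iff_differentiableAt.mp (this.comp _ hs)).hasFDerivAt
  have h2 : HasFDerivAt (fderiv ℝ T) (0 : Euc n →L[ℝ] Euc n →L[ℝ] Euc n)
      (((a ∘ φ) ∘ (chartAt ℂ x).symm) (chartAt ℂ x x)) := by
    simp only [Function.comp_apply, hli]
    exact ha.hasFDerivAt_fderiv_transition hb hx hxb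
  have h3 := (h2.comp _ hw).clm_apply hv
  have hmd : MDifferentiableAt 𝓘(ℝ, ℂ) 𝓘(ℝ, Euc n)
      (fun y => fderiv ℝ T (a (φ y)) (u y)) x := by
    have h4 := h3.differentiableAt.mdifferentiableAt.comp x (mdifferentiableAt_chart hxs)
    refine h4.congr_of_eventuallyEq ?_
    filter_upwards [(chartAt ℂ x).open_source.mem_nhds hxs] with y hy
    simp [(chartAt ℂ x).left_inv hy]
  have h5 : dAt (fun y => chartDeriv b (φ y) (ξ y) : M → Euc n) x v =
      fderiv ℝ T (a (φ x)) (dAt u x v) := by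
    rw [dAt, hev.mfderiv_eq, ← dAt, dAt_eq_fderiv hxs hmd, dAt_eq_fderiv hxs hξ]
    have h6 := DFunLike.congr_fun h3.fderiv (vecCoord x x v)
    refine Eq.trans h6 ?_
    simp [hli]
  rw [covAlong, h5]
  have h7 : fderiv ℝ T (a (φ x)) (dAt u x v) =
      chartDeriv b (φ x) ((chartDeriv a (φ x)).inverse (dAt u x v)) := by
    rw [ha.chartDeriv_eq hb hx hxb, (ha.isInvertible hx).self_apply_inverse]
  rw [h7, (hb.isInvertible hxb).inverse_apply_self, (ha.isInvertible hx).self_apply_inverse]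

/-- In isometric coordinates, the covariant derivative is the ordinary derivative. -/
theorem IsIsometricChart.crd_gradedCovAlong (ha : IsIsometricChart g₂ a)
    {ξ : FieldAlong n L φ} {x : M}
    (hφ : ContMDiffAt 𝓘(ℝ, ℂ) 𝓘(ℝ, Euc n) ∞ φ x) (hx : φ x ∈ a.source)
    (hξ : SmoothAlongAt 𝓘(ℝ, ℂ) φ ξ x) (v : TangentSpace 𝓘(ℝ, ℂ) x) (i : Fin n) :
    crd a (φ x) i (gradedCovAlong hg₂ φ ξ x v) = dAt (fun y => crd a (φ y) i (ξ y)) x v := by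
  have hs : ∀ I, MDifferentiableAt 𝓘(ℝ, ℂ) 𝓘(ℝ, Euc n)
      (fun y => chartDeriv a (φ y) (component ((grassmannBasis L).coord I) (ξ y)) : M → Euc n) x :=
    fun I => ((contMDiffAt_tangentBundle_iff ha.1 hx hφ).mp
      (hξ ((grassmannBasis L).coord I))).mdifferentiableAt (by simp)
  have hc : MDifferentiableAt 𝓘(ℝ, ℂ) 𝓘(ℝ, Grassmann L) (fun y => crd a (φ y) i (ξ y)) x :=
    (((smoothAlongAt_iff ha.1 hφ hx).mp hξ) i).mdifferentiableAt (by simp)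
  have hxs := mem_chart_source ℂ x
  have hli := (chartAt ℂ x).left_inv hxs
  rw [gradedCovAlong, map_sum]
  simp_rw [crd_tmul, ha.chartDeriv_covAlong hg₂ hφ hx (hs _), dAt_eq_fderiv hxs (hs _)]
  rw [dAt_eq_fderiv hxs hc]
  have hd : ∀ I, DifferentiableAt ℝ ((fun y => chartDeriv a (φ y)
      (component ((grassmannBasis L).coord I) (ξ y)) : M → Euc n) ∘ (chartAt ℂ x).symm)
      (chartAt ℂ x x) := by
    intro I
    refine mdifferentiableAt_iff_differentiableAt.mp (MDifferentiableAt.comp _ ?_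
      (mdifferentiableAt_chart_symm ((chartAt ℂ x).map_source hxs)))
    rw [hli]
    exact hs I
  have h1 := HasFDerivAt.fun_sum (u := Finset.univ) fun I _ =>
    (((EuclideanSpace.proj (𝕜 := ℝ) i : Euc n →L[ℝ] ℝ).hasFDerivAt.comp _
      (hd I).hasFDerivAt).smul_const (grassmannBasis L I))
  have h2 := (h1.congr_of_eventuallyEq (f₁ := (fun y => crd a (φ y) i (ξ y)) ∘
    (chartAt ℂ x).symm) (Eventually.of_forall fun z => crd_eq_sum _ _ _ _)).fderiv
  rw [h2]
  simp

end Connection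

end FlatCharts

end SusyDirac

namespace SusyDirac

open Filter Topology

/-! ### Sum, product and chain rules for `dAt`. -/

section Derivative

variable {M : Type*} [TopologicalSpace M] [ChartedSpace ℂ M] [IsManifold 𝓘(ℂ) ω M]
  {G G' G'' : Type*} [NormedAddCommGroup G] [NormedSpace ℝ G] [NormedAddCommGroup G']
  [NormedSpace ℝ G'] [NormedAddCommGroup G''] [NormedSpace ℝ G'']

theorem dAt_congr {f f' : M → G} {y : M} (h : f =ᶠ[𝓝 y] f') : dAt f y = dAt f' y := by
  rw [dAt, h.mfderiv_eq]; rfl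

theorem hasFDerivAt_comp_chart_symm {f : M → G} {p y : M} (hy : y ∈ (chartAt ℂ p).source)
    (hf : MDifferentiableAt 𝓘(ℝ, ℂ) 𝓘(ℝ, G) f y) :
    HasFDerivAt (f ∘ (chartAt ℂ p).symm) (fderiv ℝ (f ∘ (chartAt ℂ p).symm) (chartAt ℂ p y))
      (chartAt ℂ p y) := by
  have : MDifferentiableAt 𝓘(ℝ, ℂ) 𝓘(ℝ, G) f ((chartAt ℂ p).symm (chartAt ℂ p y)) := by
    rwa [(chartAt ℂ p).left_inv hy]
  exact (mdifferentiableAt_iff_differentiableAt.mp (this.comp _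
    (mdifferentiableAt_chart_symm ((chartAt ℂ p).map_source hy)))).hasFDerivAt

theorem mdifferentiableAt_of_comp_chart_symm {f : M → G} {p y : M}
    (hy : y ∈ (chartAt ℂ p).source)
    (hf : DifferentiableAt ℝ (f ∘ (chartAt ℂ p).symm) (chartAt ℂ p y)) :
    MDifferentiableAt 𝓘(ℝ, ℂ) 𝓘(ℝ, G) f y := by
  refine (hf.mdifferentiableAt.comp y (mdifferentiableAt_chart hy)).congr_of_eventuallyEq ?_
  filter_upwards [(chartAt ℂ p).open_source.mem_nhds hy] with y' hy'
  simp [(chartAt ℂ p).left_inv hy']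

theorem dAt_of_hasFDerivAt {f : M → G} {p y : M} (hy : y ∈ (chartAt ℂ p).source)
    {f' : ℂ →L[ℝ] G} (hf : HasFDerivAt (f ∘ (chartAt ℂ p).symm) f' (chartAt ℂ p y))
    (v : TangentSpace 𝓘(ℝ, ℂ) y) : dAt f y v = f' (vecCoord p y v) := by
  rw [dAt_eq_fderiv hy (mdifferentiableAt_of_comp_chart_symm hy hf.differentiableAt), hf.fderiv]

theorem dAt_bilinear (B : G →L[ℝ] G' →L[ℝ] G'') {f : M → G} {f' : M → G'} {y : M}
    (hf : MDifferentiableAt 𝓘(ℝ, ℂ) 𝓘(ℝ, G) f y)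
    (hf' : MDifferentiableAt 𝓘(ℝ, ℂ) 𝓘(ℝ, G') f' y) (v : TangentSpace 𝓘(ℝ, ℂ) y) :
    dAt (fun y => B (f y) (f' y)) y v = B (f y) (dAt f' y v) + B (dAt f y v) (f' y) := by
  have hy := mem_chart_source ℂ y
  have h := B.hasFDerivAt_of_bilinear (hasFDerivAt_comp_chart_symm hy hf)
    (hasFDerivAt_comp_chart_symm hy hf')
  rw [dAt_of_hasFDerivAt (f := fun y => B (f y) (f' y)) hy h, dAt_eq_fderiv hy hf,
    dAt_eq_fderiv hy hf']
  simp [(chartAt ℂ y).left_inv hy]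

theorem dAt_smul {f : M → ℝ} {F : M → G} {y : M}
    (hf : MDifferentiableAt 𝓘(ℝ, ℂ) 𝓘(ℝ, ℝ) f y)
    (hF : MDifferentiableAt 𝓘(ℝ, ℂ) 𝓘(ℝ, G) F y) (v : TangentSpace 𝓘(ℝ, ℂ) y) :
    dAt (fun y => f y • F y) y v = f y • dAt F y v + dAt f y v • F y :=
  dAt_bilinear (ContinuousLinearMap.lsmul ℝ ℝ) hf hF v

theorem dAt_clm (T : G →L[ℝ] G') {f : M → G} {y : M}
    (hf : MDifferentiableAt 𝓘(ℝ, ℂ) 𝓘(ℝ, G) f y) (v : TangentSpace 𝓘(ℝ, ℂ) y) :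
    dAt (fun y => T (f y)) y v = T (dAt f y v) := by
  have hy := mem_chart_source ℂ y
  have h := T.hasFDerivAt.comp _ (hasFDerivAt_comp_chart_symm hy hf)
  rw [dAt_of_hasFDerivAt (f := fun y => T (f y)) hy h, dAt_eq_fderiv hy hf]
  simp

theorem dAt_add {f f' : M → G} {y : M} (hf : MDifferentiableAt 𝓘(ℝ, ℂ) 𝓘(ℝ, G) f y)
    (hf' : MDifferentiableAt 𝓘(ℝ, ℂ) 𝓘(ℝ, G) f' y) (v : TangentSpace 𝓘(ℝ, ℂ) y) :
    dAt (fun y => f y + f' y) y v = dAt f y v + dAt f' y v := by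
  have hy := mem_chart_source ℂ y
  have h := (hasFDerivAt_comp_chart_symm hy hf).add (hasFDerivAt_comp_chart_symm hy hf')
  rw [dAt_of_hasFDerivAt (f := fun y => f y + f' y) hy h, dAt_eq_fderiv hy hf,
    dAt_eq_fderiv hy hf']
  simp

end Derivative

/-! ### The Dirac density and its invariances. -/

section SpinDensity

variable {L : ℕ}

/-- The Dirac Lagrangian of a spinor with real components `a`, `b`, whose partial derivatives are
`a₁`, `a₂`, `b₁`, `b₂`. -/
def spinDensity (a b a₁ a₂ b₁ b₂ : Grassmann L) : Grassmann L :=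
  a * (b₁ - a₂) + b * (a₁ + b₂)

/-- The coefficients κ.im and κ'.re only multiply a² or b², and κ.re and κ'.im only multiply ab +
ba; all of these vanish for odd a, b. Since κ and κ' are arbitrary, no connection of this kind
contributes to the Lagrangian. -/
theorem spinDensity_connection {a b : Grassmann L} (ha : a ∈ parityPart L 1)
    (hb : b ∈ parityPart L 1) (a₁ a₂ b₁ b₂ : Grassmann L) (κ κ' : ℂ) :
    spinDensity a b (a₁ - (κ.re • a + κ.im • b)) (a₂ - (κ'.re • a + κ'.im • b))
      (b₁ - (-κ.im • a + κ.re • b)) (b₂ - (-κ'.im • a + κ'.re • b)) =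
      spinDensity a b a₁ a₂ b₁ b₂ := by
  simp only [spinDensity, mul_add, mul_sub, mul_smul_comm, odd_mul_self ha, odd_mul_self hb,
    odd_mul_odd hb ha]
  module

/-- This is the change of frame by a factor r, with t = r² acting on the coordinate vectors. The
terms with d₁, d₂ come from differentiating r and vanish as connection terms do. The two spinor
factors contribute |r|² and the derivative |t|, for a total of |t|². -/
theorem spinDensity_frame {a b : Grassmann L} (ha : a ∈ parityPart L 1)
    (hb : b ∈ parityPart L 1) (a₁ a₂ b₁ b₂ : Grassmann L) (r₁ r₂ t₁ t₂ d₁ d₂ : ℝ)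
    (h₁ : t₁ = r₁ ^ 2 - r₂ ^ 2) (h₂ : t₂ = 2 * r₁ * r₂) :
    spinDensity (r₁ • a + r₂ • b) (-r₂ • a + r₁ • b)
      (d₁ • a + d₂ • b + (r₁ • (t₁ • a₁ + t₂ • a₂) + r₂ • (t₁ • b₁ + t₂ • b₂)))
      (-d₂ • a + d₁ • b + (r₁ • (-t₂ • a₁ + t₁ • a₂) + r₂ • (-t₂ • b₁ + t₁ • b₂)))
      (-d₂ • a + d₁ • b + (-r₂ • (t₁ • a₁ + t₂ • a₂) + r₁ • (t₁ • b₁ + t₂ • b₂)))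
      (-d₁ • a + -d₂ • b + (-r₂ • (-t₂ • a₁ + t₁ • a₂) + r₁ • (-t₂ • b₁ + t₁ • b₂))) =
      (t₁ ^ 2 + t₂ ^ 2) • spinDensity a b a₁ a₂ b₁ b₂ := by
  subst h₁ h₂
  simp only [spinDensity, mul_add, mul_sub, add_mul, mul_smul_comm, smul_mul_assoc,
    odd_mul_self ha, odd_mul_self hb, odd_mul_odd hb ha]
  module

end SpinDensity

/-! ### The Lagrangian in local coordinates. -/

section Lagrangian

variable {n L : ℕ} {Y : Type*} [TopologicalSpace Y] [ChartedSpace (Euc n) Y]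
  [IsManifold 𝓘(ℝ, Euc n) ∞ Y]
  {a : OpenPartialHomeomorph Y (Euc n)}
  {M : Type*} [TopologicalSpace M] [ChartedSpace ℂ M]
  (σ : SpinStructure M) {φ : M → Y}

/-- The coordinates in an isometric chart of the displaced map `φ + ξ`. -/
def mapCrd (a : OpenPartialHomeomorph Y (Euc n)) (ξ : FieldAlong n L φ) (i : Fin n) (y : M) :
    Grassmann L :=
  (a (φ y)) i • (1 : Grassmann L) + crd a (φ y) i (ξ y)

/-- The components of a twisted spinor in the frame `w_p` and an isometric chart. -/
def spinorCrd (a : OpenPartialHomeomorph Y (Euc n)) (p : M) (ψ : (x : M) → Twisted n L σ φ x)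
    (c : ℂ) (i : Fin n) (y : M) : Grassmann L :=
  crd a (φ y) i (ψ y (σ.root p y y * c : ℂ))

theorem spinorCrd_odd {p : M} {ψ : (x : M) → Twisted n L σ φ x}
    (hψ : ∀ x c, HasParity 1 (ψ x c)) (c : ℂ) (i : Fin n) (y : M) :
    spinorCrd σ a p ψ c i y ∈ parityPart L 1 :=
  (hψ _ _).contract_mem _

theorem crd_spinor_eq (ψ : (x : M) → Twisted n L σ φ x) (y : M) (i : Fin n) (c : ℂ) :
    crd a (φ y) i (ψ y c) = c.re • crd a (φ y) i (ψ y (1 : ℂ)) +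
      c.im • crd a (φ y) i (ψ y Complex.I) := by
  have h : (c : ℂ) = c.re • (1 : ℂ) + c.im • Complex.I := by simp [Complex.re_add_im]
  conv_lhs => rw [h]
  rw [← map_smul, ← map_smul, ← map_smul, ← map_smul, ← map_add, ← map_add]

theorem spinorCrd_change {p q y : M} (hp : y ∈ σ.dom p) (hq : y ∈ σ.dom q)
    (ψ : (x : M) → Twisted n L σ φ x) (i : Fin n) (c : ℂ) :
    spinorCrd σ a p ψ c i y = (σ.root p q y * c).re • spinorCrd σ a q ψ 1 i y +
      (σ.root p q y * c).im • spinorCrd σ a q ψ Complex.I i y := by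
  have h : σ.root p y y * c = σ.root q y y * (σ.root p q y * c) := by
    rw [← σ.root_mul p q y y ⟨⟨hp, hq⟩, σ.mem_dom y⟩]; ring
  have h' : ∀ d : ℂ, σ.root q y y * d = d.re • (σ.root q y y * 1) +
      d.im • (σ.root q y y * Complex.I) := by
    intro d
    conv_lhs => rw [← Complex.re_add_im d]
    simp only [Complex.real_smul]
    ring
  rw [spinorCrd, h, h']
  rw [map_add, map_smul, map_smul, map_add, map_smul, map_smul]
  rfl

theorem spinorCrd_self (ψ : (x : M) → Twisted n L σ φ x) (c : ℂ) (i : Fin n) (y : M) :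
    spinorCrd σ a y ψ c i y = crd a (φ y) i (ψ y c) := by
  rw [spinorCrd, root_self σ (σ.mem_dom y), one_mul]

variable [IsManifold 𝓘(ℂ) ω M]

/-- The Lagrangian density in the frame `w_p`, the chart of `M` at `p`, and an isometric chart. -/
def localDensity (a : OpenPartialHomeomorph Y (Euc n)) (p : M) (ξ : FieldAlong n L φ)
    (ψ : (x : M) → Twisted n L σ φ x) (y : M) : Grassmann L :=
  ∑ i, ((∑ k, dAt (mapCrd a ξ i) y (coordVec p y (direction k)) *
      dAt (mapCrd a ξ i) y (coordVec p y (direction k))) +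
    spinDensity (spinorCrd σ a p ψ 1 i y) (spinorCrd σ a p ψ Complex.I i y)
      (dAt (spinorCrd σ a p ψ 1 i) y (coordVec p y 1))
      (dAt (spinorCrd σ a p ψ 1 i) y (coordVec p y Complex.I))
      (dAt (spinorCrd σ a p ψ Complex.I i) y (coordVec p y 1))
      (dAt (spinorCrd σ a p ψ Complex.I i) y (coordVec p y Complex.I)))

variable (ha : a ∈ IsManifold.maximalAtlas 𝓘(ℝ, Euc n) ∞ Y)
  (hφ : ContMDiff 𝓘(ℝ, ℂ) 𝓘(ℝ, Euc n) ∞ φ)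

include ha hφ in
theorem contMDiffAt_spinorCrd {ψ : (x : M) → Twisted n L σ φ x} (hψ : IsSmoothTwisted σ φ ψ)
    {p y : M} (hp : y ∈ σ.dom p) (hy : φ y ∈ a.source) (c : ℂ) (i : Fin n) :
    ContMDiffAt 𝓘(ℝ, ℂ) 𝓘(ℝ, Grassmann L) ∞ (spinorCrd σ a p ψ c i) y :=
  (smoothAlongAt_iff ha hφ.contMDiffAt hy).mp
    ((isSmoothAlong_iff (σ.isOpen_dom p)).mp (hψ p c) y hp) i

include ha hφ in
theorem contMDiffAt_chart_coord {y : M} (hy : φ y ∈ a.source) (i : Fin n) :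
    ContMDiffAt 𝓘(ℝ, ℂ) 𝓘(ℝ, ℝ) ∞ (fun y => a (φ y) i) y :=
  contMDiffAt_euclidean_iff.mp
    ((contMDiffAt_of_mem_maximalAtlas ha hy).comp y hφ.contMDiffAt) i

include ha hφ in
theorem contMDiffAt_mapCrd {ξ : FieldAlong n L φ} {y : M} (hξ : SmoothAlongAt 𝓘(ℝ, ℂ) φ ξ y)
    (hy : φ y ∈ a.source) (i : Fin n) :
    ContMDiffAt 𝓘(ℝ, ℂ) 𝓘(ℝ, Grassmann L) ∞ (mapCrd a ξ i) y :=
  ((contMDiffAt_chart_coord ha hφ hy i).smul (contMDiffAt_const (c := (1 : Grassmann L)))).add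
    ((smoothAlongAt_iff ha hφ.contMDiffAt hy).mp hξ i)

include ha hφ in
theorem chartDeriv_mfderiv {y : M} (hy : φ y ∈ a.source) (v : TangentSpace 𝓘(ℝ, ℂ) y)
    (i : Fin n) :
    (chartDeriv a (φ y) (mfderiv 𝓘(ℝ, ℂ) 𝓘(ℝ, Euc n) φ y v)) i =
      dAt (fun y => a (φ y) i) y v := by
  have hay := contMDiffAt_of_mem_maximalAtlas ha hy
  have h1 : dAt (fun y => a (φ y) i) y v = (dAt (a ∘ φ) y v) i :=
    dAt_clm (EuclideanSpace.proj (𝕜 := ℝ) i : Euc n →L[ℝ] ℝ)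
      ((hay.comp y hφ.contMDiffAt).mdifferentiableAt (by simp)) v
  rw [h1, dAt, mfderiv_comp (I' := 𝓘(ℝ, Euc n)) y (hay.mdifferentiableAt (by simp))
    (hφ.contMDiffAt.mdifferentiableAt (by simp))]
  rfl

theorem orthoFrame_eq (g₁ : SurfaceMetric M) (y : M) (k : Fin 2) :
    orthoFrame g₁ y k = (Real.sqrt (conformalFactor g₁ y y))⁻¹ • coordVec y y (direction k) := rfl

theorem sqrt_conformalFactor_pos (g₁ : SurfaceMetric M) (y : M) :
    0 < Real.sqrt (conformalFactor g₁ y y) :=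
  Real.sqrt_pos.mpr (conformalFactor_pos g₁ (mem_chart_source ℂ y))

/-- The √ρ in `clifford` cancels the normalisation of the orthonormal frame, leaving complex
conjugation followed by multiplication by 1 or i. -/
theorem clifford_orthoFrame (g₁ : SurfaceMetric M) (y : M) (k : Fin 2) (c : ℂ) :
    clifford σ g₁ y (orthoFrame g₁ y k) c = direction k * (starRingEnd ℂ) c := by
  have h0 := sqrt_conformalFactor_pos g₁ y
  have h1 : ((Real.sqrt (conformalFactor g₁ y y) : ℝ) : ℂ) ≠ 0 := by exact_mod_cast h0.ne'
  have h : vecCoord y y (orthoFrame g₁ y k) =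
      (Real.sqrt (conformalFactor g₁ y y))⁻¹ • direction k := by
    rw [orthoFrame_eq, map_smul, vecCoord_coordVec (mem_chart_source ℂ y)]
  change ((Real.sqrt (conformalFactor g₁ y y) : ℂ) * vecCoord y y (orthoFrame g₁ y k)) *
    (starRingEnd ℂ) c = _
  rw [h, Complex.real_smul, Complex.ofReal_inv, mul_inv_cancel_left₀ h1]

variable {g₂ : TargetMetric n Y} (hg₂ : IsFlat g₂) (g₁ : SurfaceMetric M) (A : OneForm M)

include hφ in
theorem crd_twistedCov (hai : IsIsometricChart g₂ a) {ψ : (x : M) → Twisted n L σ φ x}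
    (hψ : IsSmoothTwisted σ φ ψ) {y : M} (hy : φ y ∈ a.source) (v : TangentSpace 𝓘(ℝ, ℂ) y)
    (k : Fin 2) (i : Fin n) :
    crd a (φ y) i (twistedCov g₁ σ hg₂ A φ ψ y v (Complex.basisOneI k)) =
      dAt (spinorCrd σ a y ψ (Complex.basisOneI k) i) y v -
        crd a (φ y) i (ψ y (connectionForm g₁ A y v * Complex.basisOneI k : ℂ)) := by
  have h : twistedCov g₁ σ hg₂ A φ ψ y v (Complex.basisOneI k) =
    gradedCovAlong hg₂ φ (fun y' => ψ y' (σ.root y y' y' * Complex.basisOneI k : ℂ)) y v -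
      ψ y (connectionForm g₁ A y v * Complex.basisOneI k : ℂ) :=
    Module.Basis.constr_basis _ _ _ _
  rw [h, map_sub, hai.crd_gradedCovAlong hg₂ hφ.contMDiffAt hy
    ((isSmoothAlong_iff (σ.isOpen_dom y)).mp (hψ y _) y (σ.mem_dom y))]
  rfl

theorem dirac_apply (ψ : (x : M) → Twisted n L σ φ x) (y : M) (c : ℂ) :
    dirac g₁ σ hg₂ A φ ψ y c = -∑ k, twistedCov g₁ σ hg₂ A φ ψ y (orthoFrame g₁ y k)
      (direction k * (starRingEnd ℂ) c : ℂ) := by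
  rw [dirac, LinearMap.sum_apply, ← Finset.sum_neg_distrib]
  refine Finset.sum_congr rfl fun k _ => ?_
  rw [twistedClifford, LinearMap.neg_apply, LinearMap.comp_apply, clifford_orthoFrame]

include hφ in
-- In the point's own frame the transition function is 1. The map term carries 1/√ρ from each of its
-- two frame vectors; the spinor term carries one from the frame vector in the Dirac operator and
-- one from `twistedForm`. Both give ρ⁻¹. The connection terms vanish by `spinDensity_connection`.
theorem lagrangian_eq_own (hai : IsIsometricChart g₂ a) {ξ : FieldAlong n L φ}
    {ψ : (x : M) → Twisted n L σ φ x}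
    (hψ : IsSmoothTwisted σ φ ψ) (hodd : ∀ x c, HasParity 1 (ψ x c)) {y : M}
    (hξ : SmoothAlongAt 𝓘(ℝ, ℂ) φ ξ y) (hy : φ y ∈ a.source) :
    lagrangian g₁ σ hg₂ A φ ξ ψ y =
      (conformalFactor g₁ y y)⁻¹ • localDensity σ a y ξ ψ y := by
  set s := Real.sqrt (conformalFactor g₁ y y) with hs
  have hs0 : 0 < s := sqrt_conformalFactor_pos g₁ y
  have hss : (conformalFactor g₁ y y)⁻¹ = s⁻¹ * s⁻¹ := by
    rw [← mul_inv, hs, Real.mul_self_sqrt (conformalFactor_pos g₁ (mem_chart_source ℂ y)).le]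
  have hmap : ∀ i v, crd a (φ y) i ((mfderiv 𝓘(ℝ, ℂ) 𝓘(ℝ, Euc n) φ y v) ⊗ₜ[ℝ] (1 : Grassmann L) +
      gradedCovAlong hg₂ φ ξ y v) = dAt (mapCrd a ξ i) y v := by
    intro i v
    have h1 := (contMDiffAt_chart_coord hai.1 hφ hy i).mdifferentiableAt (n := ∞) (by simp)
    have h2 := ((smoothAlongAt_iff hai.1 hφ.contMDiffAt hy).mp hξ i).mdifferentiableAt
      (n := ∞) (by simp)
    have h3 : dAt (fun y => (a (φ y)) i • (1 : Grassmann L)) y v =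
        dAt (fun y => a (φ y) i) y v • (1 : Grassmann L) :=
      dAt_clm ((ContinuousLinearMap.id ℝ ℝ).smulRight (1 : Grassmann L)) h1 v
    have h4 : MDifferentiableAt 𝓘(ℝ, ℂ) 𝓘(ℝ, Grassmann L)
        (fun y => (a (φ y)) i • (1 : Grassmann L)) y :=
      ((contMDiffAt_chart_coord hai.1 hφ hy i).smul
        (contMDiffAt_const (c := (1 : Grassmann L)))).mdifferentiableAt
        (n := ∞) (by simp)
    rw [map_add, crd_tmul, chartDeriv_mfderiv hai.1 hφ hy, hai.crd_gradedCovAlong hg₂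
      hφ.contMDiffAt hy hξ]
    change _ = dAt (fun y => (a (φ y)) i • (1 : Grassmann L) + crd a (φ y) i (ξ y)) y v
    rw [dAt_add h4 h2, h3]
  have hcov : ∀ (k : Fin 2) (i : Fin n) (v : TangentSpace 𝓘(ℝ, ℂ) y),
      crd a (φ y) i (twistedCov g₁ σ hg₂ A φ ψ y v (Complex.basisOneI k)) = _ :=
    fun k i v => crd_twistedCov σ hφ hg₂ g₁ A hai hψ hy v k i
  have hcov0 := hcov 0
  have hcov1 := hcov 1
  simp only [Complex.coe_basisOneI, Matrix.cons_val_zero, Matrix.cons_val_one] at hcov0 hcov1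
  simp only [lagrangian, hai.targetForm_eq hy, twistedForm]
  simp only [hmap, dirac_apply, Fin.sum_univ_two]
  have hd0 : direction 0 = 1 := rfl
  have hd1 : direction 1 = Complex.I := rfl
  have hI1 : Complex.I * (starRingEnd ℂ) Complex.I = 1 := by simp
  have hI0 : (1 : ℂ) * (starRingEnd ℂ) Complex.I = -Complex.I := by simp
  have h11 : (1 : ℂ) * (starRingEnd ℂ) 1 = 1 := by simp
  have h12 : Complex.I * (starRingEnd ℂ) 1 = Complex.I := by simp
  simp only [hd0, hd1, hI1, hI0, h11, h12, map_neg, map_add]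
  rw [localDensity, Finset.smul_sum, ← Finset.sum_sub_distrib, ← Finset.sum_add_distrib,
    Finset.smul_sum, ← Finset.sum_add_distrib]
  refine Finset.sum_congr rfl fun i _ => ?_
  rw [hcov0, hcov0, hcov1, hcov1, hss, orthoFrame_eq, orthoFrame_eq, hd0, hd1]
  simp only [map_smul, Fin.sum_univ_two, hd0, hd1, ← hs]
  have ho1 : spinorCrd σ a y ψ 1 i y ∈ parityPart L 1 := spinorCrd_odd σ hodd 1 i y
  have ho2 : spinorCrd σ a y ψ Complex.I i y ∈ parityPart L 1 := spinorCrd_odd σ hodd _ i y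
  have hk : ∀ κ : ℂ, crd a (φ y) i (ψ y (κ * 1 : ℂ)) =
      κ.re • spinorCrd σ a y ψ 1 i y + κ.im • spinorCrd σ a y ψ Complex.I i y := by
    intro κ
    rw [crd_spinor_eq, spinorCrd_self, spinorCrd_self, mul_one]
  have hk' : ∀ κ : ℂ, crd a (φ y) i (ψ y (κ * Complex.I : ℂ)) =
      -κ.im • spinorCrd σ a y ψ 1 i y + κ.re • spinorCrd σ a y ψ Complex.I i y := by
    intro κ
    rw [crd_spinor_eq, spinorCrd_self, spinorCrd_self]
    simp
  simp only [hk, hk', ← spinorCrd_self σ (a := a)]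
  -- Connection terms are inserted on the right so that the two sides can be matched.
  -- `connectionForm` is not bundled as a linear map, so multiplying its value by s stands in for
  -- pulling s⁻¹ out of its argument.
  rw [← spinDensity_connection ho1 ho2 _ _ _ _
    (s • connectionForm g₁ A y (s⁻¹ • coordVec y y 1))
    (s • connectionForm g₁ A y (s⁻¹ • coordVec y y Complex.I))]
  simp only [spinDensity, mul_add, mul_sub, mul_smul_comm, smul_mul_assoc,
    odd_mul_self ho1, odd_mul_self ho2, odd_mul_odd ho2 ho1, mul_neg, Complex.real_smul,
    Complex.re_ofReal_mul, Complex.im_ofReal_mul]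
  module

omit [IsManifold 𝓘(ℂ) ω M] in
theorem coordVec_add_smul {p y : M} (t₁ t₂ : ℝ) :
    coordVec p y (⟨t₁, t₂⟩ : ℂ) = t₁ • coordVec p y 1 + t₂ • coordVec p y Complex.I := by
  rw [← map_smul, ← map_smul, ← map_add]
  congr 1
  apply Complex.ext <;> simp

include ha hφ in
-- Coordinate vectors change by r² and spinor components by r. The map term is quadratic in
-- derivatives and scales by |r²|²; `spinDensity_frame` gives the same scale for the spinor term,
-- the derivative of r dropping out.
theorem localDensity_frame {ξ : FieldAlong n L φ} {ψ : (x : M) → Twisted n L σ φ x}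
    (hψ : IsSmoothTwisted σ φ ψ) (hodd : ∀ x c, HasParity 1 (ψ x c)) {p q y : M}
    (hp : y ∈ σ.dom p) (hq : y ∈ σ.dom q) (hy : φ y ∈ a.source) :
    localDensity σ a p ξ ψ y =
      Complex.normSq (σ.root p q y ^ 2) • localDensity σ a q ξ ψ y := by
  obtain ⟨d, hd⟩ := dAt_root σ hp hq hq
  set r := σ.root p q y with hr
  set t := r ^ 2 with ht
  have ht1 : t.re = r.re ^ 2 - r.im ^ 2 := by simp [ht, pow_two]
  have ht2 : t.im = 2 * r.re * r.im := by simp [ht, pow_two]; ring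
  have hv : ∀ c, coordVec p y c = coordVec q y (t * c) := fun c => coordVec_eq_coordVec σ hp hq c
  have hv1 : coordVec p y 1 = t.re • coordVec q y 1 + t.im • coordVec q y Complex.I := by
    rw [hv, mul_one, ← coordVec_add_smul]
  have hv2 : coordVec p y Complex.I = -t.im • coordVec q y 1 + t.re • coordVec q y Complex.I := by
    rw [hv, ← coordVec_add_smul]
    congr 1
    apply Complex.ext <;> simp
  have hds : ∀ (c : ℂ) (i : Fin n) (v : ℂ),
      dAt (spinorCrd σ a p ψ c i) y (coordVec q y v) =
      (d * v * c).re • spinorCrd σ a q ψ 1 i y + (d * v * c).im • spinorCrd σ a q ψ Complex.I i y +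
      ((r * c).re • dAt (spinorCrd σ a q ψ 1 i) y (coordVec q y v) +
        (r * c).im • dAt (spinorCrd σ a q ψ Complex.I i) y (coordVec q y v)) := by
    intro c i v
    have he : spinorCrd σ a p ψ c i =ᶠ[𝓝 y] fun y =>
        (σ.root p q y * c).re • spinorCrd σ a q ψ 1 i y +
        (σ.root p q y * c).im • spinorCrd σ a q ψ Complex.I i y := by
      filter_upwards [σ.dom_mem_nhds hp, σ.dom_mem_nhds hq] with y' h1 h2
      exact spinorCrd_change σ h1 h2 ψ i c
    have hr0 := (contMDiffAt_root σ hp hq).mdifferentiableAt (n := ∞) (by simp)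
    set T1 : ℂ →L[ℝ] ℝ := Complex.reCLM ∘L ((ContinuousLinearMap.mul ℝ ℂ).flip c) with hT1
    set T2 : ℂ →L[ℝ] ℝ := Complex.imCLM ∘L ((ContinuousLinearMap.mul ℝ ℂ).flip c) with hT2
    have hm1 : MDifferentiableAt 𝓘(ℝ, ℂ) 𝓘(ℝ, ℝ) (fun y => (σ.root p q y * c).re) y :=
      T1.mdifferentiableAt.comp y hr0
    have hm2 : MDifferentiableAt 𝓘(ℝ, ℂ) 𝓘(ℝ, ℝ) (fun y => (σ.root p q y * c).im) y :=
      T2.mdifferentiableAt.comp y hr0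
    have hs1 := contMDiffAt_spinorCrd σ ha hφ hψ hq hy 1 i
    have hs2 := contMDiffAt_spinorCrd σ ha hφ hψ hq hy Complex.I i
    have hs1' := hs1.mdifferentiableAt (n := ∞) (by simp)
    have hs2' := hs2.mdifferentiableAt (n := ∞) (by simp)
    have e1 : dAt (fun y => (σ.root p q y * c).re) y (coordVec q y v) = (d * v * c).re := by
      rw [← hd v]; exact dAt_clm T1 hr0 _
    have e2 : dAt (fun y => (σ.root p q y * c).im) y (coordVec q y v) = (d * v * c).im := by
      rw [← hd v]; exact dAt_clm T2 hr0 _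
    have ms1 : MDifferentiableAt 𝓘(ℝ, ℂ) 𝓘(ℝ, Grassmann L)
      (fun y => (σ.root p q y * c).re • spinorCrd σ a q ψ 1 i y) y := hm1.smul hs1'
    have ms2 : MDifferentiableAt 𝓘(ℝ, ℂ) 𝓘(ℝ, Grassmann L)
      (fun y => (σ.root p q y * c).im • spinorCrd σ a q ψ Complex.I i y) y := hm2.smul hs2'
    rw [dAt_congr he, dAt_add ms1 ms2, dAt_smul hm1 hs1', dAt_smul hm2 hs2', e1, e2]
    module
  have hd0 : direction 0 = 1 := rfl
  have hd1 : direction 1 = Complex.I := rfl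
  rw [localDensity, localDensity, Finset.smul_sum]
  refine Finset.sum_congr rfl fun i _ => ?_
  have ho1 : spinorCrd σ a q ψ 1 i y ∈ parityPart L 1 := spinorCrd_odd σ hodd 1 i y
  have ho2 : spinorCrd σ a q ψ Complex.I i y ∈ parityPart L 1 := spinorCrd_odd σ hodd _ i y
  rw [Complex.normSq_apply, smul_add]
  congr 1
  · simp only [Fin.sum_univ_two, hd0, hd1, hv1, hv2, map_add, map_smul, mul_add, add_mul,
      mul_smul_comm, smul_mul_assoc]
    module
  · have e := spinDensity_frame ho1 ho2 (dAt (spinorCrd σ a q ψ 1 i) y (coordVec q y 1))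
      (dAt (spinorCrd σ a q ψ 1 i) y (coordVec q y Complex.I))
      (dAt (spinorCrd σ a q ψ Complex.I i) y (coordVec q y 1))
      (dAt (spinorCrd σ a q ψ Complex.I i) y (coordVec q y Complex.I))
      r.re r.im t.re t.im (d * t).re (d * t).im ht1 ht2
    rw [show t.re * t.re + t.im * t.im = t.re ^ 2 + t.im ^ 2 by ring, ← e]
    congr 1
    · rw [spinorCrd_change σ hp hq, mul_one]
    · rw [spinorCrd_change σ hp hq]; simp [hr]
    all_goals
      rw [hv, hds, ← hv]
      simp only [hv1, hv2, map_add, map_smul, ← mul_assoc, mul_one, Complex.mul_I_re,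
        Complex.mul_I_im]

include hφ in
/-- The local formula for the Lagrangian in an arbitrary frame. -/
theorem lagrangian_eq (hg₁ : IsConformal g₁) (hai : IsIsometricChart g₂ a) {ξ : FieldAlong n L φ}
    {ψ : (x : M) → Twisted n L σ φ x}
    (hψ : IsSmoothTwisted σ φ ψ) (hodd : ∀ x c, HasParity 1 (ψ x c)) {p y : M}
    (hp : y ∈ σ.dom p)
    (hξ : SmoothAlongAt 𝓘(ℝ, ℂ) φ ξ y) (hy : φ y ∈ a.source) :
    lagrangian g₁ σ hg₂ A φ ξ ψ y =
      (conformalFactor g₁ p y)⁻¹ • localDensity σ a p ξ ψ y := by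
  have hy' := σ.mem_dom y
  -- Passing from the frame at y to the frame at p multiplies the density and the conformal factor
  -- by the same |r|⁴, so the quotient is unchanged.
  rw [lagrangian_eq_own σ hφ hg₂ g₁ A hai hψ hodd hξ hy,
    localDensity_frame σ hai.1 hφ hψ hodd hp hy' hy,
    hg₁.conformalFactor_eq (σ.dom_subset p hp) (mem_chart_source ℂ y), σ.root_sq p y y ⟨hp, hy'⟩,
    smul_smul]
  congr 1
  have h0 : Complex.normSq (deriv (chartAt ℂ y ∘ (chartAt ℂ p).symm) (chartAt ℂ p y)) ≠ 0 := by
    rw [← σ.root_sq p y y ⟨hp, hy'⟩]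
    simpa using root_ne_zero σ hp hy'
  have h1 := (conformalFactor_pos g₁ (mem_chart_source ℂ y)).ne'
  field_simp

end Lagrangian

end SusyDirac

namespace SusyDirac

open Filter Topology

/-! ### Smoothness and derivatives of products in Λ. -/

section GrassmannMul

variable {L : ℕ}

/-- The product of the Grassmann algebra as a continuous bilinear map. -/
def grassmannMul (L : ℕ) : Grassmann L →L[ℝ] Grassmann L →L[ℝ] Grassmann L :=
  (LinearMap.mul ℝ (Grassmann L)).toContinuousBilinearMap

variable {F H P : Type*} [NormedAddCommGroup F] [NormedSpace ℝ F] [TopologicalSpace H]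
  {J : ModelWithCorners ℝ F H} [TopologicalSpace P] [ChartedSpace H P]

theorem contMDiffAt_grassmann_mul {u v : P → Grassmann L} {q : P}
    (hu : ContMDiffAt J 𝓘(ℝ, Grassmann L) ∞ u q) (hv : ContMDiffAt J 𝓘(ℝ, Grassmann L) ∞ v q) :
    ContMDiffAt J 𝓘(ℝ, Grassmann L) ∞ (fun q => u q * v q) q :=
  ((grassmannMul L).contMDiff.contMDiffAt.comp q hu).clm_apply hv

theorem contMDiffAt_grassmann_smul {u : P → ℝ} {v : P → Grassmann L} {q : P}
    (hu : ContMDiffAt J 𝓘(ℝ, ℝ) ∞ u q) (hv : ContMDiffAt J 𝓘(ℝ, Grassmann L) ∞ v q) :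
    ContMDiffAt J 𝓘(ℝ, Grassmann L) ∞ (fun q => u q • v q) q := hu.smul hv

theorem contMDiffAt_grassmann_sum {ι : Type*} {t : Finset ι} {u : ι → P → Grassmann L} {q : P}
    (hu : ∀ i ∈ t, ContMDiffAt J 𝓘(ℝ, Grassmann L) ∞ (u i) q) :
    ContMDiffAt J 𝓘(ℝ, Grassmann L) ∞ (fun q => ∑ i ∈ t, u i q) q :=
  contMDiffAt_finsetSum hu

theorem contMDiffAt_grassmann_add {u v : P → Grassmann L} {q : P}
    (hu : ContMDiffAt J 𝓘(ℝ, Grassmann L) ∞ u q) (hv : ContMDiffAt J 𝓘(ℝ, Grassmann L) ∞ v q) :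
    ContMDiffAt J 𝓘(ℝ, Grassmann L) ∞ (fun q => u q + v q) q := hu.add hv

theorem contMDiffAt_grassmann_sub {u v : P → Grassmann L} {q : P}
    (hu : ContMDiffAt J 𝓘(ℝ, Grassmann L) ∞ u q) (hv : ContMDiffAt J 𝓘(ℝ, Grassmann L) ∞ v q) :
    ContMDiffAt J 𝓘(ℝ, Grassmann L) ∞ (fun q => u q - v q) q := hu.sub hv

theorem hasDerivAt_grassmann_mul {u v : ℝ → Grassmann L} {u' v' : Grassmann L} {t : ℝ}
    (hu : HasDerivAt u u' t) (hv : HasDerivAt v v' t) :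
    HasDerivAt (fun t => u t * v t) (u t * v' + u' * v t) t :=
  (grassmannMul L).hasDerivAt_of_bilinear (fun _ => hu) (fun _ => hv)

theorem hasDerivAt_grassmann_iff {u : ℝ → Grassmann L} {u' : Grassmann L} {t : ℝ} :
    HasDerivAt u u' t ↔ ∀ I, HasDerivAt (fun t => (grassmannBasis L).coord I (u t))
      ((grassmannBasis L).coord I u') t := by
  constructor
  · intro h I
    exact (LinearMap.toContinuousLinearMap
      ((grassmannBasis L).coord I)).hasFDerivAt.comp_hasDerivAt t h
  · intro h
    have h1 : HasDerivAt (fun t => ∑ I, (grassmannBasis L).coord I (u t) • grassmannBasis L I)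
        (∑ I, (grassmannBasis L).coord I u' • grassmannBasis L I) t :=
      HasDerivAt.fun_sum fun I _ => (h I).smul_const _
    simpa only [sum_coord_smul] using h1

theorem dAt_mul {M : Type*} [TopologicalSpace M] [ChartedSpace ℂ M] [IsManifold 𝓘(ℂ) ω M]
    {u v : M → Grassmann L} {y : M} (hu : MDifferentiableAt 𝓘(ℝ, ℂ) 𝓘(ℝ, Grassmann L) u y)
    (hv : MDifferentiableAt 𝓘(ℝ, ℂ) 𝓘(ℝ, Grassmann L) v y) (w : TangentSpace 𝓘(ℝ, ℂ) y) :
    dAt (fun y => u y * v y) y w = u y * dAt v y w + dAt u y w * v y :=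
  dAt_bilinear (grassmannMul L) hu hv w

end GrassmannMul

/-! ### Functions of a parameter and a point: interchange of derivatives. -/

section Parameter

variable {M : Type*} [TopologicalSpace M] [ChartedSpace ℂ M] [IsManifold 𝓘(ℂ) ω M]
  {G : Type*} [NormedAddCommGroup G] [NormedSpace ℝ G]

theorem contDiffAt_comp_chart_symm {u : ℝ → M → G} {p y : M} {t : ℝ} {n : ℕ∞}
    (hy : y ∈ (chartAt ℂ p).source)
    (hu : ContMDiffAt (𝓘(ℝ, ℝ).prod 𝓘(ℝ, ℂ)) 𝓘(ℝ, G) n (fun q : ℝ × M => u q.1 q.2) (t, y)) :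
    ContDiffAt ℝ n (fun q : ℝ × ℂ => u q.1 ((chartAt ℂ p).symm q.2)) (t, chartAt ℂ p y) := by
  rw [← contMDiffAt_iff_contDiffAt]
  have h1 : ContMDiffAt 𝓘(ℝ, ℂ) 𝓘(ℝ, ℂ) n (chartAt ℂ p).symm (chartAt ℂ p y) :=
    (contMDiffAt_symm_of_mem_maximalAtlas (chartAt_mem_maximalAtlas_real p)
      ((chartAt ℂ p).map_source hy)).of_le (by exact_mod_cast le_top)
  have h2 : ContMDiffAt 𝓘(ℝ, ℝ × ℂ) (𝓘(ℝ, ℝ).prod 𝓘(ℝ, ℂ)) n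
      (fun q : ℝ × ℂ => (q.1, (chartAt ℂ p).symm q.2)) (t, chartAt ℂ p y) :=
    contDiff_fst.contMDiff.contMDiffAt.prodMk
      (ContMDiffAt.comp (t, chartAt ℂ p y) h1 contDiff_snd.contMDiff.contMDiffAt)
  have hu' : ContMDiffAt (𝓘(ℝ, ℝ).prod 𝓘(ℝ, ℂ)) 𝓘(ℝ, G) n (fun q : ℝ × M => u q.1 q.2)
      ((fun q : ℝ × ℂ => (q.1, (chartAt ℂ p).symm q.2)) (t, chartAt ℂ p y)) := by
    simpa only [(chartAt ℂ p).left_inv hy] using hu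
  exact ContMDiffAt.comp (t, chartAt ℂ p y) hu' h2

theorem contMDiffAt_slice {u : ℝ → M → G} {y : M} {t : ℝ}
    (hu : ContMDiffAt (𝓘(ℝ, ℝ).prod 𝓘(ℝ, ℂ)) 𝓘(ℝ, G) ∞ (fun q : ℝ × M => u q.1 q.2) (t, y)) :
    ContMDiffAt 𝓘(ℝ, ℂ) 𝓘(ℝ, G) ∞ (u t) y :=
  ContMDiffAt.comp y (f := fun y => (t, y)) hu (contMDiffAt_const.prodMk contMDiffAt_id)

theorem dAt_coordVec_eq_partial {u : ℝ → M → G} {p y : M} {t : ℝ}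
    (hy : y ∈ (chartAt ℂ p).source)
    (hu : DifferentiableAt ℝ (fun q : ℝ × ℂ => u q.1 ((chartAt ℂ p).symm q.2))
      (t, chartAt ℂ p y)) (c : ℂ) :
    dAt (u t) y (coordVec p y c) =
      fderiv ℝ (fun q : ℝ × ℂ => u q.1 ((chartAt ℂ p).symm q.2)) (t, chartAt ℂ p y) (0, c) := by
  have h1 : HasFDerivAt (fun z : ℂ => (t, z)) (ContinuousLinearMap.inr ℝ ℝ ℂ) (chartAt ℂ p y) :=
    hasFDerivAt_prodMk_right t (chartAt ℂ p y)
  have h2 := HasFDerivAt.comp (chartAt ℂ p y) hu.hasFDerivAt h1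
  rw [dAt_of_hasFDerivAt (f := u t) hy h2, vecCoord_coordVec hy]
  simp

theorem eventually_dAt_coordVec_eq {u : ℝ → M → G} {p y : M} {t : ℝ}
    (hy : y ∈ (chartAt ℂ p).source)
    (hu : ContMDiffAt (𝓘(ℝ, ℝ).prod 𝓘(ℝ, ℂ)) 𝓘(ℝ, G) ∞ (fun q : ℝ × M => u q.1 q.2) (t, y))
    (c : ℂ) :
    ∀ᶠ q in 𝓝 (t, y), dAt (u q.1) q.2 (coordVec p q.2 c) =
      fderiv ℝ (fun q : ℝ × ℂ => u q.1 ((chartAt ℂ p).symm q.2)) (q.1, chartAt ℂ p q.2)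
        (0, c) := by
  have h1 := contDiffAt_comp_chart_symm (n := 1) hy (hu.of_le (by exact_mod_cast le_top))
  have h2 := h1.eventually (by simp)
  have hc : ContinuousAt (fun q : ℝ × M => (q.1, chartAt ℂ p q.2)) (t, y) :=
    continuousAt_fst.prodMk
      (ContinuousAt.comp (g := chartAt ℂ p) ((chartAt ℂ p).continuousAt hy) continuousAt_snd)
  have hs : ∀ᶠ q : ℝ × M in 𝓝 (t, y), q.2 ∈ (chartAt ℂ p).source :=
    continuousAt_snd ((chartAt ℂ p).open_source.mem_nhds hy)
  filter_upwards [hc.eventually h2, hs] with q hq hqs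
  exact dAt_coordVec_eq_partial hqs (hq.differentiableAt (by simp)) c

theorem contMDiffAt_dAt_coordVec {u : ℝ → M → G} {p y : M} {t : ℝ}
    (hy : y ∈ (chartAt ℂ p).source)
    (hu : ContMDiffAt (𝓘(ℝ, ℝ).prod 𝓘(ℝ, ℂ)) 𝓘(ℝ, G) ∞ (fun q : ℝ × M => u q.1 q.2) (t, y))
    (c : ℂ) :
    ContMDiffAt (𝓘(ℝ, ℝ).prod 𝓘(ℝ, ℂ)) 𝓘(ℝ, G) ∞
      (fun q : ℝ × M => dAt (u q.1) q.2 (coordVec p q.2 c)) (t, y) := by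
  have h1 := contDiffAt_comp_chart_symm (n := ⊤) hy hu
  have h2 : ContDiffAt ℝ ∞ (fun q' => fderiv ℝ (fun q : ℝ × ℂ => u q.1 ((chartAt ℂ p).symm q.2))
      q' (0, c)) (t, chartAt ℂ p y) :=
    (h1.fderiv_right (m := ∞) (by simp)).clm_apply contDiffAt_const
  have h3 : ContMDiffAt (𝓘(ℝ, ℝ).prod 𝓘(ℝ, ℂ)) 𝓘(ℝ, ℝ × ℂ) ∞
      (fun q : ℝ × M => (q.1, chartAt ℂ p q.2)) (t, y) :=
    contMDiffAt_fst.prodMk_space (ContMDiffAt.comp (t, y)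
      (contMDiffAt_of_mem_maximalAtlas (chartAt_mem_maximalAtlas_real p) hy) contMDiffAt_snd)
  have h4 := ContMDiffAt.comp (t, y) (g := fun q' => fderiv ℝ (fun q : ℝ × ℂ =>
    u q.1 ((chartAt ℂ p).symm q.2)) q' (0, c)) (f := fun q : ℝ × M => (q.1, chartAt ℂ p q.2))
    h2.contMDiffAt h3
  exact h4.congr_of_eventuallyEq (eventually_dAt_coordVec_eq hy hu c)

/-- Derivatives in the parameter and in the space variable commute. -/
theorem hasDerivAt_dAt_coordVec {u : ℝ → M → G} {w : M → G} {p y : M} {t : ℝ}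
    (hy : y ∈ (chartAt ℂ p).source)
    (hu : ContMDiffAt (𝓘(ℝ, ℝ).prod 𝓘(ℝ, ℂ)) 𝓘(ℝ, G) ∞ (fun q : ℝ × M => u q.1 q.2) (t, y))
    (hw : ∀ᶠ y' in 𝓝 y, HasDerivAt (fun t => u t y') (w y') t) (c : ℂ) :
    HasDerivAt (fun t => dAt (u t) y (coordVec p y c)) (dAt w y (coordVec p y c)) t := by
  set z := chartAt ℂ p y with hz
  set U : ℝ × ℂ → G := fun q => u q.1 ((chartAt ℂ p).symm q.2) with hU
  have h1 : ContDiffAt ℝ ∞ U (t, z) := contDiffAt_comp_chart_symm (n := ⊤) hy hu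
  have hD : HasFDerivAt (fderiv ℝ U) (fderiv ℝ (fderiv ℝ U) (t, z)) (t, z) :=
    ((h1.fderiv_right (m := 1) (by norm_cast)).differentiableAt (by simp)).hasFDerivAt
  -- Symmetry of the second derivative of U on the parameter direction (1, 0) and the space
  -- direction (0, c) is the whole content; `hl` and `hr` identify the two mixed derivatives with
  -- its two sides.
  have hsymm := (h1.isSymmSndFDerivAt (by simpa using ENat.LEInfty.out)).eq (1, 0) (0, c)
  have hdiff : ∀ᶠ q in 𝓝 (t, z), DifferentiableAt ℝ U q := by
    filter_upwards [(h1.of_le (m := 1) (by exact_mod_cast le_top)).eventually (by simp)] with q hq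
    exact hq.differentiableAt (by simp)
  have hl : HasDerivAt (fun t => fderiv ℝ U (t, z) (0, c))
      (fderiv ℝ (fderiv ℝ U) (t, z) (1, 0) (0, c)) t := by
    have e1 : HasDerivAt (fun s : ℝ => (s, z)) ((1 : ℝ), (0 : ℂ)) t :=
      (hasDerivAt_id t).prodMk (hasDerivAt_const t z)
    have e2 := HasFDerivAt.comp_hasDerivAt t (f := fun s : ℝ => (s, z)) hD e1
    exact e2.clm_apply (hasDerivAt_const t ((0 : ℝ), c)) |>.congr_deriv (by simp)
  have hr : dAt w y (coordVec p y c) = fderiv ℝ (fderiv ℝ U) (t, z) (0, c) (1, 0) := by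
    have e1 : HasFDerivAt (fun z' : ℂ => (t, z')) (ContinuousLinearMap.inr ℝ ℝ ℂ) z :=
      hasFDerivAt_prodMk_right t z
    have e2 := HasFDerivAt.comp z (f := fun z' : ℂ => (t, z')) hD e1
    have e3 := e2.clm_apply (hasFDerivAt_const ((1 : ℝ), (0 : ℂ)) z)
    have hcs : ContinuousAt (chartAt ℂ p).symm z :=
      (chartAt ℂ p).continuousAt_symm ((chartAt ℂ p).map_source hy)
    -- By uniqueness of derivatives w is the parameter derivative of U at all nearby points, which
    -- is why the hypothesis on w is needed on a neighbourhood.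
    have e4 : w ∘ (chartAt ℂ p).symm =ᶠ[𝓝 z] fun z' => fderiv ℝ U (t, z') (1, 0) := by
      have hcs' : Tendsto (chartAt ℂ p).symm (𝓝 z) (𝓝 y) := by
        have := hcs.tendsto
        rwa [hz, (chartAt ℂ p).left_inv hy] at this
      have hct : Tendsto (fun z' : ℂ => (t, z')) (𝓝 z) (𝓝 (t, z)) :=
        (continuous_const.prodMk continuous_id).continuousAt
      filter_upwards [hcs'.eventually hw, hct.eventually hdiff] with z' h1' h2'
      have e5 : HasDerivAt (fun s : ℝ => (s, z')) ((1 : ℝ), (0 : ℂ)) t :=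
        (hasDerivAt_id t).prodMk (hasDerivAt_const t z')
      have e6 := HasFDerivAt.comp_hasDerivAt t (f := fun s : ℝ => (s, z')) h2'.hasFDerivAt e5
      exact h1'.unique e6
    have e7 := e3.congr_of_eventuallyEq e4
    rw [dAt_of_hasFDerivAt hy e7, vecCoord_coordVec hy]
    simp
  rw [hr, ← hsymm]
  refine hl.congr_of_eventuallyEq ?_
  have hct : Tendsto (fun s : ℝ => (s, z)) (𝓝 t) (𝓝 (t, z)) :=
    (continuous_id.prodMk continuous_const).continuousAt
  filter_upwards [hct.eventually hdiff] with s hs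
  exact dAt_coordVec_eq_partial hy hs c

end Parameter

end SusyDirac

namespace SusyDirac

open Filter Topology

/-! ### The Lagrangian along a smooth family and its linearization. -/

section Family

variable {n L : ℕ} {Y : Type*} [TopologicalSpace Y] [ChartedSpace (Euc n) Y]
  [IsManifold 𝓘(ℝ, Euc n) ∞ Y] {a : OpenPartialHomeomorph Y (Euc n)}
  {M : Type*} [TopologicalSpace M] [ChartedSpace ℂ M] [IsManifold 𝓘(ℂ) ω M]
  (σ : SpinStructure M) {φ : M → Y} (ha : a ∈ IsManifold.maximalAtlas 𝓘(ℝ, Euc n) ∞ Y)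
  (hφ : ContMDiff 𝓘(ℝ, ℂ) 𝓘(ℝ, Euc n) ∞ φ)
  {Ξ : ℝ → FieldAlong n L φ} {Ψ : ℝ → (x : M) → Twisted n L σ φ x}
  (hΞ : IsSmoothAlong (𝓘(ℝ, ℝ).prod 𝓘(ℝ, ℂ)) (fun q : ℝ × M => φ q.2)
    (fun q => Ξ q.1 q.2) Set.univ)
  (hΨ : ∀ (p : M) (c : ℂ), IsSmoothAlong (𝓘(ℝ, ℝ).prod 𝓘(ℝ, ℂ))
    (fun q : ℝ × M => φ q.2) (fun q => Ψ q.1 q.2 (σ.root p q.2 q.2 * c : ℂ))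
    (Set.univ ×ˢ σ.dom p))

include hΞ in
theorem smoothAlongAt_slice (t : ℝ) (y : M) : SmoothAlongAt 𝓘(ℝ, ℂ) φ (Ξ t) y := fun ℓ =>
  ContMDiffAt.comp y (f := fun y => (t, y))
    (g := fun q : ℝ × M => (⟨φ q.2, component ℓ (Ξ q.1 q.2)⟩ : TangentBundle 𝓘(ℝ, Euc n) Y))
    ((isSmoothAlong_iff isOpen_univ).mp hΞ (t, y) trivial ℓ)
    (contMDiffAt_const.prodMk contMDiffAt_id)

include hΨ in
theorem isSmoothTwisted_slice (t : ℝ) : IsSmoothTwisted σ φ (Ψ t) := fun p c =>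
  (isSmoothAlong_iff (σ.isOpen_dom p)).mpr fun y hy ℓ =>
  ContMDiffAt.comp y (f := fun y => (t, y))
    (g := fun q : ℝ × M => (⟨φ q.2, component ℓ (Ψ q.1 q.2 (σ.root p q.2 q.2 * c : ℂ))⟩ :
      TangentBundle 𝓘(ℝ, Euc n) Y))
    ((isSmoothAlong_iff (isOpen_univ.prod (σ.isOpen_dom p))).mp (hΨ p c) (t, y) ⟨trivial, hy⟩ ℓ)
    (contMDiffAt_const.prodMk contMDiffAt_id)

include ha hφ hΞ in
theorem contMDiffAt_mapCrd_family (t : ℝ) {y : M} (hy : φ y ∈ a.source) (i : Fin n) :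
    ContMDiffAt (𝓘(ℝ, ℝ).prod 𝓘(ℝ, ℂ)) 𝓘(ℝ, Grassmann L) ∞
      (fun q : ℝ × M => mapCrd a (Ξ q.1) i q.2) (t, y) := by
  have h1 : ContMDiffAt (𝓘(ℝ, ℝ).prod 𝓘(ℝ, ℂ)) 𝓘(ℝ, Euc n) ∞ (fun q : ℝ × M => φ q.2) (t, y) :=
    ContMDiffAt.comp (t, y) hφ.contMDiffAt contMDiffAt_snd
  have h2 := (smoothAlongAt_iff ha h1 hy).mp
    ((isSmoothAlong_iff isOpen_univ).mp hΞ (t, y) trivial) i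
  have h3 : ContMDiffAt (𝓘(ℝ, ℝ).prod 𝓘(ℝ, ℂ)) 𝓘(ℝ, ℝ) ∞
      (fun q : ℝ × M => a (φ q.2) i) (t, y) :=
    ContMDiffAt.comp (t, y) (contMDiffAt_chart_coord ha hφ hy i) contMDiffAt_snd
  exact contMDiffAt_grassmann_add (contMDiffAt_grassmann_smul h3 contMDiffAt_const) h2

include ha hφ hΨ in
theorem contMDiffAt_spinorCrd_family (t : ℝ) {p y : M} (hp : y ∈ σ.dom p) (hy : φ y ∈ a.source)
    (c : ℂ) (i : Fin n) :
    ContMDiffAt (𝓘(ℝ, ℝ).prod 𝓘(ℝ, ℂ)) 𝓘(ℝ, Grassmann L) ∞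
      (fun q : ℝ × M => spinorCrd σ a p (Ψ q.1) c i q.2) (t, y) := by
  have h1 : ContMDiffAt (𝓘(ℝ, ℝ).prod 𝓘(ℝ, ℂ)) 𝓘(ℝ, Euc n) ∞ (fun q : ℝ × M => φ q.2) (t, y) :=
    ContMDiffAt.comp (t, y) hφ.contMDiffAt contMDiffAt_snd
  exact (smoothAlongAt_iff ha h1 hy).mp
    ((isSmoothAlong_iff (isOpen_univ.prod (σ.isOpen_dom p))).mp (hΨ p c) (t, y) ⟨trivial, hp⟩) i

include ha hφ hΞ hΨ in
theorem contMDiffAt_localDensity (t : ℝ) {p y : M} (hp : y ∈ σ.dom p) (hy : φ y ∈ a.source) :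
    ContMDiffAt (𝓘(ℝ, ℝ).prod 𝓘(ℝ, ℂ)) 𝓘(ℝ, Grassmann L) ∞
      (fun q : ℝ × M => localDensity σ a p (Ξ q.1) (Ψ q.1) q.2) (t, y) := by
  have hps := σ.dom_subset p hp
  have hm := fun i c => contMDiffAt_dAt_coordVec (u := fun t => mapCrd a (Ξ t) i) hps
    (contMDiffAt_mapCrd_family ha hφ hΞ t hy i) c
  have hs := fun c i => contMDiffAt_spinorCrd_family σ ha hφ hΨ t hp hy c i
  have hds := fun c i c' =>
    contMDiffAt_dAt_coordVec (u := fun t => spinorCrd σ a p (Ψ t) c i) hps (hs c i) c'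
  refine contMDiffAt_grassmann_sum fun i _ => contMDiffAt_grassmann_add
    (contMDiffAt_grassmann_sum fun k _ => contMDiffAt_grassmann_mul (hm i _) (hm i _))
    (contMDiffAt_grassmann_add
      (contMDiffAt_grassmann_mul (hs 1 i) (contMDiffAt_grassmann_sub (hds _ i _) (hds _ i _)))
      (contMDiffAt_grassmann_mul (hs _ i) (contMDiffAt_grassmann_add (hds _ i _) (hds _ i _))))

variable {g₂ : TargetMetric n Y} (hg₂ : IsFlat g₂) {g₁ : SurfaceMetric M}
  (hg₁ : IsConformal g₁) (A : OneForm M)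

include hφ hΞ hΨ hg₁ in
/-- The Lagrangian of a smooth family is a smooth function of the parameter and of the point. -/
theorem contMDiff_lagrangian (hodd : ∀ t x c, HasParity 1 (Ψ t x c)) :
    ContMDiff (𝓘(ℝ, ℝ).prod 𝓘(ℝ, ℂ)) 𝓘(ℝ, Grassmann L) ∞
      (fun q : ℝ × M => lagrangian g₁ σ hg₂ A φ (Ξ q.1) (Ψ q.1) q.2) := by
  rintro ⟨t, y⟩
  obtain ⟨hy, hai⟩ := flatChart_spec hg₂ (φ y)
  have hp := σ.mem_dom y
  have h1 : ContMDiffAt (𝓘(ℝ, ℝ).prod 𝓘(ℝ, ℂ)) 𝓘(ℝ, ℝ) ∞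
      (fun q : ℝ × M => (conformalFactor g₁ y q.2)⁻¹) (t, y) :=
    ContMDiffAt.comp (t, y) (g := fun y' => (conformalFactor g₁ y y')⁻¹)
      ((contMDiffAt_conformalFactor g₁ (mem_chart_source ℂ y)).inv₀
      (conformalFactor_pos g₁ (mem_chart_source ℂ y)).ne') contMDiffAt_snd
  -- `lagrangian` uses a different frame at every point. Near (t, y) it is replaced by the
  -- expression in the fixed frame and charts at y, whose dependence on the point is visibly smooth.
  refine (contMDiffAt_grassmann_smul h1
    (contMDiffAt_localDensity σ hai.1 hφ hΞ hΨ t hp hy)).congr_of_eventuallyEq ?_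
  have h2 : ∀ᶠ q : ℝ × M in 𝓝 (t, y), q.2 ∈ σ.dom y :=
    continuousAt_snd (σ.dom_mem_nhds hp)
  have h3 : ∀ᶠ q : ℝ × M in 𝓝 (t, y), φ q.2 ∈ (flatChart hg₂ (φ y)).source :=
    (hφ.continuous.comp continuous_snd).continuousAt
      ((flatChart hg₂ (φ y)).open_source.mem_nhds hy)
  filter_upwards [h2, h3] with q hq1 hq2
  exact lagrangian_eq σ hφ hg₂ g₁ A hg₁ hai (isSmoothTwisted_slice σ hΨ q.1) (hodd q.1) hq1
    (smoothAlongAt_slice hΞ q.1 q.2) hq2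

/-- The linearization of `localDensity` at `(ξ, ψ)` in the direction `(w, χ)`. -/
def variationDensity (a : OpenPartialHomeomorph Y (Euc n)) (p : M) (ξ : FieldAlong n L φ)
    (ψ : (x : M) → Twisted n L σ φ x) (w : FieldAlong n L φ) (χ : (x : M) → Twisted n L σ φ x)
    (y : M) : Grassmann L :=
  ∑ i, ((∑ k, (dAt (mapCrd a ξ i) y (coordVec p y (direction k)) *
        dAt (fun y => crd a (φ y) i (w y)) y (coordVec p y (direction k)) +
      dAt (fun y => crd a (φ y) i (w y)) y (coordVec p y (direction k)) *
        dAt (mapCrd a ξ i) y (coordVec p y (direction k)))) +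
    (spinDensity (spinorCrd σ a p ψ 1 i y) (spinorCrd σ a p ψ Complex.I i y)
      (dAt (spinorCrd σ a p χ 1 i) y (coordVec p y 1))
      (dAt (spinorCrd σ a p χ 1 i) y (coordVec p y Complex.I))
      (dAt (spinorCrd σ a p χ Complex.I i) y (coordVec p y 1))
      (dAt (spinorCrd σ a p χ Complex.I i) y (coordVec p y Complex.I)) +
    spinDensity (spinorCrd σ a p χ 1 i y) (spinorCrd σ a p χ Complex.I i y)
      (dAt (spinorCrd σ a p ψ 1 i) y (coordVec p y 1))
      (dAt (spinorCrd σ a p ψ 1 i) y (coordVec p y Complex.I))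
      (dAt (spinorCrd σ a p ψ Complex.I i) y (coordVec p y 1))
      (dAt (spinorCrd σ a p ψ Complex.I i) y (coordVec p y Complex.I))))

theorem hasDerivAt_crd {y : M} {τ : ℝ → TangentSpace 𝓘(ℝ, Euc n) (φ y) ⊗[ℝ] Grassmann L}
    {τ' : TangentSpace 𝓘(ℝ, Euc n) (φ y) ⊗[ℝ] Grassmann L} {t : ℝ}
    (h : ∀ ℓ : TangentSpace 𝓘(ℝ, Euc n) (φ y) ⊗[ℝ] Grassmann L →ₗ[ℝ] ℝ,
      HasDerivAt (fun t => ℓ (τ t)) (ℓ τ') t) (i : Fin n) :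
    HasDerivAt (fun t => crd a (φ y) i (τ t)) (crd a (φ y) i τ') t :=
  hasDerivAt_grassmann_iff.mpr fun I => h ((grassmannBasis L).coord I ∘ₗ crd a (φ y) i)

include ha hφ hΞ hΨ in
theorem hasDerivAt_localDensity {t : ℝ} {w : FieldAlong n L φ} {χ : (x : M) → Twisted n L σ φ x}
    (hw : ∀ (x : M) (ℓ : TangentSpace 𝓘(ℝ, Euc n) (φ x) ⊗[ℝ] Grassmann L →ₗ[ℝ] ℝ),
      HasDerivAt (fun t => ℓ (Ξ t x)) (ℓ (w x)) t)
    (hχ : ∀ (x : M) (c : Spinor σ x)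
      (ℓ : TangentSpace 𝓘(ℝ, Euc n) (φ x) ⊗[ℝ] Grassmann L →ₗ[ℝ] ℝ),
      HasDerivAt (fun t => ℓ (Ψ t x c)) (ℓ (χ x c)) t)
    {p y : M} (hp : y ∈ σ.dom p) (hy : φ y ∈ a.source) :
    HasDerivAt (fun t => localDensity σ a p (Ξ t) (Ψ t) y)
      (variationDensity σ a p (Ξ t) (Ψ t) w χ y) t := by
  have hps := σ.dom_subset p hp
  have hm : ∀ i c, HasDerivAt (fun t => dAt (mapCrd a (Ξ t) i) y (coordVec p y c))
      (dAt (fun y => crd a (φ y) i (w y)) y (coordVec p y c)) t := fun i c =>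
    hasDerivAt_dAt_coordVec (u := fun t => mapCrd a (Ξ t) i) hps
      (contMDiffAt_mapCrd_family ha hφ hΞ t hy i)
      (Eventually.of_forall fun y' => (hasDerivAt_crd (hw y') i).const_add _) c
  have hs : ∀ c i y', HasDerivAt (fun t => spinorCrd σ a p (Ψ t) c i y')
      (spinorCrd σ a p χ c i y') t := fun c i y' => hasDerivAt_crd (hχ y' _) i
  have hds : ∀ c i c', HasDerivAt (fun t => dAt (spinorCrd σ a p (Ψ t) c i) y (coordVec p y c'))
      (dAt (spinorCrd σ a p χ c i) y (coordVec p y c')) t := fun c i c' =>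
    hasDerivAt_dAt_coordVec (u := fun t => spinorCrd σ a p (Ψ t) c i) hps
      (contMDiffAt_spinorCrd_family σ ha hφ hΨ t hp hy c i)
      (Eventually.of_forall fun y' => hs c i y') c'
  refine HasDerivAt.fun_sum fun i _ => HasDerivAt.add
    (HasDerivAt.fun_sum fun k _ => hasDerivAt_grassmann_mul (hm i _) (hm i _)) ?_
  refine ((hasDerivAt_grassmann_mul (hs 1 i y) ((hds Complex.I i 1).sub (hds 1 i Complex.I))).add
    (hasDerivAt_grassmann_mul (hs Complex.I i y)
      ((hds 1 i 1).add (hds Complex.I i Complex.I)))).congr_deriv ?_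
  simp only [spinDensity, Pi.add_apply, Pi.sub_apply]
  abel

end Family

end SusyDirac

namespace SusyDirac

open Filter Topology

/-! ### Parity of derivatives, and mixed partial derivatives. -/

section Parity

variable {L : ℕ}

/-- T is the projection onto a complement along S. Membership in S becomes the equation T x = 0, and
T commutes with derivatives and with integrals. -/
theorem exists_clm_ker_eq (S : Submodule ℝ (Grassmann L)) :
    ∃ T : Grassmann L →L[ℝ] Grassmann L, ∀ x, x ∈ S ↔ T x = 0 := by
  obtain ⟨q, hq⟩ := S.exists_isCompl
  refine ⟨LinearMap.toContinuousLinearMap (q.projection S hq.symm), fun x => ?_⟩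
  change _ ↔ (q.projection S hq.symm) x = 0
  rw [← LinearMap.mem_ker, Submodule.ker_projection]

variable {M : Type*} [TopologicalSpace M] [ChartedSpace ℂ M] [IsManifold 𝓘(ℂ) ω M]

theorem dAt_mem_of_forall_mem {S : Submodule ℝ (Grassmann L)} {u : M → Grassmann L} {y : M}
    (hu : MDifferentiableAt 𝓘(ℝ, ℂ) 𝓘(ℝ, Grassmann L) u y) (hS : ∀ y, u y ∈ S)
    (v : TangentSpace 𝓘(ℝ, ℂ) y) : dAt u y v ∈ S := by
  obtain ⟨T, hT⟩ := exists_clm_ker_eq S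
  rw [hT, ← dAt_clm T hu, funext fun y => (hT _).mp (hS y)]
  rw [dAt, mfderiv_const]
  rfl

end Parity

section SecondDerivative

variable {M : Type*} [TopologicalSpace M] [ChartedSpace ℂ M] [IsManifold 𝓘(ℂ) ω M]
  {G : Type*} [NormedAddCommGroup G] [NormedSpace ℝ G]

theorem contMDiffAt_dAt {f : M → G} {p y : M} (hy : y ∈ (chartAt ℂ p).source)
    (hf : ContMDiffAt 𝓘(ℝ, ℂ) 𝓘(ℝ, G) ∞ f y) (c : ℂ) :
    ContMDiffAt 𝓘(ℝ, ℂ) 𝓘(ℝ, G) ∞ (fun y => dAt f y (coordVec p y c)) y :=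
  contMDiffAt_slice (u := fun _ y => dAt f y (coordVec p y c)) (t := 0)
    (contMDiffAt_dAt_coordVec (u := fun _ => f) hy
      (ContMDiffAt.comp ((0 : ℝ), y) hf contMDiffAt_snd) c)

/-- Mixed partial derivatives in a chart commute. -/
theorem dAt_dAt_comm {f : M → G} {p y : M} (hy : y ∈ (chartAt ℂ p).source)
    (hf : ContMDiffAt 𝓘(ℝ, ℂ) 𝓘(ℝ, G) ∞ f y) (c c' : ℂ) :
    dAt (fun y => dAt f y (coordVec p y c)) y (coordVec p y c') =
      dAt (fun y => dAt f y (coordVec p y c')) y (coordVec p y c) := by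
  have h0 : ContDiffAt ℝ ∞ (f ∘ (chartAt ℂ p).symm) (chartAt ℂ p y) := by
    rw [← contMDiffAt_iff_contDiffAt]
    refine ContMDiffAt.comp _ ?_ (contMDiffAt_symm_of_mem_maximalAtlas
      (chartAt_mem_maximalAtlas_real p) ((chartAt ℂ p).map_source hy))
    rwa [(chartAt ℂ p).left_inv hy]
  have hD : HasFDerivAt (fderiv ℝ (f ∘ (chartAt ℂ p).symm)) _ (chartAt ℂ p y) :=
    ((h0.fderiv_right (m := 1) (by norm_cast)).differentiableAt (by simp)).hasFDerivAt
  have hd : ∀ᶠ z in 𝓝 (chartAt ℂ p y), DifferentiableAt ℝ (f ∘ (chartAt ℂ p).symm) z := by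
    filter_upwards [(h0.of_le (m := 1) (by exact_mod_cast le_top)).eventually (by simp)] with q hq
    exact hq.differentiableAt (by simp)
  have key : ∀ c c', dAt (fun y => dAt f y (coordVec p y c)) y (coordVec p y c') =
      fderiv ℝ (fderiv ℝ (f ∘ (chartAt ℂ p).symm)) (chartAt ℂ p y) c' c := by
    intro c c'
    have e : (fun y => dAt f y (coordVec p y c)) ∘ (chartAt ℂ p).symm =ᶠ[𝓝 (chartAt ℂ p y)]
        fun z => fderiv ℝ (f ∘ (chartAt ℂ p).symm) z c := by
      filter_upwards [hd, (chartAt ℂ p).open_target.mem_nhds ((chartAt ℂ p).map_source hy)]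
        with z hz hzt
      have hzs := (chartAt ℂ p).map_target hzt
      have hz' : DifferentiableAt ℝ (f ∘ (chartAt ℂ p).symm)
          (chartAt ℂ p ((chartAt ℂ p).symm z)) := by rwa [(chartAt ℂ p).right_inv hzt]
      have := dAt_of_hasFDerivAt hzs hz'.hasFDerivAt (coordVec p _ c)
      rw [vecCoord_coordVec hzs, (chartAt ℂ p).right_inv hzt] at this
      exact this
    have h1 := (hD.clm_apply (hasFDerivAt_const c _)).congr_of_eventuallyEq e
    rw [dAt_of_hasFDerivAt hy h1, vecCoord_coordVec hy]
    simp
  rw [key, key, (h0.isSymmSndFDerivAt (by simpa using ENat.LEInfty.out)).eq]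

end SecondDerivative

/-! ### The supersymmetry transformations in local frames. -/

section Supersymmetry

variable {n L : ℕ} {Y : Type*} [TopologicalSpace Y] [ChartedSpace (Euc n) Y]
  [IsManifold 𝓘(ℝ, Euc n) ∞ Y] {a : OpenPartialHomeomorph Y (Euc n)}
  {M : Type*} [TopologicalSpace M] [ChartedSpace ℂ M]
  (σ : SpinStructure M) {φ : M → Y}

/-- The component along `f` of a section of `𝕊 ⊗ Λ` in the frame `w_p`. -/
def secCrd (p : M) (s : (x : M) → Spinor σ x ⊗[ℝ] Grassmann L) (f : ℂ →ₗ[ℝ] ℝ) (y : M) :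
    Grassmann L :=
  contract (f ∘ₗ LinearMap.mulLeft ℝ (σ.root y p y)) (s y)

theorem secCrd_odd {s : (x : M) → Spinor σ x ⊗[ℝ] Grassmann L} (hs : ∀ x, HasParity 1 (s x))
    (p : M) (f : ℂ →ₗ[ℝ] ℝ) (y : M) : secCrd σ p s f y ∈ parityPart L 1 :=
  (hs y).contract_mem _

theorem coord_secCrd (s : (x : M) → Spinor σ x ⊗[ℝ] Grassmann L) (p : M) (f : ℂ →ₗ[ℝ] ℝ) (y : M)
    (ℓ : Grassmann L →ₗ[ℝ] ℝ) :
    ℓ (secCrd σ p s f y) = f (σ.root y p y * component ℓ (s y)) := by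
  rw [secCrd, apply_contract]
  rfl

theorem secCrd_change {p q y : M} (hp : y ∈ σ.dom p) (hq : y ∈ σ.dom q)
    (s : (x : M) → Spinor σ x ⊗[ℝ] Grassmann L) (f : ℂ →ₗ[ℝ] ℝ) :
    secCrd σ q s f y = secCrd σ p s (f ∘ₗ LinearMap.mulLeft ℝ (σ.root p q y)) y := by
  rw [secCrd, secCrd, ← σ.root_mul y p q y ⟨⟨σ.mem_dom y, hp⟩, hq⟩]
  congr 2
  refine LinearMap.ext fun z => ?_
  simp only [LinearMap.comp_apply, LinearMap.mulLeft_apply]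
  congr 1
  ring

theorem secCrd_self (s : (x : M) → Spinor σ x ⊗[ℝ] Grassmann L) (f : ℂ →ₗ[ℝ] ℝ) (y : M) :
    secCrd σ y s f y = contract f (s y) := by
  rw [secCrd, root_self σ (σ.mem_dom y)]
  congr 1
  refine LinearMap.ext fun z => ?_
  simp

theorem secCrd_linear (p : M) (s : (x : M) → Spinor σ x ⊗[ℝ] Grassmann L) (f : ℂ →ₗ[ℝ] ℝ)
    (y : M) : secCrd σ p s f y =
      f 1 • secCrd σ p s Complex.reLm y + f Complex.I • secCrd σ p s Complex.imLm y := by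
  have h : f ∘ₗ LinearMap.mulLeft ℝ (σ.root y p y) =
      f 1 • (Complex.reLm ∘ₗ LinearMap.mulLeft ℝ (σ.root y p y)) +
      f Complex.I • (Complex.imLm ∘ₗ LinearMap.mulLeft ℝ (σ.root y p y)) := by
    have hf : ∀ z : ℂ, f z = f 1 * z.re + f Complex.I * z.im := by
      intro z
      conv_lhs => rw [show z = z.re • (1 : ℂ) + z.im • Complex.I by simp [Complex.re_add_im]]
      rw [map_add, map_smul, map_smul, smul_eq_mul, smul_eq_mul]
      ring
    refine LinearMap.ext fun z => ?_
    simp only [LinearMap.comp_apply, LinearMap.add_apply, LinearMap.smul_apply, smul_eq_mul]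
    exact hf _
  rw [secCrd, h, contract_add, contract_smul, contract_smul]
  rfl

theorem contMDiffAt_secCrd {s : (x : M) → Spinor σ x ⊗[ℝ] Grassmann L} (hs : IsSmoothSpinor σ s)
    {p y : M} (hp : y ∈ σ.dom p) (f : ℂ →ₗ[ℝ] ℝ) :
    ContMDiffAt 𝓘(ℝ, ℂ) 𝓘(ℝ, Grassmann L) ∞ (secCrd σ p s f) y := by
  refine contMDiffAt_grassmann_iff.mpr fun I => ?_
  simp_rw [coord_secCrd]
  exact (LinearMap.toContinuousLinearMap f).contMDiff.contMDiffAt.comp y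
    ((hs _ p).contMDiffAt (σ.dom_mem_nhds hp))

/-- The spinor argument is expanded in the real basis r, r i of ℂ, and u = r⁻¹ reads off its
coordinates. With r a transition function this is the frame w_p. -/
theorem contract_gradedEval_complex {V : Type*} [AddCommGroup V] [Module ℝ V]
    (α : ℂ →ₗ[ℝ] V ⊗[ℝ] Grassmann L) (f : V →ₗ[ℝ] ℝ) (τ : ℂ ⊗[ℝ] Grassmann L) {r u : ℂ}
    (h : r * u = 1) : contract f (gradedEval α τ) =
      contract f (α (r * 1)) * contract (Complex.reLm ∘ₗ LinearMap.mulLeft ℝ u) τ +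
      contract f (α (r * Complex.I)) * contract (Complex.imLm ∘ₗ LinearMap.mulLeft ℝ u) τ := by
  induction τ with
  | zero => simp
  | add x y hx hy => rw [map_add, map_add, hx, hy]; simp only [map_add, mul_add]; abel
  | tmul w l =>
    have hw : w = (u * w).re • (r * 1) + (u * w).im • (r * Complex.I) := by
      simp only [Complex.real_smul]
      calc w = r * u * w := by rw [h, one_mul]
        _ = r * (((u * w).re : ℂ) + (u * w).im * Complex.I) := by
          rw [Complex.re_add_im]; ring
        _ = _ := by ring
    rw [contract_gradedEval]
    conv_lhs => rw [hw]
    simp only [map_add, map_smul, contract_tmul, LinearMap.comp_apply, LinearMap.mulLeft_apply,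
      add_mul, smul_mul_assoc, mul_smul_comm]
    rfl

theorem crd_susyMap {p y : M} (hp : y ∈ σ.dom p) (ψ : (x : M) → Twisted n L σ φ x)
    (s : (x : M) → Spinor σ x ⊗[ℝ] Grassmann L) (i : Fin n) :
    crd a (φ y) i (susyMap σ φ ψ s y) =
      spinorCrd σ a p ψ 1 i y * secCrd σ p s Complex.reLm y +
      spinorCrd σ a p ψ Complex.I i y * secCrd σ p s Complex.imLm y :=
  contract_gradedEval_complex (ψ y) _ (s y) (root_mul_root σ hp (σ.mem_dom y))

variable [IsManifold 𝓘(ℂ) ω M] (g₁ : SurfaceMetric M)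

theorem symplecticDual_apply (y : M) (τ : Spinor σ y ⊗[ℝ] Grassmann L) (c : Spinor σ y) :
    symplecticDual σ g₁ y τ c = contract ((spinorForm σ g₁ y).flip c) τ := by
  induction τ with
  | zero => simp
  | add u v hu hv => rw [map_add, LinearMap.add_apply, hu, hv, map_add]
  | tmul w l =>
    rw [symplecticDual, TensorProduct.lift.tmul, contract_tmul]
    rfl

theorem crd_dualTensor (y : M) (τ : Spinor σ y ⊗[ℝ] Grassmann L)
    (Z : TangentSpace 𝓘(ℝ, Euc n) (φ y)) (c : Spinor σ y) (i : Fin n) :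
    crd a (φ y) i (dualTensor g₁ σ φ y τ Z c) =
      (chartDeriv a (φ y) Z) i • contract ((spinorForm σ g₁ y).flip c) τ := by
  rw [dualTensor, LinearMap.comp_apply, TensorProduct.mk_apply, crd_tmul, symplecticDual_apply]

variable (ha : a ∈ IsManifold.maximalAtlas 𝓘(ℝ, Euc n) ∞ Y)
  (hφ : ContMDiff 𝓘(ℝ, ℂ) 𝓘(ℝ, Euc n) ∞ φ)

include ha hφ in
-- The √ρ of the symplectic form cancels the 1/√ρ of the frame vector inserted in dφ. The
-- conjugation in the symplectic form undoes the one in the Clifford multiplication, so the spinor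
-- enters complex linearly.
theorem crd_susySpinor_own {y : M} (hy : φ y ∈ a.source)
    (s : (x : M) → Spinor σ x ⊗[ℝ] Grassmann L) (c : ℂ) (i : Fin n) :
    crd a (φ y) i (susySpinor g₁ σ φ s y c) =
      dAt (fun y => a (φ y) i) y (coordVec y y 1) •
          contract (Complex.imLm ∘ₗ LinearMap.mulLeft ℝ c) (s y) -
        dAt (fun y => a (φ y) i) y (coordVec y y Complex.I) •
          contract (Complex.reLm ∘ₗ LinearMap.mulLeft ℝ c) (s y) := by
  have h0 := sqrt_conformalFactor_pos g₁ y
  have hk : ∀ k, crd a (φ y) i (dualTensor g₁ σ φ y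
      (gradedClifford σ g₁ y (orthoFrame g₁ y k) (s y))
      (mfderiv 𝓘(ℝ, ℂ) 𝓘(ℝ, Euc n) φ y (orthoFrame g₁ y k)) c) =
      dAt (fun y => a (φ y) i) y (coordVec y y (direction k)) •
        contract (Complex.imLm ∘ₗ
          LinearMap.mulLeft ℝ ((starRingEnd ℂ) (direction k) * c)) (s y) := by
    intro k
    rw [crd_dualTensor, gradedClifford, contract_comp, chartDeriv_mfderiv ha hφ hy, orthoFrame_eq,
      map_smul, smul_eq_mul, mul_comm, mul_smul, ← contract_smul, ← orthoFrame_eq]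
    refine congrArg (HSMul.hSMul _) (congrArg (fun f => contract f (s y)) ?_)
    refine LinearMap.ext fun w => ?_
    rw [LinearMap.smul_apply, LinearMap.comp_apply, LinearMap.flip_apply, clifford_orthoFrame]
    change (Real.sqrt (conformalFactor g₁ y y))⁻¹ • (Real.sqrt (conformalFactor g₁ y y) *
      ((starRingEnd ℂ) (direction k * (starRingEnd ℂ) w) * c).im) =
      ((starRingEnd ℂ) (direction k) * c * w).im
    rw [smul_eq_mul, inv_mul_cancel_left₀ h0.ne', map_mul, Complex.conj_conj]
    congr 1
    ring
  rw [susySpinor, LinearMap.sum_apply, map_sum, Fin.sum_univ_two, hk, hk, sub_eq_add_neg,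
    ← smul_neg]
  have hd0 : direction 0 = 1 := rfl
  have hd1 : direction 1 = Complex.I := rfl
  rw [hd0, hd1, map_one (starRingEnd ℂ), one_mul, Complex.conj_I]
  congr 2
  rw [← neg_one_smul ℝ (contract _ (s y)), ← contract_smul]
  refine congrArg (fun f => contract f (s y)) (LinearMap.ext fun w => ?_)
  simp
  ring

include ha hφ in
-- The right side is the imaginary part of (∂₁φ − i∂₂φ) · c · s, so it keeps its form in every
-- frame: the first factor is multiplied by r², and one r supplied by the argument c and another by
-- the components of s account for it.
theorem spinorCrd_susySpinor {p y : M} (hp : y ∈ σ.dom p) (hy : φ y ∈ a.source)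
    (s : (x : M) → Spinor σ x ⊗[ℝ] Grassmann L) (c : ℂ) (i : Fin n) :
    spinorCrd σ a p (susySpinor g₁ σ φ s) c i y =
      dAt (fun y => a (φ y) i) y (coordVec p y 1) •
          secCrd σ p s (Complex.imLm ∘ₗ LinearMap.mulLeft ℝ c) y -
        dAt (fun y => a (φ y) i) y (coordVec p y Complex.I) •
          secCrd σ p s (Complex.reLm ∘ₗ LinearMap.mulLeft ℝ c) y := by
  have hy' := σ.mem_dom y
  set r := σ.root p y y with hr
  have hsec : ∀ f : ℂ →ₗ[ℝ] ℝ, contract (f ∘ₗ LinearMap.mulLeft ℝ (r * c)) (s y) =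
      secCrd σ p s (f ∘ₗ LinearMap.mulLeft ℝ (r ^ 2 * c)) y := by
    intro f
    rw [← secCrd_self σ s, secCrd_change σ hp hy']
    congr 1
    refine LinearMap.ext fun w => ?_
    simp only [LinearMap.comp_apply, LinearMap.mulLeft_apply]
    congr 1
    ring
  rw [spinorCrd, crd_susySpinor_own σ g₁ ha hφ hy, hsec, hsec, coordVec_eq_coordVec σ hp hy',
    coordVec_eq_coordVec σ hp hy', ← hr]
  set t := r ^ 2 with ht
  have h1 : coordVec y y (t * 1) = t.re • coordVec y y 1 + t.im • coordVec y y Complex.I := by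
    rw [mul_one, ← coordVec_add_smul]
  have h2 : coordVec y y (t * Complex.I) =
      -t.im • coordVec y y 1 + t.re • coordVec y y Complex.I := by
    rw [← coordVec_add_smul]
    congr 1
    apply Complex.ext <;> simp
  rw [h1, h2]
  simp only [map_add, map_smul]
  rw [secCrd_linear σ p s (Complex.imLm ∘ₗ LinearMap.mulLeft ℝ (t * c)),
    secCrd_linear σ p s (Complex.reLm ∘ₗ LinearMap.mulLeft ℝ (t * c)),
    secCrd_linear σ p s (Complex.imLm ∘ₗ LinearMap.mulLeft ℝ c),
    secCrd_linear σ p s (Complex.reLm ∘ₗ LinearMap.mulLeft ℝ c)]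
  simp only [LinearMap.comp_apply, LinearMap.mulLeft_apply, Complex.reLm_coe, Complex.imLm_coe,
    mul_one, Complex.mul_re, Complex.mul_im, Complex.I_re, Complex.I_im, mul_zero, zero_sub,
    add_zero, smul_eq_mul]
  module

theorem spinorCrd_add_smul (p : M) (ψ χ : (x : M) → Twisted n L σ φ x) (t : ℝ) (c : ℂ) (i : Fin n)
    (y : M) : spinorCrd σ a p (fun x => ψ x + t • χ x) c i y =
      spinorCrd σ a p ψ c i y + t • spinorCrd σ a p χ c i y := by
  simp only [spinorCrd, LinearMap.add_apply, LinearMap.smul_apply, map_add, map_smul]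

include hφ in
/-- The linear family is a supersymmetry variation. -/
theorem isSusyVariation_linear {g₂ : TargetMetric n Y} (hg₂ : IsFlat g₂)
    {ψ : (x : M) → Twisted n L σ φ x} (hψ : IsSmoothTwisted σ φ ψ)
    (hψ_odd : ∀ x c, HasParity 1 (ψ x c)) {s : (x : M) → Spinor σ x ⊗[ℝ] Grassmann L}
    (hs : IsSmoothSpinor σ s) (hs_odd : ∀ x, HasParity 1 (s x)) :
    IsSusyVariation g₁ σ φ ψ s (fun t => t • susyMap σ φ ψ s)
      (fun t x => ψ x + t • susySpinor g₁ σ φ s x) where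
  smooth_map := by
    refine (isSmoothAlong_iff isOpen_univ).mpr ?_
    rintro ⟨t, y⟩ -
    obtain ⟨hy, hai⟩ := flatChart_spec hg₂ (φ y)
    have hp := σ.mem_dom y
    have h1 : ContMDiffAt (𝓘(ℝ, ℝ).prod 𝓘(ℝ, ℂ)) 𝓘(ℝ, Euc n) ∞
        (fun q : ℝ × M => φ q.2) (t, y) := ContMDiffAt.comp (t, y) hφ.contMDiffAt contMDiffAt_snd
    refine (smoothAlongAt_iff hai.1 h1 hy).mpr fun i => ?_
    have h2 : ContMDiffAt 𝓘(ℝ, ℂ) 𝓘(ℝ, Grassmann L) ∞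
        (fun y' => crd (flatChart hg₂ (φ y)) (φ y') i (susyMap σ φ ψ s y')) y := by
      refine (contMDiffAt_grassmann_add
        (contMDiffAt_grassmann_mul (contMDiffAt_spinorCrd σ hai.1 hφ hψ hp hy 1 i)
          (contMDiffAt_secCrd σ hs hp Complex.reLm))
        (contMDiffAt_grassmann_mul (contMDiffAt_spinorCrd σ hai.1 hφ hψ hp hy Complex.I i)
          (contMDiffAt_secCrd σ hs hp Complex.imLm))).congr_of_eventuallyEq ?_
      filter_upwards [σ.dom_mem_nhds hp] with y' hy'
      exact crd_susyMap σ hy' ψ s i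
    have h3 := contMDiffAt_grassmann_smul (contMDiffAt_fst (p := (t, y)) (I := 𝓘(ℝ, ℝ))
      (J := 𝓘(ℝ, ℂ)) (n := ∞)) (ContMDiffAt.comp (t, y) h2 contMDiffAt_snd)
    refine h3.congr_of_eventuallyEq (Eventually.of_forall fun q => ?_)
    exact map_smul (crd _ _ i) q.1 (susyMap σ φ ψ s q.2)
  smooth_spinor := by
    intro p c
    refine (isSmoothAlong_iff (isOpen_univ.prod (σ.isOpen_dom p))).mpr ?_
    rintro ⟨t, y⟩ ⟨-, hp⟩
    replace hp : y ∈ σ.dom p := hp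
    obtain ⟨hy, hai⟩ := flatChart_spec hg₂ (φ y)
    have h1 : ContMDiffAt (𝓘(ℝ, ℝ).prod 𝓘(ℝ, ℂ)) 𝓘(ℝ, Euc n) ∞
        (fun q : ℝ × M => φ q.2) (t, y) := ContMDiffAt.comp (t, y) hφ.contMDiffAt contMDiffAt_snd
    refine (smoothAlongAt_iff hai.1 h1 hy).mpr fun i => ?_
    have hD := contMDiffAt_dAt (σ.dom_subset p hp) (contMDiffAt_chart_coord hai.1 hφ hy i)
    have h2 : ContMDiffAt 𝓘(ℝ, ℂ) 𝓘(ℝ, Grassmann L) ∞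
        (spinorCrd σ (flatChart hg₂ (φ y)) p (susySpinor g₁ σ φ s) c i) y := by
      refine (contMDiffAt_grassmann_sub
        (contMDiffAt_grassmann_smul (hD 1) (contMDiffAt_secCrd σ hs hp
          (Complex.imLm ∘ₗ LinearMap.mulLeft ℝ c)))
        (contMDiffAt_grassmann_smul (hD Complex.I) (contMDiffAt_secCrd σ hs hp
          (Complex.reLm ∘ₗ LinearMap.mulLeft ℝ c)))).congr_of_eventuallyEq ?_
      filter_upwards [σ.dom_mem_nhds hp, hφ.continuous.continuousAt
        ((flatChart hg₂ (φ y)).open_source.mem_nhds hy)] with y' hy' hy''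
      exact spinorCrd_susySpinor σ g₁ hai.1 hφ hy' hy'' s c i
    have h3 := contMDiffAt_grassmann_add
      (ContMDiffAt.comp (t, y) (contMDiffAt_spinorCrd σ hai.1 hφ hψ hp hy c i) contMDiffAt_snd)
      (contMDiffAt_grassmann_smul (contMDiffAt_fst (p := (t, y)) (I := 𝓘(ℝ, ℝ))
      (J := 𝓘(ℝ, ℂ)) (n := ∞)) (ContMDiffAt.comp (t, y) h2 contMDiffAt_snd))
    refine h3.congr_of_eventuallyEq (Eventually.of_forall fun q => ?_)
    exact spinorCrd_add_smul σ p ψ (susySpinor g₁ σ φ s) q.1 c i q.2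
  even_map t x := (hasParity_gradedEval (hψ_odd x) (hs_odd x)).smul t
  odd_spinor t x c := by
    refine (hψ_odd x c).add (b := t • susySpinor g₁ σ φ s x c) (HasParity.smul t ?_)
    rw [susySpinor, LinearMap.sum_apply]
    refine hasParity_sum _ fun k _ => ?_
    rw [dualTensor, LinearMap.comp_apply, TensorProduct.mk_apply, symplecticDual_apply]
    refine hasParity_tmul _ ?_
    rw [gradedClifford, contract_comp]
    exact (hs_odd x).contract_mem _
  map_zero := by simp
  spinor_zero := by simp
  deriv_map x ℓ := by
    simpa using (hasDerivAt_id (0 : ℝ)).mul_const (ℓ (susyMap σ φ ψ s x))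
  deriv_spinor x c ℓ := by
    simpa using ((hasDerivAt_id (0 : ℝ)).mul_const
      (ℓ (susySpinor g₁ σ φ s x c))).const_add (ℓ (ψ x c))

end Supersymmetry

end SusyDirac

namespace SusyDirac

open Filter Topology

/-! ### The algebraic identity behind the first variation. -/

section Algebra

variable {L : ℕ}

/-- The first variation of the Lagrangian density, in one coordinate of the target: the map has the
partial derivatives `D₁`, `D₂`, the spinor has the components `a`, `b`, and the parameter of the
supersymmetry has the components `s`, `t`. -/
theorem variation_eq_divergence {a b a₁ a₂ b₁ b₂ s t s₁ s₂ t₁ t₂ : Grassmann L}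
    (ha₁ : a₁ ∈ parityPart L 1) (ha₂ : a₂ ∈ parityPart L 1) (hb₁ : b₁ ∈ parityPart L 1)
    (hb₂ : b₂ ∈ parityPart L 1) (hs : s ∈ parityPart L 1) (ht : t ∈ parityPart L 1)
    (D₁ D₂ D₁₁ D₁₂ D₂₂ : ℝ) :
    ((D₁ • (1 : Grassmann L)) * (a * s₁ + a₁ * s + (b * t₁ + b₁ * t)) +
        (a * s₁ + a₁ * s + (b * t₁ + b₁ * t)) * (D₁ • (1 : Grassmann L)) +
      ((D₂ • (1 : Grassmann L)) * (a * s₂ + a₂ * s + (b * t₂ + b₂ * t)) +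
        (a * s₂ + a₂ * s + (b * t₂ + b₂ * t)) * (D₂ • (1 : Grassmann L)))) +
      (spinDensity a b
        (D₁ • t₁ + D₁₁ • t - (D₂ • s₁ + D₁₂ • s)) (D₁ • t₂ + D₁₂ • t - (D₂ • s₂ + D₂₂ • s))
        (D₁ • s₁ + D₁₁ • s + (D₂ • t₁ + D₁₂ • t)) (D₁ • s₂ + D₁₂ • s + (D₂ • t₂ + D₂₂ • t)) +
      spinDensity (D₁ • t - D₂ • s) (D₁ • s + D₂ • t) a₁ a₂ b₁ b₂) =
    ((D₁ • a + D₂ • b) * s₁ + (D₁ • a₁ + D₁₁ • a + (D₂ • b₁ + D₁₂ • b)) * s +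
      ((D₁ • b - D₂ • a) * t₁ + (D₁ • b₁ + D₁₁ • b - (D₂ • a₁ + D₁₂ • a)) * t)) +
    ((D₁ • a + D₂ • b) * t₂ + (D₁ • a₂ + D₁₂ • a + (D₂ • b₂ + D₂₂ • b)) * t +
      ((D₂ • a - D₁ • b) * s₂ + (D₂ • a₂ + D₂₂ • a - (D₁ • b₂ + D₁₂ • b)) * s)) +
    (2 : ℝ) • (a * (D₁ • (s₁ - t₂) + D₂ • (t₁ + s₂)) +
      b * (D₁ • (t₁ + s₂) - D₂ • (s₁ - t₂))) := by
  -- The only sign rule used moves s and t to the right of the derivatives of a and b. After that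
  -- both sides are combinations of the same ordered products, with equal coefficients.
  simp only [spinDensity, mul_add, mul_sub, add_mul, sub_mul, mul_smul_comm, smul_mul_assoc,
    mul_one, one_mul, odd_mul_odd hs ha₁, odd_mul_odd hs ha₂, odd_mul_odd hs hb₁,
    odd_mul_odd hs hb₂, odd_mul_odd ht ha₁, odd_mul_odd ht ha₂, odd_mul_odd ht hb₁,
    odd_mul_odd ht hb₂]
  module

end Algebra

/-! ### The supersymmetry current and its divergence. -/

section Current

variable {n L : ℕ} {Y : Type*} [TopologicalSpace Y] [ChartedSpace (Euc n) Y]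
  [IsManifold 𝓘(ℝ, Euc n) ∞ Y] {a : OpenPartialHomeomorph Y (Euc n)}
  {M : Type*} [TopologicalSpace M] [ChartedSpace ℂ M] [IsManifold 𝓘(ℂ) ω M]
  (σ : SpinStructure M) {φ : M → Y} (g₂ : TargetMetric n Y)

/-- The contraction of `dφ` and `ψ`, in the chart of `M` at `p` and the frame `w_p`. -/
def pairing (p : M) (ψ : (x : M) → Twisted n L σ φ x) (v c : ℂ) (y : M) : Grassmann L :=
  targetForm g₂ (φ y) ((mfderiv 𝓘(ℝ, ℂ) 𝓘(ℝ, Euc n) φ y (coordVec p y v)) ⊗ₜ[ℝ] (1 : Grassmann L))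
    (ψ y (σ.root p y y * c : ℂ))

/-- The components of the density `ρ J` of the supersymmetry current, in the chart at `p`. -/
def currentDensity (p : M) (ψ : (x : M) → Twisted n L σ φ x)
    (s : (x : M) → Spinor σ x ⊗[ℝ] Grassmann L) : Fin 2 → M → Grassmann L :=
  ![fun y => (pairing σ g₂ p ψ 1 1 y + pairing σ g₂ p ψ Complex.I Complex.I y) *
        secCrd σ p s Complex.reLm y +
      (pairing σ g₂ p ψ 1 Complex.I y - pairing σ g₂ p ψ Complex.I 1 y) *
        secCrd σ p s Complex.imLm y,
    fun y => (pairing σ g₂ p ψ 1 1 y + pairing σ g₂ p ψ Complex.I Complex.I y) *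
        secCrd σ p s Complex.imLm y +
      (pairing σ g₂ p ψ Complex.I 1 y - pairing σ g₂ p ψ 1 Complex.I y) *
        secCrd σ p s Complex.reLm y]

variable {g₂} (hφ : ContMDiff 𝓘(ℝ, ℂ) 𝓘(ℝ, Euc n) ∞ φ)

include hφ in
theorem pairing_eq (hai : IsIsometricChart g₂ a) {y : M} (hy : φ y ∈ a.source) (p : M)
    (ψ : (x : M) → Twisted n L σ φ x) (v c : ℂ) :
    pairing σ g₂ p ψ v c y =
      ∑ i, dAt (fun y => a (φ y) i) y (coordVec p y v) • spinorCrd σ a p ψ c i y := by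
  rw [pairing, hai.targetForm_eq hy]
  refine Finset.sum_congr rfl fun i _ => ?_
  rw [crd_tmul, chartDeriv_mfderiv hai.1 hφ hy, smul_mul_assoc, one_mul]
  rfl

include hφ in
theorem pairing_change (hg₂ : IsFlat g₂) {p q y : M} (hp : y ∈ σ.dom p) (hq : y ∈ σ.dom q)
    (ψ : (x : M) → Twisted n L σ φ x) (v c : ℂ) :
    pairing σ g₂ p ψ v c y =
      (σ.root p q y ^ 2 * v).re • ((σ.root p q y * c).re • pairing σ g₂ q ψ 1 1 y +
        (σ.root p q y * c).im • pairing σ g₂ q ψ 1 Complex.I y) +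
      (σ.root p q y ^ 2 * v).im • ((σ.root p q y * c).re • pairing σ g₂ q ψ Complex.I 1 y +
        (σ.root p q y * c).im • pairing σ g₂ q ψ Complex.I Complex.I y) := by
  obtain ⟨hy, hai⟩ := flatChart_spec hg₂ (φ y)
  simp only [pairing_eq σ hφ hai hy]
  simp only [Finset.smul_sum, ← Finset.sum_add_distrib]
  refine Finset.sum_congr rfl fun i _ => ?_
  rw [spinorCrd_change σ hp hq, coordVec_eq_coordVec σ hp hq,
    ← Complex.eta (σ.root p q y ^ 2 * v), coordVec_add_smul]
  simp only [map_add, map_smul]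
  module

include hφ in
-- In complex form the density is the sum over target coordinates of (∂₁φ + i∂₂φ)(a − ib)(s + it).
-- Going from q to p the three factors are multiplied by the conjugate of r², by r and by r⁻¹. The
-- result, the conjugate of r², is the law for ρJ: |r²|² from ρ and r⁻² from the vector.
theorem currentDensity_change (hg₂ : IsFlat g₂) {p q y : M} (hp : y ∈ σ.dom p) (hq : y ∈ σ.dom q)
    (ψ : (x : M) → Twisted n L σ φ x) (s : (x : M) → Spinor σ x ⊗[ℝ] Grassmann L) :
    currentDensity σ g₂ p ψ s 0 y =
        (σ.root p q y ^ 2).re • currentDensity σ g₂ q ψ s 0 y +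
        (σ.root p q y ^ 2).im • currentDensity σ g₂ q ψ s 1 y ∧
      currentDensity σ g₂ p ψ s 1 y =
        (σ.root p q y ^ 2).re • currentDensity σ g₂ q ψ s 1 y -
        (σ.root p q y ^ 2).im • currentDensity σ g₂ q ψ s 0 y := by
  have h1 : secCrd σ q s Complex.reLm y = (σ.root p q y).re • secCrd σ p s Complex.reLm y -
      (σ.root p q y).im • secCrd σ p s Complex.imLm y := by
    rw [secCrd_change σ hp hq, secCrd_linear]
    simp [sub_eq_add_neg]
  have h2 : secCrd σ q s Complex.imLm y = (σ.root p q y).im • secCrd σ p s Complex.reLm y +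
      (σ.root p q y).re • secCrd σ p s Complex.imLm y := by
    rw [secCrd_change σ hp hq, secCrd_linear]
    simp
  simp only [currentDensity, Matrix.cons_val_zero, Matrix.cons_val_one, h1, h2,
    pairing_change σ hφ hg₂ hp hq ψ]
  set r := σ.root p q y
  constructor
  all_goals
    simp only [pow_two, mul_one, Complex.mul_re, Complex.mul_im, Complex.I_re, Complex.I_im,
      mul_zero, zero_sub, add_zero, mul_add, mul_sub, add_mul, sub_mul,
      mul_smul_comm, smul_mul_assoc, smul_add, smul_sub]
    module

variable (g₁ : SurfaceMetric M)

variable (g₂) in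
/-- The supersymmetry current. -/
def current (ψ : (x : M) → Twisted n L σ φ x) (s : (x : M) → Spinor σ x ⊗[ℝ] Grassmann L)
    (x : M) : TangentSpace 𝓘(ℝ, ℂ) x ⊗[ℝ] Grassmann L :=
  ∑ k, coordVec x x (direction k) ⊗ₜ[ℝ]
    ((conformalFactor g₁ x x)⁻¹ • currentDensity σ g₂ x ψ s k x)

include hφ in
-- `current` is assembled at each point from that point's own chart and frame. Expressing it near y
-- in one fixed chart is what gives its smoothness and its divergence.
theorem vecCoord_current (hg₂ : IsFlat g₂) {g₁ : SurfaceMetric M} (hg₁ : IsConformal g₁) {p y : M}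
    (hp : y ∈ σ.dom p)
    (ψ : (x : M) → Twisted n L σ φ x) (s : (x : M) → Spinor σ x ⊗[ℝ] Grassmann L)
    (ℓ : Grassmann L →ₗ[ℝ] ℝ) :
    vecCoord p y (component ℓ (current σ g₂ g₁ ψ s y)) =
      (conformalFactor g₁ p y)⁻¹ • (⟨ℓ (currentDensity σ g₂ p ψ s 0 y),
        ℓ (currentDensity σ g₂ p ψ s 1 y)⟩ : ℂ) := by
  have hy' := σ.mem_dom y
  obtain ⟨h0, h1⟩ := currentDensity_change σ hφ hg₂ hp hy' ψ s
  have hd0 : direction 0 = 1 := rfl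
  have hd1 : direction 1 = Complex.I := rfl
  have hr := root_ne_zero σ hp hy'
  have hinv : σ.root y p y ^ 2 * σ.root p y y ^ 2 = 1 := by
    rw [← mul_pow, root_mul_root σ hy' hp, one_pow]
  rw [current, Fin.sum_univ_two, map_add, map_add, component_tmul, component_tmul]
  simp only [map_smul, vecCoord_coordVec_eq σ hy' hp]
  rw [h0, h1,
    hg₁.conformalFactor_eq (σ.dom_subset p hp) (mem_chart_source ℂ y), ← σ.root_sq p y y ⟨hp, hy'⟩,
    hd0, hd1]
  set t := σ.root p y y ^ 2 with ht
  have ht0 : t ≠ 0 := pow_ne_zero 2 hr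
  have hu : σ.root y p y ^ 2 = t⁻¹ := eq_inv_of_mul_eq_one_left hinv
  rw [hu, Complex.inv_def]
  have hρ := (conformalFactor_pos g₁ (mem_chart_source ℂ y)).ne'
  apply Complex.ext
  · simp
    ring
  · simp
    ring

theorem currentDensity_even {ψ : (x : M) → Twisted n L σ φ x} (hg₂ : IsFlat g₂)
    (hφ : ContMDiff 𝓘(ℝ, ℂ) 𝓘(ℝ, Euc n) ∞ φ)
    (hψ : ∀ x c, HasParity 1 (ψ x c)) {s : (x : M) → Spinor σ x ⊗[ℝ] Grassmann L}
    (hs : ∀ x, HasParity 1 (s x)) (p : M) (k : Fin 2) (y : M) :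
    currentDensity σ g₂ p ψ s k y ∈ parityPart L 0 := by
  obtain ⟨hy, hai⟩ := flatChart_spec hg₂ (φ y)
  have hP : ∀ v c, pairing σ g₂ p ψ v c y ∈ parityPart L 1 := by
    intro v c
    rw [pairing_eq σ hφ hai hy]
    exact Submodule.sum_mem _ fun i _ => Submodule.smul_mem _ _ (spinorCrd_odd σ hψ c i y)
  have hS := fun f => secCrd_odd σ hs p f y
  fin_cases k
  · exact Submodule.add_mem _ (odd_mul_odd_mem (Submodule.add_mem _ (hP _ _) (hP _ _)) (hS _))
      (odd_mul_odd_mem (Submodule.sub_mem _ (hP _ _) (hP _ _)) (hS _))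
  · exact Submodule.add_mem _ (odd_mul_odd_mem (Submodule.add_mem _ (hP _ _) (hP _ _)) (hS _))
      (odd_mul_odd_mem (Submodule.sub_mem _ (hP _ _) (hP _ _)) (hS _))

theorem hasParity_current {ψ : (x : M) → Twisted n L σ φ x} (hg₂ : IsFlat g₂)
    (hφ : ContMDiff 𝓘(ℝ, ℂ) 𝓘(ℝ, Euc n) ∞ φ)
    (hψ : ∀ x c, HasParity 1 (ψ x c)) {s : (x : M) → Spinor σ x ⊗[ℝ] Grassmann L}
    (hs : ∀ x, HasParity 1 (s x)) (x : M) : HasParity 0 (current σ g₂ g₁ ψ s x) :=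
  hasParity_sum _ fun k _ => hasParity_tmul _
    (Submodule.smul_mem _ _ (currentDensity_even σ hg₂ hφ hψ hs x k x))

include hφ in
theorem contMDiffAt_pairing (hg₂ : IsFlat g₂) {ψ : (x : M) → Twisted n L σ φ x}
    (hψ : IsSmoothTwisted σ φ ψ) {p y : M} (hp : y ∈ σ.dom p) (v c : ℂ) :
    ContMDiffAt 𝓘(ℝ, ℂ) 𝓘(ℝ, Grassmann L) ∞ (pairing σ g₂ p ψ v c) y := by
  obtain ⟨hy, hai⟩ := flatChart_spec hg₂ (φ y)
  have h : ContMDiffAt 𝓘(ℝ, ℂ) 𝓘(ℝ, Grassmann L) ∞ (fun y' => ∑ i,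
      dAt (fun y' => flatChart hg₂ (φ y) (φ y') i) y' (coordVec p y' v) •
        spinorCrd σ (flatChart hg₂ (φ y)) p ψ c i y') y :=
    contMDiffAt_grassmann_sum fun i _ => contMDiffAt_grassmann_smul
      (contMDiffAt_dAt (σ.dom_subset p hp) (contMDiffAt_chart_coord hai.1 hφ hy i) v)
      (contMDiffAt_spinorCrd σ hai.1 hφ hψ hp hy c i)
  refine h.congr_of_eventuallyEq ?_
  filter_upwards [hφ.continuous.continuousAt
    ((flatChart hg₂ (φ y)).open_source.mem_nhds hy)] with y' hy'
  exact pairing_eq σ hφ hai hy' p ψ v c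

include hφ in
theorem contMDiffAt_currentDensity (hg₂ : IsFlat g₂) {ψ : (x : M) → Twisted n L σ φ x}
    (hψ : IsSmoothTwisted σ φ ψ) {s : (x : M) → Spinor σ x ⊗[ℝ] Grassmann L}
    (hs : IsSmoothSpinor σ s) {p y : M} (hp : y ∈ σ.dom p) (k : Fin 2) :
    ContMDiffAt 𝓘(ℝ, ℂ) 𝓘(ℝ, Grassmann L) ∞ (currentDensity σ g₂ p ψ s k) y := by
  have hP := fun v c => contMDiffAt_pairing σ hφ hg₂ hψ hp v c
  have hS := fun f => contMDiffAt_secCrd σ hs hp f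
  fin_cases k
  · exact contMDiffAt_grassmann_add
      (contMDiffAt_grassmann_mul (contMDiffAt_grassmann_add (hP _ _) (hP _ _)) (hS _))
      (contMDiffAt_grassmann_mul (contMDiffAt_grassmann_sub (hP _ _) (hP _ _)) (hS _))
  · exact contMDiffAt_grassmann_add
      (contMDiffAt_grassmann_mul (contMDiffAt_grassmann_add (hP _ _) (hP _ _)) (hS _))
      (contMDiffAt_grassmann_mul (contMDiffAt_grassmann_sub (hP _ _) (hP _ _)) (hS _))

include hφ in
theorem contMDiff_current (hg₂ : IsFlat g₂) {g₁ : SurfaceMetric M} (hg₁ : IsConformal g₁)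
    {ψ : (x : M) → Twisted n L σ φ x}
    (hψ : IsSmoothTwisted σ φ ψ) {s : (x : M) → Spinor σ x ⊗[ℝ] Grassmann L}
    (hs : IsSmoothSpinor σ s) (ℓ : Grassmann L →ₗ[ℝ] ℝ) :
    ContMDiff 𝓘(ℝ, ℂ) 𝓘(ℝ, ℂ).tangent ∞
      (fun x => (⟨x, component ℓ (current σ g₂ g₁ ψ s x)⟩ : TangentBundle 𝓘(ℝ, ℂ) M)) := by
  intro y
  have hp := σ.mem_dom y
  have hys := mem_chart_source ℂ y
  refine (contMDiffAt_tangentBundle_iff (f := fun y => y) (chartAt_mem_maximalAtlas_real y) hys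
    contMDiffAt_id).mpr ?_
  have hρ := (contMDiffAt_conformalFactor g₁ hys).inv₀ (conformalFactor_pos g₁ hys).ne'
  have hc : ∀ k, ContMDiffAt 𝓘(ℝ, ℂ) 𝓘(ℝ, ℝ) ∞
      (fun y' => ℓ (currentDensity σ g₂ y ψ s k y')) y := fun k =>
    (LinearMap.toContinuousLinearMap ℓ).contMDiff.contMDiffAt.comp y
      (contMDiffAt_currentDensity σ hφ hg₂ hψ hs hp k)
  have h : ContMDiffAt 𝓘(ℝ, ℂ) 𝓘(ℝ, ℂ) ∞ (fun y' => (conformalFactor g₁ y y')⁻¹ •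
      Complex.equivRealProdCLM.symm (ℓ (currentDensity σ g₂ y ψ s 0 y'),
        ℓ (currentDensity σ g₂ y ψ s 1 y'))) y :=
    hρ.smul (Complex.equivRealProdCLM.symm.toContinuousLinearMap.contMDiff.contMDiffAt.comp y
      ((hc 0).prodMk_space (hc 1)))
  refine h.congr_of_eventuallyEq ?_
  filter_upwards [σ.dom_mem_nhds hp] with y' hy'
  exact (vecCoord_current σ hφ hg₂ hg₁ hy' ψ s ℓ).trans (by
    congr 1)

include hφ in
-- For a conformal metric √det g is ρ, so the densities differentiated in `divergence` agree near x
-- with the components of `currentDensity`.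
theorem gradedDivergence_current (hg₂ : IsFlat g₂) {g₁ : SurfaceMetric M} (hg₁ : IsConformal g₁)
    {ψ : (x : M) → Twisted n L σ φ x}
    (hψ : IsSmoothTwisted σ φ ψ) {s : (x : M) → Spinor σ x ⊗[ℝ] Grassmann L}
    (hs : IsSmoothSpinor σ s) (x : M) :
    gradedDivergence g₁ (current σ g₂ g₁ ψ s) x = (conformalFactor g₁ x x)⁻¹ •
      (dAt (currentDensity σ g₂ x ψ s 0) x (coordVec x x 1) +
        dAt (currentDensity σ g₂ x ψ s 1) x (coordVec x x Complex.I)) := by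
  have hp := σ.mem_dom x
  have hm := fun k => (contMDiffAt_currentDensity σ hφ hg₂ hψ hs hp k).mdifferentiableAt
    (n := ∞) (by simp)
  rw [← sum_coord_smul ((conformalFactor g₁ x x)⁻¹ • _), gradedDivergence]
  refine Finset.sum_congr rfl fun I _ => ?_
  congr 1
  set ℓ := (grassmannBasis L).coord I with hℓ
  have hev : ∀ᶠ y in 𝓝 x, (areaDensity g₁ x y * (vecCoord x y (component ℓ
        (current σ g₂ g₁ ψ s y))).re = ℓ (currentDensity σ g₂ x ψ s 0 y)) ∧
      (areaDensity g₁ x y * (vecCoord x y (component ℓ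
        (current σ g₂ g₁ ψ s y))).im = ℓ (currentDensity σ g₂ x ψ s 1 y)) := by
    filter_upwards [σ.dom_mem_nhds hp] with y hy
    have hys := σ.dom_subset x hy
    have hρ := (conformalFactor_pos g₁ hys).ne'
    rw [vecCoord_current σ hφ hg₂ hg₁ hy, hg₁.areaDensity_eq hys]
    simp [hρ]
  have hl : ∀ k v, dAt (fun y => ℓ (currentDensity σ g₂ x ψ s k y)) x v =
      ℓ (dAt (currentDensity σ g₂ x ψ s k) x v) := fun k v =>
    dAt_clm (LinearMap.toContinuousLinearMap ℓ) (hm k) v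
  rw [divergence, dAt_congr (hev.mono fun y h => h.1), dAt_congr (hev.mono fun y h => h.2), hl, hl,
    hg₁.areaDensity_eq (mem_chart_source ℂ x), map_smul, map_add, smul_eq_mul]

theorem dAt_sum {G : Type*} [NormedAddCommGroup G] [NormedSpace ℝ G] {ι : Type*} {t : Finset ι}
    {u : ι → M → G} {y : M} (hu : ∀ i ∈ t, MDifferentiableAt 𝓘(ℝ, ℂ) 𝓘(ℝ, G) (u i) y)
    (v : TangentSpace 𝓘(ℝ, ℂ) y) :
    dAt (fun y => ∑ i ∈ t, u i y) y v = ∑ i ∈ t, dAt (u i) y v := by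
  have hy := mem_chart_source ℂ y
  have h := HasFDerivAt.fun_sum (u := t) fun i hi => hasFDerivAt_comp_chart_symm hy (hu i hi)
  rw [dAt_of_hasFDerivAt (f := fun y => ∑ i ∈ t, u i y) hy h, sum_apply]
  exact Finset.sum_congr rfl fun i hi => (dAt_eq_fderiv hy (hu i hi) v).symm

theorem dAt_sub {G : Type*} [NormedAddCommGroup G] [NormedSpace ℝ G] {u w : M → G} {y : M}
    (hu : MDifferentiableAt 𝓘(ℝ, ℂ) 𝓘(ℝ, G) u y)
    (hw : MDifferentiableAt 𝓘(ℝ, ℂ) 𝓘(ℝ, G) w y) (v : TangentSpace 𝓘(ℝ, ℂ) y) :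
    dAt (fun y => u y - w y) y v = dAt u y v - dAt w y v := by
  have hy := mem_chart_source ℂ y
  have h := (hasFDerivAt_comp_chart_symm hy hu).sub (hasFDerivAt_comp_chart_symm hy hw)
  rw [dAt_of_hasFDerivAt (f := fun y => u y - w y) hy h, dAt_eq_fderiv hy hu,
    dAt_eq_fderiv hy hw]
  simp

/-- The expressions in the derivatives of a spinor whose vanishing is the Cauchy-Riemann
equation. -/
def cauchyRiemann (s : (x : M) → Spinor σ x ⊗[ℝ] Grassmann L) (x : M) : Fin 2 → Grassmann L :=
  ![dAt (secCrd σ x s Complex.reLm) x (coordVec x x 1) -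
      dAt (secCrd σ x s Complex.imLm) x (coordVec x x Complex.I),
    dAt (secCrd σ x s Complex.imLm) x (coordVec x x 1) +
      dAt (secCrd σ x s Complex.reLm) x (coordVec x x Complex.I)]

/-- The contraction of `ψ`, `dφ` and the Cauchy-Riemann expressions of `s`. -/
def obstruction (a : OpenPartialHomeomorph Y (Euc n)) (ψ : (x : M) → Twisted n L σ φ x)
    (s : (x : M) → Spinor σ x ⊗[ℝ] Grassmann L) (x : M) : Grassmann L :=
  ∑ i, (spinorCrd σ a x ψ 1 i x *
      (dAt (fun y => a (φ y) i) x (coordVec x x 1) • cauchyRiemann σ s x 0 +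
        dAt (fun y => a (φ y) i) x (coordVec x x Complex.I) • cauchyRiemann σ s x 1) +
    spinorCrd σ a x ψ Complex.I i x *
      (dAt (fun y => a (φ y) i) x (coordVec x x 1) • cauchyRiemann σ s x 1 -
        dAt (fun y => a (φ y) i) x (coordVec x x Complex.I) • cauchyRiemann σ s x 0))

include hφ in
-- The formulas for δφ, δψ and the current in coordinates are expanded with the product rule; for
-- each target coordinate separately what remains is `variation_eq_divergence`.
theorem variationDensity_eq (hai : IsIsometricChart g₂ a)
    {ψ : (x : M) → Twisted n L σ φ x} (hψ : IsSmoothTwisted σ φ ψ)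
    (hψ_odd : ∀ x c, HasParity 1 (ψ x c)) {s : (x : M) → Spinor σ x ⊗[ℝ] Grassmann L}
    (hs : IsSmoothSpinor σ s) (hs_odd : ∀ x, HasParity 1 (s x)) {x : M} (hx : φ x ∈ a.source) :
    variationDensity σ a x 0 ψ (susyMap σ φ ψ s) (susySpinor g₁ σ φ s) x =
      dAt (currentDensity σ g₂ x ψ s 0) x (coordVec x x 1) +
        dAt (currentDensity σ g₂ x ψ s 1) x (coordVec x x Complex.I) +
      (2 : ℝ) • obstruction σ a ψ s x := by
  have hp := σ.mem_dom x
  have hxs := mem_chart_source ℂ x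
  have hev : ∀ᶠ y in 𝓝 x, y ∈ σ.dom x ∧ φ y ∈ a.source := by
    filter_upwards [σ.dom_mem_nhds hp, hφ.continuous.continuousAt (a.open_source.mem_nhds hx)]
      with y h1 h2 using ⟨h1, h2⟩
  set S₁ := secCrd σ x s Complex.reLm with hS₁
  set S₂ := secCrd σ x s Complex.imLm with hS₂
  have mS₁ : MDifferentiableAt 𝓘(ℝ, ℂ) 𝓘(ℝ, Grassmann L) S₁ x :=
    (contMDiffAt_secCrd σ hs hp _).mdifferentiableAt (n := ∞) (by simp)
  have mS₂ : MDifferentiableAt 𝓘(ℝ, ℂ) 𝓘(ℝ, Grassmann L) S₂ x :=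
    (contMDiffAt_secCrd σ hs hp _).mdifferentiableAt (n := ∞) (by simp)
  set D : ℂ → Fin n → M → ℝ := fun v i y => dAt (fun y => a (φ y) i) y (coordVec x y v) with hD
  have mD : ∀ v i, MDifferentiableAt 𝓘(ℝ, ℂ) 𝓘(ℝ, ℝ) (D v i) x := fun v i =>
    (contMDiffAt_dAt hxs (contMDiffAt_chart_coord hai.1 hφ hx i) v).mdifferentiableAt
      (n := ∞) (by simp)
  set F : ℂ → Fin n → M → Grassmann L := fun c i => spinorCrd σ a x ψ c i with hF
  have mF : ∀ c i, MDifferentiableAt 𝓘(ℝ, ℂ) 𝓘(ℝ, Grassmann L) (F c i) x := fun c i =>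
    (contMDiffAt_spinorCrd σ hai.1 hφ hψ hp hx c i).mdifferentiableAt (n := ∞) (by simp)
  -- The algebraic identity has a single symbol D₁₂ for the mixed second derivatives of φ.
  have hcomm : ∀ i, dAt (D Complex.I i) x (coordVec x x 1) =
      dAt (D 1 i) x (coordVec x x Complex.I) := fun i =>
    dAt_dAt_comm hxs (contMDiffAt_chart_coord hai.1 hφ hx i) _ _
  have mDF : ∀ v c i, MDifferentiableAt 𝓘(ℝ, ℂ) 𝓘(ℝ, Grassmann L)
      (fun y => D v i y • F c i y) x := fun v c i => (mD v i).smul (mF c i)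
  have mDS₁ : ∀ v i, MDifferentiableAt 𝓘(ℝ, ℂ) 𝓘(ℝ, Grassmann L)
      (fun y => D v i y • S₁ y) x := fun v i => (mD v i).smul mS₁
  have mDS₂ : ∀ v i, MDifferentiableAt 𝓘(ℝ, ℂ) 𝓘(ℝ, Grassmann L)
      (fun y => D v i y • S₂ y) x := fun v i => (mD v i).smul mS₂
  have mMul : ∀ {u v : M → Grassmann L}, MDifferentiableAt 𝓘(ℝ, ℂ) 𝓘(ℝ, Grassmann L) u x →
      MDifferentiableAt 𝓘(ℝ, ℂ) 𝓘(ℝ, Grassmann L) v x →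
      MDifferentiableAt 𝓘(ℝ, ℂ) 𝓘(ℝ, Grassmann L) (fun y => u y * v y) x := fun hu hv =>
    ((grassmannMul L).mdifferentiableAt.comp x hu).clm_apply hv
  have mAdd : ∀ {u v : M → Grassmann L}, MDifferentiableAt 𝓘(ℝ, ℂ) 𝓘(ℝ, Grassmann L) u x →
      MDifferentiableAt 𝓘(ℝ, ℂ) 𝓘(ℝ, Grassmann L) v x →
      MDifferentiableAt 𝓘(ℝ, ℂ) 𝓘(ℝ, Grassmann L) (fun y => u y + v y) x := fun hu hv => hu.add hv
  have mSub : ∀ {u v : M → Grassmann L}, MDifferentiableAt 𝓘(ℝ, ℂ) 𝓘(ℝ, Grassmann L) u x →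
      MDifferentiableAt 𝓘(ℝ, ℂ) 𝓘(ℝ, Grassmann L) v x →
      MDifferentiableAt 𝓘(ℝ, ℂ) 𝓘(ℝ, Grassmann L) (fun y => u y - v y) x := fun hu hv => hu.sub hv
  -- the current
  have hJ₀ : currentDensity σ g₂ x ψ s 0 =ᶠ[𝓝 x] fun y => ∑ i,
      ((D 1 i y • F 1 i y + D Complex.I i y • F Complex.I i y) * S₁ y +
        (D 1 i y • F Complex.I i y - D Complex.I i y • F 1 i y) * S₂ y) := by
    filter_upwards [hev] with y hy
    simp only [currentDensity, Matrix.cons_val_zero, pairing_eq σ hφ hai hy.2,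
      Finset.sum_add_distrib, Finset.sum_sub_distrib, ← Finset.sum_mul]
    rfl
  have hJ₁ : currentDensity σ g₂ x ψ s 1 =ᶠ[𝓝 x] fun y => ∑ i,
      ((D 1 i y • F 1 i y + D Complex.I i y • F Complex.I i y) * S₂ y +
        (D Complex.I i y • F 1 i y - D 1 i y • F Complex.I i y) * S₁ y) := by
    filter_upwards [hev] with y hy
    simp only [currentDensity, Matrix.cons_val_one, Matrix.cons_val_zero, pairing_eq σ hφ hai hy.2,
      Finset.sum_add_distrib, Finset.sum_sub_distrib, ← Finset.sum_mul]
    rfl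
  -- the variation of the map
  have hw : ∀ i v, dAt (fun y => crd a (φ y) i (susyMap σ φ ψ s y)) x v =
      F 1 i x * dAt S₁ x v + dAt (F 1 i) x v * S₁ x +
        (F Complex.I i x * dAt S₂ x v + dAt (F Complex.I i) x v * S₂ x) := by
    intro i v
    have he : (fun y => crd a (φ y) i (susyMap σ φ ψ s y)) =ᶠ[𝓝 x]
        fun y => F 1 i y * S₁ y + F Complex.I i y * S₂ y := by
      filter_upwards [hev] with y hy
      exact crd_susyMap σ hy.1 ψ s i
    rw [dAt_congr he, dAt_add (mMul (mF _ _) mS₁) (mMul (mF _ _) mS₂), dAt_mul (mF _ _) mS₁,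
      dAt_mul (mF _ _) mS₂]
  have hm : ∀ i v, dAt (mapCrd a (0 : FieldAlong n L φ) i) x (coordVec x x v) =
      D v i x • (1 : Grassmann L) := by
    intro i v
    have he : mapCrd a (0 : FieldAlong n L φ) i = fun y => a (φ y) i • (1 : Grassmann L) := by
      funext y
      simp [mapCrd]
    rw [he]
    exact dAt_clm ((ContinuousLinearMap.id ℝ ℝ).smulRight (1 : Grassmann L))
      ((contMDiffAt_chart_coord hai.1 hφ hx i).mdifferentiableAt (n := ∞) (by simp)) _
  -- the variation of the spinor
  have hχ₁ : ∀ i, spinorCrd σ a x (susySpinor g₁ σ φ s) 1 i =ᶠ[𝓝 x]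
      fun y => D 1 i y • S₂ y - D Complex.I i y • S₁ y := by
    intro i
    filter_upwards [hev] with y hy
    rw [spinorCrd_susySpinor σ g₁ hai.1 hφ hy.1 hy.2,
      secCrd_linear σ x s (Complex.imLm ∘ₗ LinearMap.mulLeft ℝ 1),
      secCrd_linear σ x s (Complex.reLm ∘ₗ LinearMap.mulLeft ℝ 1)]
    simp [hD, hS₁, hS₂]
  have hχ₂ : ∀ i, spinorCrd σ a x (susySpinor g₁ σ φ s) Complex.I i =ᶠ[𝓝 x]
      fun y => D 1 i y • S₁ y + D Complex.I i y • S₂ y := by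
    intro i
    filter_upwards [hev] with y hy
    rw [spinorCrd_susySpinor σ g₁ hai.1 hφ hy.1 hy.2,
      secCrd_linear σ x s (Complex.imLm ∘ₗ LinearMap.mulLeft ℝ Complex.I),
      secCrd_linear σ x s (Complex.reLm ∘ₗ LinearMap.mulLeft ℝ Complex.I)]
    simp [hD, hS₁, hS₂]
  have hd0 : direction 0 = 1 := rfl
  have hd1 : direction 1 = Complex.I := rfl
  have mA : ∀ i, MDifferentiableAt 𝓘(ℝ, ℂ) 𝓘(ℝ, Grassmann L)
      (fun y => D 1 i y • F 1 i y + D Complex.I i y • F Complex.I i y) x :=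
    fun i => mAdd (mDF _ _ _) (mDF _ _ _)
  have mB : ∀ i, MDifferentiableAt 𝓘(ℝ, ℂ) 𝓘(ℝ, Grassmann L)
      (fun y => D 1 i y • F Complex.I i y - D Complex.I i y • F 1 i y) x :=
    fun i => mSub (mDF _ _ _) (mDF _ _ _)
  have mB' : ∀ i, MDifferentiableAt 𝓘(ℝ, ℂ) 𝓘(ℝ, Grassmann L)
      (fun y => D Complex.I i y • F 1 i y - D 1 i y • F Complex.I i y) x :=
    fun i => mSub (mDF _ _ _) (mDF _ _ _)
  rw [dAt_congr hJ₀, dAt_congr hJ₁,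
    dAt_sum fun i _ => mAdd (mMul (mA i) mS₁) (mMul (mB i) mS₂),
    dAt_sum fun i _ => mAdd (mMul (mA i) mS₂) (mMul (mB' i) mS₁),
    obstruction, Finset.smul_sum, ← Finset.sum_add_distrib, ← Finset.sum_add_distrib,
    variationDensity]
  refine Finset.sum_congr rfl fun i _ => ?_
  -- Derivatives of odd components are odd, as required to exchange them with s and t.
  have hdF : ∀ c v, dAt (F c i) x v ∈ parityPart L 1 := fun c v =>
    dAt_mem_of_forall_mem (mF c i) (spinorCrd_odd σ hψ_odd c i) v
  rw [dAt_congr (hχ₁ i), dAt_congr (hχ₂ i), (hχ₁ i).eq_of_nhds, (hχ₂ i).eq_of_nhds]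
  simp only [Fin.sum_univ_two, hd0, hd1, hm, hw]
  rw [dAt_add (mMul (mA i) mS₁) (mMul (mB i) mS₂), dAt_add (mMul (mA i) mS₂) (mMul (mB' i) mS₁),
    dAt_mul (mA i) mS₁, dAt_mul (mB i) mS₂, dAt_mul (mA i) mS₂, dAt_mul (mB' i) mS₁]
  simp only [dAt_add (mDF _ _ _) (mDF _ _ _), dAt_sub (mDF _ _ _) (mDF _ _ _),
    dAt_sub (mDS₂ _ _) (mDS₁ _ _), dAt_add (mDS₁ _ _) (mDS₂ _ _), dAt_smul (mD _ _) (mF _ _),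
    dAt_smul (mD _ _) mS₁, dAt_smul (mD _ _) mS₂, hcomm]
  exact variation_eq_divergence (hdF _ _) (hdF _ _) (hdF _ _) (hdF _ _)
    (secCrd_odd σ hs_odd x _ x) (secCrd_odd σ hs_odd x _ x) _ _ _ _ _

end Current

end SusyDirac

namespace SusyDirac

open Filter Topology

/-! ### The spin-3/2 part of ∇s as the Cauchy-Riemann operator. -/

section SpinThreeHalf

variable {L : ℕ} {M : Type*} [TopologicalSpace M] [ChartedSpace ℂ M] [IsManifold 𝓘(ℂ) ω M]
  (σ : SpinStructure M) (g₁ : SurfaceMetric M)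

theorem tensor_ext_contract {a b : ℂ ⊗[ℝ] Grassmann L}
    (hre : contract Complex.reLm a = contract Complex.reLm b)
    (him : contract Complex.imLm a = contract Complex.imLm b) : a = b := by
  refine tensor_ext_component fun I => Complex.ext ?_ ?_
  · have := congrArg ((grassmannBasis L).coord I) hre
    rwa [apply_contract, apply_contract] at this
  · have := congrArg ((grassmannBasis L).coord I) him
    rwa [apply_contract, apply_contract] at this

theorem mdifferentiableAt_component {s : (x : M) → Spinor σ x ⊗[ℝ] Grassmann L}
    (hs : IsSmoothSpinor σ s) (ℓ : Grassmann L →ₗ[ℝ] ℝ) {p y : M} (hp : y ∈ σ.dom p) :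
    MDifferentiableAt 𝓘(ℝ, ℂ) 𝓘(ℝ, ℂ) (fun y => σ.root y p y * component ℓ (s y)) y :=
  ((hs ℓ p).contMDiffAt (σ.dom_mem_nhds hp)).mdifferentiableAt (n := ∞) (by simp)

theorem contract_gradedCovSpinor {s : (x : M) → Spinor σ x ⊗[ℝ] Grassmann L}
    (hs : IsSmoothSpinor σ s) (A : OneForm M) (f : ℂ →ₗ[ℝ] ℝ) (x : M)
    (v : TangentSpace 𝓘(ℝ, ℂ) x) :
    contract f (gradedCovSpinor σ g₁ A s x v) = dAt (secCrd σ x s f) x v +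
      contract (f ∘ₗ LinearMap.mulLeft ℝ (connectionForm g₁ A x v)) (s x) := by
  have hx := σ.mem_dom x
  have hS := (contMDiffAt_secCrd σ hs hx f).mdifferentiableAt (n := ∞) (by simp)
  refine (grassmannBasis L).ext_elem fun I => ?_
  have key : ∀ ℓ : Grassmann L →ₗ[ℝ] ℝ, ℓ (dAt (secCrd σ x s f) x v) =
      f (dAt (fun y => σ.root y x y * component ℓ (s y)) x v) := by
    intro ℓ
    have h1 := dAt_clm (LinearMap.toContinuousLinearMap ℓ) hS v
    have h2 := dAt_clm (LinearMap.toContinuousLinearMap f)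
      (mdifferentiableAt_component σ hs ℓ hx) v
    simp only [LinearMap.coe_toContinuousLinearMap'] at h1 h2
    rw [← h1, ← h2]
    simp only [coord_secCrd]
  change (grassmannBasis L).coord I _ = (grassmannBasis L).coord I _
  rw [map_add, key, apply_contract, apply_contract, LinearMap.comp_apply,
    LinearMap.mulLeft_apply, ← map_add]
  congr 1
  simp only [gradedCovSpinor, map_sum]
  rw [Finset.sum_eq_single I]
  · simp [component, covSpinor]
  · intro J _ hJ
    simp [component, Finsupp.single_eq_of_ne hJ.symm]
  · simp

/-- Without A the connection form is a multiple of dz, that is, of type (1,0). This is what lets it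
cancel in `contract_qCov`, where only the (0,1) part of ∇s matters. -/
theorem connectionForm_zero (x : M) : ∃ K : ℂ, ∀ v : TangentSpace 𝓘(ℝ, ℂ) x,
    connectionForm g₁ 0 x v = K * vecCoord x x v :=
  ⟨_, fun v => by
    simp only [connectionForm, Pi.zero_apply, zero_apply, Complex.ofReal_zero, mul_zero, zero_mul,
      sub_zero]
    rfl⟩

/-- The spin-3/2 part of `∇s` consists of the Cauchy-Riemann expressions of `s`. -/
theorem contract_qCov {s : (x : M) → Spinor σ x ⊗[ℝ] Grassmann L}
    (hs : IsSmoothSpinor σ s) (f : ℂ →ₗ[ℝ] ℝ) (x : M) (i : Fin 2) :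
    contract f (qCov σ g₁ s x i) = ((1 / 2 : ℝ) * (Real.sqrt (conformalFactor g₁ x x))⁻¹) •
      (f ((starRingEnd ℂ) (direction i)) • cauchyRiemann σ s x 0 +
        f ((starRingEnd ℂ) (direction i) * Complex.I) • cauchyRiemann σ s x 1) := by
  obtain ⟨K, hK⟩ := connectionForm_zero g₁ x
  have hx := σ.mem_dom x
  set g : ℂ →ₗ[ℝ] ℝ := f ∘ₗ LinearMap.mulLeft ℝ ((starRingEnd ℂ) (direction i)) with hg
  -- The two conjugations cancel: γᵏγⁱ is complex multiplication by eₖ times the conjugate of eᵢ,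
  -- where e₁ = 1 and e₂ = i.
  have hcl : ∀ k (τ : Spinor σ x ⊗[ℝ] Grassmann L),
      contract f (gradedClifford σ g₁ x (orthoFrame g₁ x k)
        (gradedClifford σ g₁ x (orthoFrame g₁ x i) τ)) =
      contract (g ∘ₗ LinearMap.mulLeft ℝ (direction k)) τ := by
    intro k τ
    rw [gradedClifford, gradedClifford, contract_comp, contract_comp]
    refine congrArg (fun h => contract h τ) (LinearMap.ext fun c => ?_)
    rw [LinearMap.comp_apply, LinearMap.comp_apply, clifford_orthoFrame, clifford_orthoFrame]
    change f (direction k * (starRingEnd ℂ) (direction i * (starRingEnd ℂ) c)) =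
      f ((starRingEnd ℂ) (direction i) * (direction k * c))
    rw [map_mul (starRingEnd ℂ), Complex.conj_conj, mul_left_comm]
  have hS : ∀ h : ℂ →ₗ[ℝ] ℝ, ∀ v, dAt (secCrd σ x s h) x v =
      h 1 • dAt (secCrd σ x s Complex.reLm) x v +
        h Complex.I • dAt (secCrd σ x s Complex.imLm) x v := by
    intro h v
    have e : secCrd σ x s h = fun y =>
        h 1 • secCrd σ x s Complex.reLm y + h Complex.I • secCrd σ x s Complex.imLm y :=
      funext fun y => secCrd_linear σ x s h y
    have m : ∀ h, MDifferentiableAt 𝓘(ℝ, ℂ) 𝓘(ℝ, Grassmann L) (secCrd σ x s h) x := fun h =>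
      (contMDiffAt_secCrd σ hs hx h).mdifferentiableAt (n := ∞) (by simp)
    have c : ∀ (r : ℝ) h, dAt (fun y => r • secCrd σ x s h y) x v =
        r • dAt (secCrd σ x s h) x v := fun r h =>
      dAt_clm (r • ContinuousLinearMap.id ℝ (Grassmann L)) (m h) v
    have mc : ∀ (r : ℝ) h, MDifferentiableAt 𝓘(ℝ, ℂ) 𝓘(ℝ, Grassmann L)
        (fun y => r • secCrd σ x s h y) x := fun r h => (m h).const_smul r
    rw [e, dAt_add (mc _ _) (mc _ _), c, c]
  rw [qCov, spinThreeHalf, map_smul, map_sum]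
  simp only [Fin.sum_univ_two, hcl, contract_gradedCovSpinor σ g₁ hs, hK]
  simp only [orthoFrame_eq, map_smul, vecCoord_coordVec (mem_chart_source ℂ x)]
  -- The connection contributes K times the sum of the squares of the directions, and 1² + i² = 0.
  have hcancel : ∀ r : ℝ, contract ((g ∘ₗ LinearMap.mulLeft ℝ (direction 0)) ∘ₗ
        LinearMap.mulLeft ℝ (K * r • direction 0)) (s x) +
      contract ((g ∘ₗ LinearMap.mulLeft ℝ (direction 1)) ∘ₗ
        LinearMap.mulLeft ℝ (K * r • direction 1)) (s x) = 0 := by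
    intro r
    rw [← contract_add]
    have : (g ∘ₗ LinearMap.mulLeft ℝ (direction 0)) ∘ₗ
          LinearMap.mulLeft ℝ (K * r • direction 0) +
        (g ∘ₗ LinearMap.mulLeft ℝ (direction 1)) ∘ₗ
          LinearMap.mulLeft ℝ (K * r • direction 1) = 0 := by
      refine LinearMap.ext fun c => ?_
      simp only [LinearMap.add_apply, LinearMap.comp_apply, LinearMap.mulLeft_apply,
        ← map_add, LinearMap.zero_apply]
      have h0 : direction 0 = 1 := rfl
      have h1 : direction 1 = Complex.I := rfl
      rw [h0, h1, Complex.real_smul, Complex.real_smul]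
      have e : (1 : ℂ) * (K * (r * 1) * c) + Complex.I * (K * (r * Complex.I) * c) =
          (Complex.I * Complex.I + 1) * (K * r * c) := by ring
      rw [e, Complex.I_mul_I]
      simp
    rw [this]
    simp [contract]
  have h0 : direction 0 = 1 := rfl
  have h1 : direction 1 = Complex.I := rfl
  have hgI : g (Complex.I * Complex.I) = - g 1 := by rw [Complex.I_mul_I, map_neg]
  have hlin : ∀ a b u w : Grassmann L, u + w = 0 → a + u + (b + w) = a + b := fun a b u w h => by
    rw [add_add_add_comm, h, add_zero]
  rw [hlin _ _ _ _ (hcancel _), hS (g ∘ₗ _), hS (g ∘ₗ _)]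
  simp only [LinearMap.comp_apply, LinearMap.mulLeft_apply, h0, h1, one_mul, mul_one, hgI]
  have hg1 : f ((starRingEnd ℂ) (direction i)) = g 1 := by simp [hg]
  have hg2 : f ((starRingEnd ℂ) (direction i) * Complex.I) = g Complex.I := by simp [hg]
  rw [hg1, hg2, cauchyRiemann]
  simp only [Matrix.cons_val_zero, Matrix.cons_val_one]
  module

theorem forall_qCov_eq_zero_iff {s : (x : M) → Spinor σ x ⊗[ℝ] Grassmann L}
    (hs : IsSmoothSpinor σ s) (x : M) :
    (∀ i, qCov σ g₁ s x i = 0) ↔ ∀ i, cauchyRiemann σ s x i = 0 := by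
  have hr : ((1 / 2 : ℝ) * (Real.sqrt (conformalFactor g₁ x x))⁻¹) ≠ 0 :=
    mul_ne_zero (by norm_num) (inv_ne_zero (sqrt_conformalFactor_pos g₁ x).ne')
  have h0 : direction 0 = 1 := rfl
  constructor
  · intro h
    -- The component i = 0 suffices: its real and imaginary parts are nonzero multiples of the two
    -- Cauchy-Riemann expressions.
    have h1 := contract_qCov σ g₁ hs Complex.reLm x 0
    have h2 := contract_qCov σ g₁ hs Complex.imLm x 0
    simp only [h 0, map_zero, h0, map_one, one_mul, Complex.reLm_coe, Complex.imLm_coe,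
      Complex.one_re, Complex.I_re, Complex.one_im, Complex.I_im, one_smul, zero_smul, add_zero,
      zero_add] at h1 h2
    refine Fin.forall_fin_two.2 ⟨?_, ?_⟩
    · exact (smul_eq_zero.1 h1.symm).resolve_left hr
    · exact (smul_eq_zero.1 h2.symm).resolve_left hr
  · intro h i
    refine tensor_ext_contract ?_ ?_ <;>
    · rw [contract_qCov σ g₁ hs, h, h]
      simp

end SpinThreeHalf

/-! ### Holomorphic sections and the Cauchy-Riemann equations. -/

section Holomorphic

variable {L : ℕ} {M : Type*} [TopologicalSpace M] [ChartedSpace ℂ M] [IsManifold 𝓘(ℂ) ω M]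
  (σ : SpinStructure M)

/-- The Cauchy-Riemann equations in a chart. -/
theorem mdifferentiableAt_complex_iff {h : M → ℂ} {x : M}
    (hh : MDifferentiableAt 𝓘(ℝ, ℂ) 𝓘(ℝ, ℂ) h x) :
    MDifferentiableAt 𝓘(ℂ) 𝓘(ℂ) h x ↔
      dAt h x (coordVec x x Complex.I) = Complex.I * dAt h x (coordVec x x 1) := by
  have hx : x ∈ (chartAt ℂ x).source := mem_chart_source ℂ x
  rw [dAt_coordVec hx hh, dAt_coordVec hx hh]
  have hd := (hasFDerivAt_comp_chart_symm hx hh).differentiableAt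
  have hc : MDifferentiableAt 𝓘(ℂ) 𝓘(ℂ) h x ↔
      DifferentiableAt ℂ (h ∘ (chartAt ℂ x).symm) (chartAt ℂ x x) := by
    rw [mdifferentiableAt_iff]
    simp only [mfld_simps, differentiableWithinAt_univ]
    constructor
    · exact fun h => h.2
    · exact fun h => ⟨hh.continuousAt, h⟩
  rw [hc, differentiableAt_complex_iff_differentiableAt_real]
  simp only [hd, true_and, smul_eq_mul]

theorem dAt_holomorphic_iff {s : (x : M) → Spinor σ x ⊗[ℝ] Grassmann L}
    (hs : IsSmoothSpinor σ s) (ℓ : Grassmann L →ₗ[ℝ] ℝ) (x : M) :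
    MDifferentiableAt 𝓘(ℂ) 𝓘(ℂ) (fun y => σ.root y x y * component ℓ (s y)) x ↔
      ∀ i, ℓ (cauchyRiemann σ s x i) = 0 := by
  have hx := σ.mem_dom x
  have hm := mdifferentiableAt_component σ hs ℓ hx
  rw [mdifferentiableAt_complex_iff hm]
  have key : ∀ (f : ℂ →ₗ[ℝ] ℝ) v, ℓ (dAt (secCrd σ x s f) x v) =
      f (dAt (fun y => σ.root y x y * component ℓ (s y)) x v) := by
    intro f v
    have hS := (contMDiffAt_secCrd σ hs hx f).mdifferentiableAt (n := ∞) (by simp)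
    have h1 := dAt_clm (LinearMap.toContinuousLinearMap ℓ) hS v
    have h2 := dAt_clm (LinearMap.toContinuousLinearMap f) hm v
    simp only [LinearMap.coe_toContinuousLinearMap'] at h1 h2
    rw [← h1, ← h2]
    simp only [coord_secCrd]
  rw [Fin.forall_fin_two, cauchyRiemann]
  simp only [Matrix.cons_val_zero, Matrix.cons_val_one, map_sub, map_add, key, Complex.reLm_coe,
    Complex.imLm_coe, Complex.ext_iff, Complex.mul_re, Complex.mul_im, Complex.I_re, Complex.I_im,
    zero_mul, one_mul, zero_sub, zero_add]
  constructor <;> rintro ⟨h1, h2⟩ <;> constructor <;> linarith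

theorem isHolomorphicSpinor_iff {s : (x : M) → Spinor σ x ⊗[ℝ] Grassmann L}
    (hs : IsSmoothSpinor σ s) :
    IsHolomorphicSpinor σ s ↔ ∀ x i, cauchyRiemann σ s x i = 0 := by
  constructor
  · intro h x i
    refine (grassmannBasis L).ext_elem fun I => ?_
    rw [map_zero]
    exact (dAt_holomorphic_iff σ hs _ x).1 ((h ((grassmannBasis L).coord I) x).mdifferentiableAt
      (σ.dom_mem_nhds (σ.mem_dom x))) i
  · intro h ℓ p x hx
    have hxx := σ.mem_dom x
    have h1 : MDifferentiableAt 𝓘(ℂ) 𝓘(ℂ) (fun y => σ.root y x y * component ℓ (s y)) x :=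
      (dAt_holomorphic_iff σ hs ℓ x).2 fun i => by rw [h x i, map_zero]
    -- The equations at x are known in the frame w_x; the holomorphic transition function carries
    -- differentiability over to the frame w_p.
    have h2 := (mdifferentiableAt_root σ hxx hx).mul h1
    refine (h2.congr_of_eventuallyEq ?_).mdifferentiableWithinAt
    filter_upwards [σ.dom_mem_nhds hxx, σ.dom_mem_nhds hx] with y h1 h2
    simp only [Pi.mul_apply]
    rw [← σ.root_mul y x p y ⟨⟨σ.mem_dom y, h1⟩, h2⟩]
    ring

theorem forall_qCov_eq_zero_iff_isHolomorphicSpinor (g₁ : SurfaceMetric M)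
    {s : (x : M) → Spinor σ x ⊗[ℝ] Grassmann L} (hs : IsSmoothSpinor σ s) :
    (∀ x i, qCov σ g₁ s x i = 0) ↔ IsHolomorphicSpinor σ s := by
  rw [isHolomorphicSpinor_iff σ hs]
  exact forall_congr' fun x => forall_qCov_eq_zero_iff σ g₁ hs x

end Holomorphic

/-! ### The first variation of the Lagrangian. -/

section Variation

variable {n L : ℕ} {Y : Type*} [TopologicalSpace Y] [ChartedSpace (Euc n) Y]
  [IsManifold 𝓘(ℝ, Euc n) ∞ Y] {a : OpenPartialHomeomorph Y (Euc n)}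
  {M : Type*} [TopologicalSpace M] [ChartedSpace ℂ M] [IsManifold 𝓘(ℂ) ω M]
  (σ : SpinStructure M) {φ : M → Y} {g₂ : TargetMetric n Y} {g₁ : SurfaceMetric M}

/-- The ½ is the one in 𝔮. The factor 1/√ρ in 𝔮(∇s) cancels the √ρ of the symplectic dual, and ρ⁻¹
comes from `twistedForm` and from the frame vector in dφ. -/
theorem qTerm_eq (hai : IsIsometricChart g₂ a) (hφ : ContMDiff 𝓘(ℝ, ℂ) 𝓘(ℝ, Euc n) ∞ φ)
    (ψ : (x : M) → Twisted n L σ φ x)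
    {s : (x : M) → Spinor σ x ⊗[ℝ] Grassmann L} (hs : IsSmoothSpinor σ s) {x : M}
    (hx : φ x ∈ a.source) :
    qTerm g₁ σ g₂ φ ψ s x =
      ((1 / 2 : ℝ) * (conformalFactor g₁ x x)⁻¹) • obstruction σ a ψ s x := by
  have hρ := sqrt_conformalFactor_pos g₁ x
  set r := Real.sqrt (conformalFactor g₁ x x) with hr
  have hrr : (conformalFactor g₁ x x)⁻¹ = r⁻¹ * r⁻¹ := by
    rw [← mul_inv, hr, Real.mul_self_sqrt]
    exact (conformalFactor_pos g₁ (mem_chart_source ℂ x)).le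
  have hflip : ∀ c : ℂ, ∀ w : ℂ, (spinorForm σ g₁ x).flip c w =
      r * ((starRingEnd ℂ) w * c).im := fun _ _ => rfl
  have hr1 : r⁻¹ * r = 1 := inv_mul_cancel₀ hρ.ne'
  have hcI : ∀ i, contract ((spinorForm σ g₁ x).flip Complex.I) (qCov σ g₁ s x i) =
      (1 / 2 : ℝ) • cauchyRiemann σ s x i := by
    refine Fin.forall_fin_two.2 ⟨?_, ?_⟩
    · rw [contract_qCov σ g₁ hs, hflip, hflip, ← hr]
      simp [direction, smul_smul, hr1, mul_assoc]
    · rw [contract_qCov σ g₁ hs, hflip, hflip, ← hr]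
      simp [direction, smul_smul, hr1, mul_assoc]
  have hc10 : contract ((spinorForm σ g₁ x).flip (1 : ℂ)) (qCov σ g₁ s x 0) =
      -((1 / 2 : ℝ) • cauchyRiemann σ s x 1) := by
    rw [contract_qCov σ g₁ hs, hflip, hflip, ← hr]
    simp [direction, smul_smul, hr1, mul_assoc]
  have hc11 : contract ((spinorForm σ g₁ x).flip (1 : ℂ)) (qCov σ g₁ s x 1) =
      (1 / 2 : ℝ) • cauchyRiemann σ s x 0 := by
    rw [contract_qCov σ g₁ hs, hflip, hflip, ← hr]
    simp [direction, smul_smul, hr1, mul_assoc]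
  have h0 : direction 0 = 1 := rfl
  have h1 : direction 1 = Complex.I := rfl
  have hD : ∀ i k, (chartDeriv a (φ x) (mfderiv 𝓘(ℝ, ℂ) 𝓘(ℝ, Euc n) φ x (orthoFrame g₁ x k))) i =
      r⁻¹ * dAt (fun y => a (φ y) i) x (coordVec x x (direction k)) := by
    intro i k
    rw [chartDeriv_mfderiv hai.1 hφ hx, orthoFrame_eq, map_smul, smul_eq_mul]
  simp only [qTerm, twistedForm, hai.targetForm_eq hx, crd_dualTensor, hD, Fin.sum_univ_two, hcI,
    hc10, hc11, h0, h1, obstruction, spinorCrd_self, hrr, ← hr, ← Finset.sum_sub_distrib,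
    ← Finset.sum_add_distrib, Finset.smul_sum]
  refine Finset.sum_congr rfl fun i _ => ?_
  simp only [mul_add, mul_sub, mul_smul_comm, mul_neg, smul_neg]
  module

theorem hasDerivAt_lagrangian (hφ : ContMDiff 𝓘(ℝ, ℂ) 𝓘(ℝ, Euc n) ∞ φ) (hg₂ : IsFlat g₂)
    (hg₁ : IsConformal g₁) (A : OneForm M)
    {ψ : (x : M) → Twisted n L σ φ x} (hψ : IsSmoothTwisted σ φ ψ)
    (hψ_odd : ∀ x c, HasParity 1 (ψ x c)) {s : (x : M) → Spinor σ x ⊗[ℝ] Grassmann L}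
    (hs : IsSmoothSpinor σ s) (hs_odd : ∀ x, HasParity 1 (s x))
    {Ξ : ℝ → FieldAlong n L φ} {Ψ : ℝ → (x : M) → Twisted n L σ φ x}
    (h : IsSusyVariation g₁ σ φ ψ s Ξ Ψ) (x : M) :
    HasDerivAt (fun t => lagrangian g₁ σ hg₂ A φ (Ξ t) (Ψ t) x)
      (gradedDivergence g₁ (current σ g₂ g₁ ψ s) x + (4 : ℝ) • qTerm g₁ σ g₂ φ ψ s x) 0 := by
  obtain ⟨hx, hai⟩ := flatChart_spec hg₂ (φ x)
  set a := flatChart hg₂ (φ x)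
  have h1 := hasDerivAt_localDensity σ hai.1 hφ h.smooth_map h.smooth_spinor h.deriv_map
    h.deriv_spinor (σ.mem_dom x) hx
  have h2 := h1.const_smul (conformalFactor g₁ x x)⁻¹
  rw [h.map_zero, h.spinor_zero,
    variationDensity_eq σ hφ g₁ hai hψ hψ_odd hs hs_odd hx, smul_add] at h2
  rw [gradedDivergence_current σ hφ hg₂ hg₁ hψ hs x, qTerm_eq σ hai hφ ψ hs hx]
  have he : (fun t => lagrangian g₁ σ hg₂ A φ (Ξ t) (Ψ t) x) = fun t =>
      (conformalFactor g₁ x x)⁻¹ • localDensity σ a x (Ξ t) (Ψ t) x := funext fun t =>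
    lagrangian_eq σ hφ hg₂ g₁ A hg₁ hai (isSmoothTwisted_slice σ h.smooth_spinor t)
      (h.odd_spinor t) (σ.mem_dom x) (smoothAlongAt_slice h.smooth_map t x) hx
  -- The constant 4 is the 2 of `variationDensity_eq` divided by the ½ of `qTerm_eq`.
  have hc : (4 : ℝ) • ((1 / 2 : ℝ) * (conformalFactor g₁ x x)⁻¹) • obstruction σ a ψ s x =
      (conformalFactor g₁ x x)⁻¹ • (2 : ℝ) • obstruction σ a ψ s x := by
    module
  rw [he, hc]
  exact h2

end Variation

end SusyDirac

namespace SusyDirac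

open Filter Topology MeasureTheory

/-! ### Coordinate invariance of the divergence. -/

section Density

variable {M : Type*} [TopologicalSpace M] [ChartedSpace ℂ M] [IsManifold 𝓘(ℂ) ω M]
  {g : SurfaceMetric M}

/-- The density `ρ V` of a vector field `V`, in the chart at `p`. -/
def densityCrd (g : SurfaceMetric M) (V : (x : M) → TangentSpace 𝓘(ℝ, ℂ) x) (p y : M) : ℂ :=
  conformalFactor g p y • vecCoord p y (V y)

/-- The smooth vector fields on `M`. -/
def IsSmoothField (V : (x : M) → TangentSpace 𝓘(ℝ, ℂ) x) : Prop :=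
  ContMDiff 𝓘(ℝ, ℂ) 𝓘(ℝ, ℂ).tangent ∞ fun x => (⟨x, V x⟩ : TangentBundle 𝓘(ℝ, ℂ) M)

variable {V : (x : M) → TangentSpace 𝓘(ℝ, ℂ) x}

theorem IsSmoothField.contMDiffAt_vecCoord (hV : IsSmoothField V) {p y : M}
    (hy : y ∈ (chartAt ℂ p).source) :
    ContMDiffAt 𝓘(ℝ, ℂ) 𝓘(ℝ, ℂ) ∞ (fun y => vecCoord p y (V y)) y :=
  (contMDiffAt_tangentBundle_iff (f := fun y => y) (chartAt_mem_maximalAtlas_real p) hy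
    contMDiffAt_id).mp hV.contMDiffAt

theorem IsSmoothField.smul (hV : IsSmoothField V) {f : M → ℝ}
    (hf : ContMDiff 𝓘(ℝ, ℂ) 𝓘(ℝ, ℝ) ∞ f) : IsSmoothField fun x => f x • V x := by
  intro y
  have hy := mem_chart_source ℂ y
  refine (contMDiffAt_tangentBundle_iff (f := fun y => y) (chartAt_mem_maximalAtlas_real y) hy
    contMDiffAt_id).mpr ?_
  refine (hf.contMDiffAt.smul (hV.contMDiffAt_vecCoord hy)).congr_of_eventuallyEq ?_
  exact Eventually.of_forall fun z => map_smul (vecCoord y z) (f z) (V z)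

theorem IsSmoothField.contMDiffAt_densityCrd (hV : IsSmoothField V) {p y : M}
    (hy : y ∈ (chartAt ℂ p).source) :
    ContMDiffAt 𝓘(ℝ, ℂ) 𝓘(ℝ, ℂ) ∞ (densityCrd g V p) y :=
  (contMDiffAt_conformalFactor g hy).smul (hV.contMDiffAt_vecCoord hy)

/-- The sum of the partial derivatives of `ρ V` in the chart at `p`. -/
def densityDiv (g : SurfaceMetric M) (V : (x : M) → TangentSpace 𝓘(ℝ, ℂ) x) (p y : M) : ℝ :=
  (dAt (densityCrd g V p) y (coordVec p y 1)).re +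
    (dAt (densityCrd g V p) y (coordVec p y Complex.I)).im

theorem divergence_eq_own (hg : IsConformal g) (hV : IsSmoothField V) (y : M) :
    divergence g V y = (conformalFactor g y y)⁻¹ * densityDiv g V y y := by
  have hy := mem_chart_source ℂ y
  have hm : MDifferentiableAt 𝓘(ℝ, ℂ) 𝓘(ℝ, ℂ) (densityCrd g V y) y :=
    (hV.contMDiffAt_densityCrd hy).mdifferentiableAt (n := ∞) (by simp)
  have hr : (fun z => areaDensity g y z * (vecCoord y z (V z)).re) =ᶠ[𝓝 y]
      fun z => Complex.reCLM (densityCrd g V y z) := by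
    filter_upwards [(chartAt ℂ y).open_source.mem_nhds hy] with z hz
    rw [hg.areaDensity_eq hz, densityCrd, Complex.reCLM_apply, Complex.smul_re, smul_eq_mul]
  have hi : (fun z => areaDensity g y z * (vecCoord y z (V z)).im) =ᶠ[𝓝 y]
      fun z => Complex.imCLM (densityCrd g V y z) := by
    filter_upwards [(chartAt ℂ y).open_source.mem_nhds hy] with z hz
    rw [hg.areaDensity_eq hz, densityCrd, Complex.imCLM_apply, Complex.smul_im, smul_eq_mul]
  rw [divergence, hg.areaDensity_eq hy, dAt_congr hr, dAt_congr hi, dAt_clm _ hm, dAt_clm _ hm]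
  rfl

/-- Under a holomorphic change of the coordinate with derivative `τ`, the partial derivatives of
a density `conj τ F` and of `F` are related by the factor `|τ|²`. -/
theorem re_add_im_conj_mul (T : ℂ →ₗ[ℝ] ℂ) (τ d w : ℂ) :
    ((starRingEnd ℂ) τ * T (τ * 1) + (starRingEnd ℂ) (d * 1) * w).re +
      ((starRingEnd ℂ) τ * T (τ * Complex.I) + (starRingEnd ℂ) (d * Complex.I) * w).im =
    Complex.normSq τ * ((T 1).re + (T Complex.I).im) := by
  have hT : ∀ z : ℂ, T z = z.re • T 1 + z.im • T Complex.I := by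
    intro z
    rw [← map_smul, ← map_smul, ← map_add]
    congr 1
    simp [Complex.re_add_im]
  rw [hT (τ * 1), hT (τ * Complex.I), Complex.normSq_apply]
  simp
  ring

/-- `densityDiv` is 2 Re ∂_z of the complex density F = ρV. Under a change of coordinate with
derivative τ, ρ contributes |τ|² and V contributes τ⁻¹, so F is multiplied by the conjugate of τ.
That factor is antiholomorphic and passes through ∂_z, which itself contributes τ. The total |τ|² is
also the factor of ρ. -/
theorem densityDiv_change (hg : IsConformal g) (hV : IsSmoothField V) {p y : M}
    (hp : y ∈ (chartAt ℂ p).source) :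
    (conformalFactor g y y)⁻¹ * densityDiv g V y y =
      (conformalFactor g p y)⁻¹ * densityDiv g V p y := by
  have hy := mem_chart_source ℂ y
  set D : ℂ → ℂ := deriv (chartAt ℂ y ∘ (chartAt ℂ p).symm) with hD
  set τ : M → ℂ := fun z => D (chartAt ℂ p z) with hτ
  obtain ⟨d, hd⟩ := exists_hasDerivAt_deriv_chart_change hp hy
  have hcomp : (fun z => (starRingEnd ℂ) (τ z)) ∘ (chartAt ℂ p).symm =ᶠ[𝓝 (chartAt ℂ p y)]
      fun z => Complex.conjCLE (D z) := by
    filter_upwards [(chartAt ℂ p).open_target.mem_nhds ((chartAt ℂ p).map_source hp)] with z hz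
    simp [hτ, (chartAt ℂ p).right_inv hz]
  have hfd : HasFDerivAt ((fun z => (starRingEnd ℂ) (τ z)) ∘ (chartAt ℂ p).symm)
      ((Complex.conjCLE : ℂ →L[ℝ] ℂ).comp
        ((ContinuousLinearMap.toSpanSingleton ℂ d).restrictScalars ℝ)) (chartAt ℂ p y) :=
    ((Complex.conjCLE : ℂ →L[ℝ] ℂ).hasFDerivAt.comp (chartAt ℂ p y)
      (hd.hasFDerivAt.restrictScalars ℝ)).congr_of_eventuallyEq hcomp
  have hmτ := mdifferentiableAt_of_comp_chart_symm hp hfd.differentiableAt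
  have hmF : MDifferentiableAt 𝓘(ℝ, ℂ) 𝓘(ℝ, ℂ) (densityCrd g V y) y :=
    (hV.contMDiffAt_densityCrd hy).mdifferentiableAt (n := ∞) (by simp)
  have hF : densityCrd g V p =ᶠ[𝓝 y] fun z =>
      ContinuousLinearMap.mul ℝ ℂ ((starRingEnd ℂ) (τ z)) (densityCrd g V y z) := by
    filter_upwards [(chartAt ℂ p).open_source.mem_nhds hp,
      (chartAt ℂ y).open_source.mem_nhds hy] with z hz hz'
    rw [ContinuousLinearMap.mul_apply', densityCrd, densityCrd, hg.conformalFactor_eq hz hz',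
      vecCoord_eq_deriv_mul hz hz']
    change _ = (starRingEnd ℂ) (τ z) * conformalFactor g y z • (τ z * vecCoord p z (V z))
    change (conformalFactor g y z * Complex.normSq (τ z)) • vecCoord p z (V z) = _
    rw [Complex.real_smul, Complex.real_smul, Complex.ofReal_mul, Complex.normSq_eq_conj_mul_self]
    ring
  have hcv : ∀ c, coordVec p y c = coordVec y y (τ y * c) := by
    intro c
    rw [← coordVec_vecCoord hy (coordVec p y c), vecCoord_eq_deriv_mul hp hy,
      vecCoord_coordVec hp]
  have hdp : ∀ c, dAt (densityCrd g V p) y (coordVec p y c) =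
      (starRingEnd ℂ) (τ y) * ((dAt (densityCrd g V y) y).comp (coordVec y y) : ℂ →ₗ[ℝ] ℂ)
        (τ y * c) + (starRingEnd ℂ) (d * c) * densityCrd g V y y := by
    intro c
    rw [dAt_congr hF, dAt_bilinear _ hmτ hmF]
    simp only [ContinuousLinearMap.mul_apply']
    rw [dAt_of_hasFDerivAt hp hfd, vecCoord_coordVec hp, hcv]
    simp [mul_comm]
  have hne : Complex.normSq (τ y) ≠ 0 := by
    intro h0
    have h1 := hg.conformalFactor_eq hp hy
    have h2 := (conformalFactor_pos g hp).ne'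
    change conformalFactor g p y = conformalFactor g y y * Complex.normSq (τ y) at h1
    rw [h0, mul_zero] at h1
    exact h2 h1
  have hρ : conformalFactor g p y = conformalFactor g y y * Complex.normSq (τ y) :=
    hg.conformalFactor_eq hp hy
  rw [densityDiv, densityDiv, hdp, hdp, re_add_im_conj_mul, hρ]
  have h2 := (conformalFactor_pos g hy).ne'
  simp only [ContinuousLinearMap.coe_coe, ContinuousLinearMap.comp_apply]
  field_simp

theorem divergence_eq (hg : IsConformal g) (hV : IsSmoothField V) {p y : M}
    (hp : y ∈ (chartAt ℂ p).source) :
    divergence g V y = (conformalFactor g p y)⁻¹ * densityDiv g V p y := by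
  rw [divergence_eq_own hg hV, densityDiv_change hg hV hp]

theorem continuous_divergence (hg : IsConformal g) (hV : IsSmoothField V) :
    Continuous (divergence g V) := by
  refine continuous_iff_continuousAt.2 fun y => ?_
  have hy := mem_chart_source ℂ y
  have h1 : ∀ c, ContinuousAt (fun z => dAt (densityCrd g V y) z (coordVec y z c)) y := fun c =>
    (contMDiffAt_dAt hy (hV.contMDiffAt_densityCrd hy) c).continuousAt
  have h2 : ContinuousAt (densityDiv g V y) y :=
    (Complex.continuous_re.continuousAt.comp (h1 1)).add
      (Complex.continuous_im.continuousAt.comp (h1 Complex.I))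
  have h3 : ContinuousAt (fun z => (conformalFactor g y z)⁻¹ * densityDiv g V y z) y :=
    ((contMDiffAt_conformalFactor g hy).continuousAt.inv₀ (conformalFactor_pos g hy).ne').mul h2
  refine h3.congr ?_
  filter_upwards [(chartAt ℂ y).open_source.mem_nhds hy] with z hz
  exact (divergence_eq hg hV hz).symm

theorem divergence_sum (hg : IsConformal g) {ι : Type*} (t : Finset ι)
    {W : ι → (x : M) → TangentSpace 𝓘(ℝ, ℂ) x} (hW : ∀ i ∈ t, IsSmoothField (W i))
    (hs : IsSmoothField fun x => ∑ i ∈ t, W i x) (y : M) :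
    divergence g (fun x => ∑ i ∈ t, W i x) y = ∑ i ∈ t, divergence g (W i) y := by
  have hy := mem_chart_source ℂ y
  have he : densityCrd g (fun x => ∑ i ∈ t, W i x) y = fun z => ∑ i ∈ t, densityCrd g (W i) y z :=
    funext fun z => by simp only [densityCrd, map_sum, Finset.smul_sum]
  rw [divergence_eq_own hg hs, Finset.sum_congr rfl fun i hi => divergence_eq_own hg (hW i hi) y,
    ← Finset.mul_sum]
  congr 1
  simp only [densityDiv]
  rw [he, Finset.sum_add_distrib]
  have hm : ∀ i ∈ t, MDifferentiableAt 𝓘(ℝ, ℂ) 𝓘(ℝ, ℂ) (densityCrd g (W i) y) y := fun i hi =>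
    ((hW i hi).contMDiffAt_densityCrd hy).mdifferentiableAt (n := ∞) (by simp)
  rw [dAt_sum hm, dAt_sum hm, Complex.re_sum, Complex.im_sum]

end Density

/-! ### Integration in one chart and the local divergence theorem. -/

section ChartIntegral

variable {M : Type*} [TopologicalSpace M] [ChartedSpace ℂ M]
  {G : Type*} [NormedAddCommGroup G] [NormedSpace ℝ G]

/-- The function `f` in the chart at `p`, extended by zero. -/
def chartExtend (p : M) (f : M → G) : ℂ → G :=
  (chartAt ℂ p).target.indicator (f ∘ (chartAt ℂ p).symm)

theorem chartExtend_apply {p : M} {z : ℂ} (hz : z ∈ (chartAt ℂ p).target) (f : M → G) :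
    chartExtend p f z = f ((chartAt ℂ p).symm z) :=
  Set.indicator_of_mem hz _

variable {p : M} {K : Set M} {f : M → G}

theorem isCompact_image_chart (hK : IsCompact K) (hKp : K ⊆ (chartAt ℂ p).source) :
    IsCompact (chartAt ℂ p '' K) :=
  hK.image_of_continuousOn ((chartAt ℂ p).continuousOn.mono hKp)

theorem chartExtend_eq_zero (hf : ∀ y ∉ K, f y = 0) {z : ℂ} (hz : z ∉ chartAt ℂ p '' K) :
    chartExtend p f z = 0 := by
  by_cases h : z ∈ (chartAt ℂ p).target
  · rw [chartExtend_apply h]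
    exact hf _ fun hK => hz ⟨_, hK, (chartAt ℂ p).right_inv h⟩
  · exact Set.indicator_of_notMem h _

theorem hasCompactSupport_chartExtend (hK : IsCompact K) (hKp : K ⊆ (chartAt ℂ p).source)
    (hf : ∀ y ∉ K, f y = 0) : HasCompactSupport (chartExtend p f) :=
  HasCompactSupport.intro (isCompact_image_chart hK hKp) fun _ hz => chartExtend_eq_zero hf hz

theorem chartExtend_eventuallyEq {z : ℂ} (hz : z ∈ (chartAt ℂ p).target) :
    chartExtend p f =ᶠ[𝓝 z] f ∘ (chartAt ℂ p).symm := by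
  filter_upwards [(chartAt ℂ p).open_target.mem_nhds hz] with w hw using chartExtend_apply hw f

/-- The image of K is compact, hence closed in the plane, so a point outside the target has a whole
neighbourhood missing it. Thus extension by zero creates no singularity at the boundary of the
chart. -/
theorem chartExtend_eventuallyEq_zero (hK : IsCompact K) (hKp : K ⊆ (chartAt ℂ p).source)
    (hf : ∀ y ∉ K, f y = 0) {z : ℂ} (hz : z ∉ (chartAt ℂ p).target) :
    chartExtend p f =ᶠ[𝓝 z] fun _ => 0 := by
  have hz' : z ∉ chartAt ℂ p '' K := fun ⟨y, hy, h⟩ =>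
    hz (h ▸ (chartAt ℂ p).map_source (hKp hy))
  filter_upwards [(isCompact_image_chart hK hKp).isClosed.isOpen_compl.mem_nhds hz'] with w hw
  exact chartExtend_eq_zero hf hw

theorem continuous_chartExtend (hK : IsCompact K) (hKp : K ⊆ (chartAt ℂ p).source)
    (hf : ∀ y ∉ K, f y = 0) (hc : ∀ y ∈ (chartAt ℂ p).source, ContinuousAt f y) :
    Continuous (chartExtend p f) := by
  refine continuous_iff_continuousAt.2 fun z => ?_
  by_cases hz : z ∈ (chartAt ℂ p).target
  · refine ContinuousAt.congr ?_ (chartExtend_eventuallyEq hz).symm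
    exact (hc _ ((chartAt ℂ p).map_target hz)).comp ((chartAt ℂ p).continuousAt_symm hz)
  · exact continuousAt_const.congr (chartExtend_eventuallyEq_zero hK hKp hf hz).symm

theorem integrableOn_chart (hK : IsCompact K) (hKp : K ⊆ (chartAt ℂ p).source)
    (hf : ∀ y ∉ K, f y = 0) (hc : ∀ y ∈ (chartAt ℂ p).source, ContinuousAt f y) :
    IntegrableOn (f ∘ (chartAt ℂ p).symm) (chartAt ℂ p).target := by
  rw [← integrable_indicator_iff (chartAt ℂ p).open_target.measurableSet]
  exact (continuous_chartExtend hK hKp hf hc).integrable_of_hasCompactSupport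
    (hasCompactSupport_chartExtend hK hKp hf)

/-- Integration by parts against the constant function 1. -/
theorem integral_fderiv_eq_zero {u : ℂ → ℝ} (hu : ContDiff ℝ 1 u) (hc : HasCompactSupport u)
    (v : ℂ) : ∫ z, fderiv ℝ u z v = 0 := by
  have h := integral_mul_fderiv_eq_neg_fderiv_mul_of_integrable (μ := (volume : Measure ℂ))
    (f := fun _ => (1 : ℝ)) (g := u) (v := v) (by simp) ?_ ?_ ?_ ?_
  · simpa using h
  · simp only [one_mul]
    refine Continuous.integrable_of_hasCompactSupport ?_ ?_
    · exact (hu.continuous_fderiv (by simp)).clm_apply continuous_const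
    · exact (hc.fderiv (𝕜 := ℝ)).comp_left (g := fun T : ℂ →L[ℝ] ℝ => T v) rfl
  · simpa using hu.continuous.integrable_of_hasCompactSupport hc
  · exact fun _ _ => differentiableAt_const _
  · exact fun z _ => (hu.differentiable (by simp)).differentiableAt

variable [IsManifold 𝓘(ℂ) ω M]

theorem contDiff_chartExtend (hK : IsCompact K) (hKp : K ⊆ (chartAt ℂ p).source)
    (hf : ∀ y ∉ K, f y = 0)
    (hs : ∀ y ∈ (chartAt ℂ p).source, ContMDiffAt 𝓘(ℝ, ℂ) 𝓘(ℝ, G) ∞ f y) :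
    ContDiff ℝ ∞ (chartExtend p f) := by
  refine contDiff_iff_contDiffAt.2 fun z => ?_
  by_cases hz : z ∈ (chartAt ℂ p).target
  · refine ContDiffAt.congr_of_eventuallyEq ?_ (chartExtend_eventuallyEq hz)
    rw [← contMDiffAt_iff_contDiffAt]
    exact (hs _ ((chartAt ℂ p).map_target hz)).comp z
      (contMDiffAt_symm_of_mem_maximalAtlas (chartAt_mem_maximalAtlas_real p) hz)
  · exact contDiffAt_const.congr_of_eventuallyEq (chartExtend_eventuallyEq_zero hK hKp hf hz)

/-- The integral of a partial derivative over a chart. -/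
theorem setIntegral_dAt_eq_zero {f : M → ℝ} (hK : IsCompact K) (hKp : K ⊆ (chartAt ℂ p).source)
    (hf : ∀ y ∉ K, f y = 0)
    (hs : ∀ y ∈ (chartAt ℂ p).source, ContMDiffAt 𝓘(ℝ, ℂ) 𝓘(ℝ, ℝ) ∞ f y) (c : ℂ) :
    ∫ z in (chartAt ℂ p).target, dAt f ((chartAt ℂ p).symm z)
      (coordVec p ((chartAt ℂ p).symm z) c) = 0 := by
  have h := integral_fderiv_eq_zero ((contDiff_chartExtend hK hKp hf hs).of_le
    (by exact_mod_cast le_top)) (hasCompactSupport_chartExtend hK hKp hf) c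
  rw [← setIntegral_eq_integral_of_forall_compl_eq_zero (s := (chartAt ℂ p).target)] at h
  · rw [← h]
    refine setIntegral_congr_fun (chartAt ℂ p).open_target.measurableSet fun z hz => ?_
    have hy := (chartAt ℂ p).map_target hz
    rw [dAt_coordVec hy ((hs _ hy).mdifferentiableAt (n := ∞) (by simp)),
      (chartAt ℂ p).right_inv hz, (chartExtend_eventuallyEq hz).fderiv_eq]
  · intro z hz
    rw [(chartExtend_eventuallyEq_zero hK hKp hf hz).fderiv_eq]
    simp

/-- The integral of `f dvol(g)` over the chart at `p`. -/
def chartIntegral (g : SurfaceMetric M) (p : M) (f : M → G) : G :=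
  ∫ z in (chartAt ℂ p).target,
    conformalFactor g p ((chartAt ℂ p).symm z) • f ((chartAt ℂ p).symm z)

variable {g : SurfaceMetric M}

theorem integrableOn_chart_conformalFactor (hK : IsCompact K) (hKp : K ⊆ (chartAt ℂ p).source)
    (hf : ∀ y ∉ K, f y = 0) (hc : Continuous f) :
    IntegrableOn (fun z => conformalFactor g p ((chartAt ℂ p).symm z) •
      f ((chartAt ℂ p).symm z)) (chartAt ℂ p).target :=
  integrableOn_chart (f := fun y => conformalFactor g p y • f y) hK hKp
    (fun y hy => by simp [hf y hy])
    fun _ hy => (contMDiffAt_conformalFactor g hy).continuousAt.smul hc.continuousAt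

theorem det_mul_complex (τ : ℂ) :
    ((ContinuousLinearMap.toSpanSingleton ℂ τ).restrictScalars ℝ).det = Complex.normSq τ := by
  rw [← Algebra.norm_complex_apply, Algebra.norm_apply, ContinuousLinearMap.det]
  congr 1
  ext
  · simp [mul_comm]

/-- The change of variables between two charts. -/
theorem chartIntegral_change (hg : IsConformal g) {p q : M}
    (hf : ∀ y, y ∉ (chartAt ℂ p).source ∩ (chartAt ℂ q).source → f y = 0) :
    chartIntegral g p f = chartIntegral g q f := by
  set e : OpenPartialHomeomorph ℂ ℂ := (chartAt ℂ q).symm ≫ₕ chartAt ℂ p with he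
  have hsrc : ∀ z, z ∈ e.source ↔ z ∈ (chartAt ℂ q).target ∧
      (chartAt ℂ q).symm z ∈ (chartAt ℂ p).source := fun z => by simp [he]
  have htgt : ∀ z, z ∈ e.target ↔ z ∈ (chartAt ℂ p).target ∧
      (chartAt ℂ p).symm z ∈ (chartAt ℂ q).source := fun z => by simp [he]
  have hd : ∀ z ∈ e.source, HasFDerivAt e
      ((ContinuousLinearMap.toSpanSingleton ℂ (deriv (chartAt ℂ p ∘ (chartAt ℂ q).symm) z)
        ).restrictScalars ℝ) z := by
    intro z hz
    have h := differentiableAt_chart_change ((chartAt ℂ q).map_target ((hsrc z).1 hz).1)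
      ((hsrc z).1 hz).2
    rw [(chartAt ℂ q).right_inv ((hsrc z).1 hz).1] at h
    exact h.hasDerivAt.hasFDerivAt.restrictScalars ℝ
  -- As f vanishes off the overlap of the two charts, both integrals may be restricted to its
  -- images, which `e` maps onto each other.
  have h1 : chartIntegral g p f = ∫ z in e.target,
      conformalFactor g p ((chartAt ℂ p).symm z) • f ((chartAt ℂ p).symm z) := by
    refine setIntegral_eq_of_subset_of_forall_sdiff_eq_zero
      (chartAt ℂ p).open_target.measurableSet (fun z hz => ((htgt z).1 hz).1) fun z hz => ?_
    rw [hf _ fun h => hz.2 ((htgt z).2 ⟨hz.1, h.2⟩), smul_zero]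
  have h2 : chartIntegral g q f = ∫ z in e.source,
      conformalFactor g q ((chartAt ℂ q).symm z) • f ((chartAt ℂ q).symm z) := by
    refine setIntegral_eq_of_subset_of_forall_sdiff_eq_zero
      (chartAt ℂ q).open_target.measurableSet (fun z hz => ((hsrc z).1 hz).1) fun z hz => ?_
    rw [hf _ fun h => hz.2 ((hsrc z).2 ⟨hz.1, h.1⟩), smul_zero]
  rw [h1, h2, integral_target_eq_integral_abs_det_fderiv_smul volume hd]
  refine setIntegral_congr_fun e.open_source.measurableSet fun z hz => ?_
  have hz1 := ((hsrc z).1 hz).1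
  have hz2 := ((hsrc z).1 hz).2
  have hez : (chartAt ℂ p).symm (e z) = (chartAt ℂ q).symm z := by
    simp [he, (chartAt ℂ p).left_inv hz2]
  rw [det_mul_complex, abs_of_nonneg (Complex.normSq_nonneg _), hez, smul_smul,
    hg.conformalFactor_eq ((chartAt ℂ q).map_target hz1) hz2, (chartAt ℂ q).right_inv hz1, mul_comm]

/-- The divergence theorem for vector fields supported in a chart. -/
theorem chartIntegral_divergence (hg : IsConformal g) (hK : IsCompact K)
    (hKp : K ⊆ (chartAt ℂ p).source) {V : (x : M) → TangentSpace 𝓘(ℝ, ℂ) x}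
    (hV : IsSmoothField V) (hf : ∀ y ∉ K, V y = 0) :
    chartIntegral g p (divergence g V) = 0 := by
  have hd0 : ∀ y ∉ K, densityCrd g V p y = 0 := fun y hy => by simp [densityCrd, hf y hy]
  have hs := fun y (hy : y ∈ (chartAt ℂ p).source) => hV.contMDiffAt_densityCrd (g := g) hy
  have hre : ∀ y ∈ (chartAt ℂ p).source, ContMDiffAt 𝓘(ℝ, ℂ) 𝓘(ℝ, ℝ) ∞
      (fun y => Complex.reCLM (densityCrd g V p y)) y := fun y hy =>
    Complex.reCLM.contMDiff.contMDiffAt.comp y (hs y hy)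
  have him : ∀ y ∈ (chartAt ℂ p).source, ContMDiffAt 𝓘(ℝ, ℂ) 𝓘(ℝ, ℝ) ∞
      (fun y => Complex.imCLM (densityCrd g V p y)) y := fun y hy =>
    Complex.imCLM.contMDiff.contMDiffAt.comp y (hs y hy)
  have h1 := setIntegral_dAt_eq_zero hK hKp (fun y hy => by simp [hd0 y hy]) hre 1
  have h2 := setIntegral_dAt_eq_zero hK hKp (fun y hy => by simp [hd0 y hy]) him Complex.I
  -- Each partial derivative must be integrable on its own for the integral of their sum to split.
  have hint : ∀ {f : M → ℝ}, (∀ y ∈ (chartAt ℂ p).source, ContMDiffAt 𝓘(ℝ, ℂ) 𝓘(ℝ, ℝ) ∞ f y) →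
      (∀ y ∉ K, f y = 0) → ∀ c, IntegrableOn (fun z => dAt f ((chartAt ℂ p).symm z)
        (coordVec p ((chartAt ℂ p).symm z) c)) (chartAt ℂ p).target := by
    intro f hfs hf0 c
    have hi : Integrable fun z => fderiv ℝ (chartExtend p f) z c := by
      have hcd := contDiff_chartExtend hK hKp hf0 hfs
      refine Continuous.integrable_of_hasCompactSupport ?_ ?_
      · exact (hcd.continuous_fderiv (by simp)).clm_apply continuous_const
      · exact ((hasCompactSupport_chartExtend hK hKp hf0).fderiv (𝕜 := ℝ)).comp_left
          (g := fun T : ℂ →L[ℝ] ℝ => T c) rfl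
    refine hi.integrableOn.congr_fun (fun z hz => ?_) (chartAt ℂ p).open_target.measurableSet
    have hy := (chartAt ℂ p).map_target hz
    beta_reduce
    rw [dAt_coordVec hy ((hfs _ hy).mdifferentiableAt (n := ∞) (by simp)),
      (chartAt ℂ p).right_inv hz, (chartExtend_eventuallyEq hz).fderiv_eq]
  have hi1 := hint hre (fun y hy => by simp [hd0 y hy]) 1
  have hi2 := hint him (fun y hy => by simp [hd0 y hy]) Complex.I
  have h3 := integral_add hi1 hi2
  rw [h1, h2, add_zero] at h3
  rw [← h3, chartIntegral]
  refine setIntegral_congr_fun (chartAt ℂ p).open_target.measurableSet fun z hz => ?_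
  have hy := (chartAt ℂ p).map_target hz
  have hm := (hs _ hy).mdifferentiableAt (n := ∞) (by simp)
  rw [divergence_eq hg hV hy, dAt_clm _ hm, dAt_clm _ hm, smul_eq_mul,
    mul_inv_cancel_left₀ (conformalFactor_pos g hy).ne']
  rfl

end ChartIntegral

end SusyDirac

namespace SusyDirac

open Filter Topology MeasureTheory

/-! ### Global integration: divergence theorem and dependence on parameters. -/

section SurfaceIntegral

variable {M : Type*} [TopologicalSpace M] [ChartedSpace ℂ M] [IsManifold 𝓘(ℂ) ω M]
  [CompactSpace M] [T2Space M] {G : Type*} [NormedAddCommGroup G] [NormedSpace ℝ G]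
  {g : SurfaceMetric M}

theorem tsupport_chartPartition_subset (p : M) :
    tsupport (chartPartition M p) ⊆ (chartAt ℂ p).source :=
  (SmoothPartitionOfUnity.exists_isSubordinate_chartAt_source 𝓘(ℝ, ℂ) M).choose_spec p

theorem isCompact_tsupport_chartPartition (p : M) : IsCompact (tsupport (chartPartition M p)) :=
  (isClosed_tsupport _).isCompact

theorem chartPartition_eq_zero {p y : M} (hy : y ∉ tsupport (chartPartition M p)) :
    chartPartition M p y = 0 :=
  image_eq_zero_of_notMem_tsupport hy

variable (M) in
theorem finite_support_chartPartition :
    {p : M | (Function.support (chartPartition M p)).Nonempty}.Finite :=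
  (chartPartition M).locallyFinite.finite_nonempty_of_compact

variable (M) in
/-- The charts which contribute to the partition of unity. -/
def partitionCharts : Finset M :=
  (finite_support_chartPartition M).toFinset

theorem chartPartition_eq_zero_of_notMem {p : M} (hp : p ∉ partitionCharts M) (y : M) :
    chartPartition M p y = 0 := by
  by_contra h
  exact hp ((finite_support_chartPartition M).mem_toFinset.2 ⟨y, h⟩)

theorem sum_chartPartition (y : M) : ∑ p ∈ partitionCharts M, chartPartition M p y = 1 := by
  rw [← (chartPartition M).sum_eq_one (Set.mem_univ y)]
  refine (finsum_eq_sum_of_support_subset _ fun p hp => ?_).symm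
  by_contra h
  exact hp (chartPartition_eq_zero_of_notMem h y)

theorem surfaceIntegral_eq_sum (hg : IsConformal g) (f : M → G) :
    surfaceIntegral g f =
      ∑ p ∈ partitionCharts M, chartIntegral g p fun y => chartPartition M p y • f y := by
  have h1 : ∀ p : M, (∫ z in (chartAt ℂ p).target,
      (chartPartition M p ((chartAt ℂ p).symm z) * areaDensity g p ((chartAt ℂ p).symm z)) •
        f ((chartAt ℂ p).symm z)) = chartIntegral g p fun y => chartPartition M p y • f y := by
    intro p
    refine setIntegral_congr_fun (chartAt ℂ p).open_target.measurableSet fun z hz => ?_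
    beta_reduce
    rw [hg.areaDensity_eq ((chartAt ℂ p).map_target hz), smul_smul, mul_comm]
  rw [surfaceIntegral]
  simp only [h1]
  refine finsum_eq_sum_of_support_subset _ fun p hp => ?_
  by_contra h
  refine hp ?_
  simp [chartIntegral, chartPartition_eq_zero_of_notMem h]

theorem integrableOn_chartPartition {f : M → G} (hf : Continuous f) (p : M) :
    IntegrableOn (fun z => conformalFactor g p ((chartAt ℂ p).symm z) •
      chartPartition M p ((chartAt ℂ p).symm z) • f ((chartAt ℂ p).symm z))
      (chartAt ℂ p).target :=
  integrableOn_chart_conformalFactor (f := fun y => chartPartition M p y • f y)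
    (isCompact_tsupport_chartPartition p) (tsupport_chartPartition_subset p)
    (fun y hy => by simp [chartPartition_eq_zero hy])
    ((chartPartition M p).contMDiff.continuous.smul hf)

theorem surfaceIntegral_sum (hg : IsConformal g) {ι : Type*} (t : Finset ι) {f : ι → M → G}
    (hf : ∀ i ∈ t, Continuous (f i)) :
    surfaceIntegral g (fun x => ∑ i ∈ t, f i x) = ∑ i ∈ t, surfaceIntegral g (f i) := by
  rw [surfaceIntegral_eq_sum hg,
    Finset.sum_congr rfl fun i _ => surfaceIntegral_eq_sum hg (f i), Finset.sum_comm]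
  refine Finset.sum_congr rfl fun p _ => ?_
  simp only [chartIntegral, Finset.smul_sum]
  exact integral_finsetSum t fun i hi => integrableOn_chartPartition (hf i hi) p

theorem surfaceIntegral_smul_const [CompleteSpace G] (hg : IsConformal g) (f : M → ℝ) (c : G) :
    surfaceIntegral g (fun x => f x • c) = surfaceIntegral g f • c := by
  rw [surfaceIntegral_eq_sum hg, surfaceIntegral_eq_sum hg, Finset.sum_smul]
  refine Finset.sum_congr rfl fun p _ => ?_
  rw [chartIntegral, chartIntegral, ← integral_smul_const]
  simp only [smul_assoc]

/-- The integral of a function supported in a chart. -/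
theorem surfaceIntegral_eq_chartIntegral (hg : IsConformal g) {f : M → G} (hf : Continuous f)
    {q : M} {K : Set M} (hK : IsCompact K) (hKq : K ⊆ (chartAt ℂ q).source)
    (h0 : ∀ y ∉ K, f y = 0) : surfaceIntegral g f = chartIntegral g q f := by
  -- Each piece lives in the overlap of two charts and can be moved to the chart at q. There the
  -- functions of the partition add up to 1.
  have h1 : ∀ p : M, chartIntegral g p (fun y => chartPartition M p y • f y) =
      chartIntegral g q fun y => chartPartition M p y • f y := by
    intro p
    refine chartIntegral_change hg fun y hy => ?_
    by_cases hyp : y ∈ (chartAt ℂ p).source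
    · rw [h0 y fun h => hy ⟨hyp, hKq h⟩, smul_zero]
    · rw [chartPartition_eq_zero fun h => hyp (tsupport_chartPartition_subset p h), zero_smul]
  rw [surfaceIntegral_eq_sum hg, Finset.sum_congr rfl fun p _ => h1 p]
  simp only [chartIntegral]
  rw [← integral_finsetSum]
  · simp only [← Finset.smul_sum, ← Finset.sum_smul, sum_chartPartition, one_smul]
  · intro p _
    exact integrableOn_chart_conformalFactor (f := fun y => chartPartition M p y • f y) hK hKq
      (fun y hy => by simp [h0 y hy]) ((chartPartition M p).contMDiff.continuous.smul hf)

/-- The divergence theorem on a closed surface. -/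
theorem surfaceIntegral_divergence (hg : IsConformal g) {V : (x : M) → TangentSpace 𝓘(ℝ, ℂ) x}
    (hV : IsSmoothField V) : surfaceIntegral g (divergence g V) = 0 := by
  have hW : ∀ p : M, IsSmoothField fun x => chartPartition M p x • V x := fun p =>
    hV.smul (chartPartition M p).contMDiff
  have hsum : (fun x => ∑ p ∈ partitionCharts M, chartPartition M p x • V x) = V :=
    funext fun x => by rw [← Finset.sum_smul, sum_chartPartition, one_smul]
  have h1 : divergence g V = fun y => ∑ p ∈ partitionCharts M,
      divergence g (fun x => chartPartition M p x • V x) y := by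
    funext y
    rw [← divergence_sum hg _ (fun p _ => hW p) (by rwa [hsum]), hsum]
  rw [h1, surfaceIntegral_sum hg _ fun p _ => continuous_divergence hg (hW p)]
  refine Finset.sum_eq_zero fun p _ => ?_
  have h0 : ∀ y ∉ tsupport (chartPartition M p), chartPartition M p y • V y = 0 := fun y hy => by
    rw [chartPartition_eq_zero hy, zero_smul]
  rw [surfaceIntegral_eq_chartIntegral hg (continuous_divergence hg (hW p))
    (isCompact_tsupport_chartPartition p) (tsupport_chartPartition_subset p),
    chartIntegral_divergence hg (isCompact_tsupport_chartPartition p)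
      (tsupport_chartPartition_subset p) (hW p) h0]
  -- It remains to see that the divergence of a localized field vanishes off the support: that
  -- complement is open, so the field is zero near y and not merely at y.
  intro y hy
  have he : densityCrd g (fun x => chartPartition M p x • V x) y =ᶠ[𝓝 y] fun _ => 0 := by
    filter_upwards [(isClosed_tsupport _).isOpen_compl.mem_nhds hy] with z hz
    rw [densityCrd, h0 z hz, map_zero, smul_zero]
  have hz : ∀ v, dAt (fun _ : M => (0 : ℂ)) y v = 0 := fun v => by
    rw [dAt, mfderiv_const]
    rfl
  rw [divergence_eq_own hg (hW p), densityDiv, dAt_congr he, hz, hz]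
  simp

/-- A continuous linear map with kernel S commutes with the integral. No integrability is assumed,
since a non-integrable function has integral 0, which lies in S. -/
theorem surfaceIntegral_mem {L : ℕ} (hg : IsConformal g) (S : Submodule ℝ (Grassmann L))
    {f : M → Grassmann L} (hf : ∀ x, f x ∈ S) : surfaceIntegral g f ∈ S := by
  obtain ⟨T, hT⟩ := exists_clm_ker_eq S
  rw [surfaceIntegral_eq_sum hg]
  refine Submodule.sum_mem _ fun p _ => ?_
  rw [chartIntegral]
  set h : ℂ → Grassmann L := fun z => conformalFactor g p ((chartAt ℂ p).symm z) •
    chartPartition M p ((chartAt ℂ p).symm z) • f ((chartAt ℂ p).symm z) with hh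
  have hS : ∀ z, h z ∈ S := fun z => S.smul_mem _ (S.smul_mem _ (hf _))
  by_cases hi : IntegrableOn h (chartAt ℂ p).target
  · rw [hT]
    refine (T.integral_comp_comm hi).symm.trans ?_
    simp only [(hT _).1 (hS _), integral_zero]
  · rw [integral_undef hi]
    exact S.zero_mem

/-- The partial derivative of a smooth family of functions with respect to the parameter. -/
theorem continuous_deriv_family {u : ℝ → M → G}
    (hu : ContMDiff (𝓘(ℝ, ℝ).prod 𝓘(ℝ, ℂ)) 𝓘(ℝ, G) ∞ (fun q : ℝ × M => u q.1 q.2)) :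
    (∀ t y, DifferentiableAt ℝ (fun t => u t y) t) ∧
      Continuous fun q : ℝ × M => deriv (fun t => u t q.2) q.1 := by
  have key : ∀ t y, ∀ᶠ q : ℝ × M in 𝓝 (t, y), HasDerivAt (fun t => u t q.2)
      (fderiv ℝ (fun q : ℝ × ℂ => u q.1 ((chartAt ℂ y).symm q.2)) (q.1, chartAt ℂ y q.2)
        (1, 0)) q.1 := by
    intro t y
    have hy := mem_chart_source ℂ y
    have hd : ContDiffAt ℝ 1 (fun q : ℝ × ℂ => u q.1 ((chartAt ℂ y).symm q.2))
        (t, chartAt ℂ y y) :=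
      contDiffAt_comp_chart_symm (n := 1) hy
        ((hu (t, y)).of_le (by exact_mod_cast le_top))
    have hc : ContinuousAt (fun q : ℝ × M => (q.1, chartAt ℂ y q.2)) (t, y) :=
      continuousAt_fst.prodMk (((chartAt ℂ y).continuousAt hy).comp continuousAt_snd)
    have hs : ∀ᶠ q : ℝ × M in 𝓝 (t, y), q.2 ∈ (chartAt ℂ y).source :=
      continuousAt_snd ((chartAt ℂ y).open_source.mem_nhds hy)
    filter_upwards [hc.eventually (hd.eventually (by simp)), hs] with q hq hqs
    have h1 := (hq.differentiableAt (by simp)).hasFDerivAt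
    have h2 : HasDerivAt (fun t : ℝ => (t, chartAt ℂ y q.2)) ((1 : ℝ), (0 : ℂ)) q.1 :=
      (hasDerivAt_id q.1).prodMk (hasDerivAt_const q.1 _)
    have h3 := h1.comp_hasDerivAt q.1 h2
    simpa only [Function.comp_def, (chartAt ℂ y).left_inv hqs] using h3
  refine ⟨fun t y => (key t y).self_of_nhds.differentiableAt,
    continuous_iff_continuousAt.2 fun ⟨t, y⟩ => ?_⟩
  have hy := mem_chart_source ℂ y
  have hd : ContDiffAt ℝ 1 (fun q : ℝ × ℂ => u q.1 ((chartAt ℂ y).symm q.2))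
      (t, chartAt ℂ y y) :=
    contDiffAt_comp_chart_symm (n := 1) hy ((hu (t, y)).of_le (by exact_mod_cast le_top))
  have hc : ContinuousAt (fun q : ℝ × M => (q.1, chartAt ℂ y q.2)) (t, y) :=
    continuousAt_fst.prodMk (((chartAt ℂ y).continuousAt hy).comp continuousAt_snd)
  have hf : ContinuousAt (fderiv ℝ (fun q : ℝ × ℂ => u q.1 ((chartAt ℂ y).symm q.2)))
      (t, chartAt ℂ y y) := (hd.fderiv_right (m := 0) (by norm_num)).continuousAt
  have hf' : ContinuousAt (fun q : ℝ × M =>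
      fderiv ℝ (fun q : ℝ × ℂ => u q.1 ((chartAt ℂ y).symm q.2)) (q.1, chartAt ℂ y q.2))
      (t, y) := ContinuousAt.comp (f := fun q : ℝ × M => (q.1, chartAt ℂ y q.2)) hf hc
  refine (hf'.clm_apply (continuousAt_const (y := ((1 : ℝ), (0 : ℂ))))).congr ?_
  filter_upwards [key t y] with q hq using hq.deriv.symm

/-- Differentiation under the integral sign. -/
theorem hasDerivAt_surfaceIntegral (hg : IsConformal g) {u : ℝ → M → G}
    (hu : ContMDiff (𝓘(ℝ, ℝ).prod 𝓘(ℝ, ℂ)) 𝓘(ℝ, G) ∞ (fun q : ℝ × M => u q.1 q.2))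
    {w : M → G} (hw : ∀ x, HasDerivAt (fun t => u t x) (w x) 0) :
    HasDerivAt (fun t => surfaceIntegral g (u t)) (surfaceIntegral g w) 0 := by
  obtain ⟨hdiff, hcont⟩ := continuous_deriv_family hu
  set D : ℝ → M → G := fun t y => deriv (fun t => u t y) t with hD
  have hDw : w = D 0 := funext fun x => (hw x).deriv.symm
  have huc : ∀ t, Continuous (u t) := fun t =>
    hu.continuous.comp (continuous_const.prodMk continuous_id)
  have hDc : ∀ t, Continuous (D t) := fun t =>
    hcont.comp (continuous_const.prodMk continuous_id)
  -- The parameter derivative is continuous, hence bounded on the compact set [−1, 1] × M. The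
  -- dominating function is C times the norm of the localized area density, which is integrable.
  obtain ⟨C, hC⟩ := ((isCompact_closedBall (0 : ℝ) 1).prod
    (isCompact_univ (X := M))).exists_bound_of_continuousOn hcont.continuousOn
  simp only [surfaceIntegral_eq_sum hg]
  refine HasDerivAt.fun_sum fun p _ => ?_
  have hχ := integrableOn_chartPartition (g := g) (continuous_const (y := (1 : ℝ))) p
  rw [hDw]
  refine (hasDerivAt_integral_of_dominated_loc_of_deriv_le (𝕜 := ℝ)
    (F := fun t z => conformalFactor g p ((chartAt ℂ p).symm z) •
      chartPartition M p ((chartAt ℂ p).symm z) • u t ((chartAt ℂ p).symm z))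
    (F' := fun t z => conformalFactor g p ((chartAt ℂ p).symm z) •
      chartPartition M p ((chartAt ℂ p).symm z) • D t ((chartAt ℂ p).symm z))
    (bound := fun z => ‖conformalFactor g p ((chartAt ℂ p).symm z) •
      chartPartition M p ((chartAt ℂ p).symm z) • (1 : ℝ)‖ * C)
    (Metric.ball_mem_nhds (0 : ℝ) one_pos) ?_ ?_ ?_ ?_ ?_ ?_).2
  · exact Eventually.of_forall fun t => (integrableOn_chartPartition (huc t) p).aestronglyMeasurable
  · exact integrableOn_chartPartition (huc 0) p
  · exact (integrableOn_chartPartition (hDc 0) p).aestronglyMeasurable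
  · refine Eventually.of_forall fun z t ht => ?_
    rw [norm_smul, norm_smul, norm_smul, norm_smul, norm_one, mul_one, ← mul_assoc]
    refine mul_le_mul_of_nonneg_left ?_ (by positivity)
    exact hC (t, (chartAt ℂ p).symm z) ⟨Metric.ball_subset_closedBall ht, Set.mem_univ _⟩
  · exact hχ.norm.mul_const C
  · exact Eventually.of_forall fun z t _ =>
      ((hdiff t ((chartAt ℂ p).symm z)).hasDerivAt.const_smul _).const_smul _

end SurfaceIntegral

/-! ### Parity and stationarity of the action. -/

section Action

variable {n L : ℕ} {Y : Type*} [TopologicalSpace Y] [ChartedSpace (Euc n) Y]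
  [IsManifold 𝓘(ℝ, Euc n) ∞ Y]
  {M : Type*} [TopologicalSpace M] [ChartedSpace ℂ M] [IsManifold 𝓘(ℂ) ω M]
  (σ : SpinStructure M) {φ : M → Y} {g₂ : TargetMetric n Y} {g₁ : SurfaceMetric M}

/-- Parity is read off the local formula: differentiation preserves it, the map term is a sum of
products of even elements, and the spinor term one of products of odd elements. -/
theorem lagrangian_even (hφ : ContMDiff 𝓘(ℝ, ℂ) 𝓘(ℝ, Euc n) ∞ φ) (hg₂ : IsFlat g₂)
    (hg₁ : IsConformal g₁) (A : OneForm M) {ξ : FieldAlong n L φ}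
    (hξ : ∀ y, SmoothAlongAt 𝓘(ℝ, ℂ) φ ξ y) (hξ_even : ∀ y, HasParity 0 (ξ y))
    {ψ : (x : M) → Twisted n L σ φ x} (hψ : IsSmoothTwisted σ φ ψ)
    (hψ_odd : ∀ x c, HasParity 1 (ψ x c)) (x : M) :
    lagrangian g₁ σ hg₂ A φ ξ ψ x ∈ parityPart L 0 := by
  obtain ⟨hx, hai⟩ := flatChart_spec hg₂ (φ x)
  have hp := σ.mem_dom x
  rw [lagrangian_eq σ hφ hg₂ g₁ A hg₁ hai hψ hψ_odd hp (hξ x) hx, localDensity]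
  refine Submodule.smul_mem _ _ (Submodule.sum_mem _ fun i _ => Submodule.add_mem _
    (Submodule.sum_mem _ fun k _ => ?_) ?_)
  · have h : ∀ v, dAt (mapCrd (flatChart hg₂ (φ x)) ξ i) x v ∈ parityPart L 0 := fun v =>
      dAt_mem_of_forall_mem ((contMDiffAt_mapCrd hai.1 hφ (hξ x) hx i).mdifferentiableAt
        (n := ∞) (by simp)) (fun y => Submodule.add_mem _
          (Submodule.smul_mem _ _ one_mem_parityPart) ((hξ_even y).contract_mem _)) v
    simpa using mul_mem_parityPart (h (coordVec x x (direction k))) (h _)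
  · have h : ∀ c v, dAt (spinorCrd σ (flatChart hg₂ (φ x)) x ψ c i) x v ∈ parityPart L 1 :=
      fun c v => dAt_mem_of_forall_mem
        ((contMDiffAt_spinorCrd σ hai.1 hφ hψ hp hx c i).mdifferentiableAt (n := ∞) (by simp))
        (spinorCrd_odd σ hψ_odd c i) v
    exact Submodule.add_mem _
      (odd_mul_odd_mem (spinorCrd_odd σ hψ_odd _ _ _) (Submodule.sub_mem _ (h _ _) (h _ _)))
      (odd_mul_odd_mem (spinorCrd_odd σ hψ_odd _ _ _) (Submodule.add_mem _ (h _ _) (h _ _)))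

variable [CompactSpace M] [T2Space M]

theorem surfaceIntegral_gradedDivergence (hg₁ : IsConformal g₁)
    {J : (x : M) → TangentSpace 𝓘(ℝ, ℂ) x ⊗[ℝ] Grassmann L}
    (hJ : ∀ ℓ : Grassmann L →ₗ[ℝ] ℝ, IsSmoothField fun x => component ℓ (J x)) :
    surfaceIntegral g₁ (gradedDivergence g₁ J) = 0 := by
  have hc := fun I => continuous_divergence hg₁ (hJ ((grassmannBasis L).coord I))
  have h1 := surfaceIntegral_sum hg₁ Finset.univ (f := fun I x => divergence g₁
    (fun y => component ((grassmannBasis L).coord I) (J y)) x • grassmannBasis L I)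
    fun I _ => (hc I).smul continuous_const
  refine h1.trans (Finset.sum_eq_zero fun I _ => ?_)
  rw [surfaceIntegral_smul_const hg₁, surfaceIntegral_divergence hg₁ (hJ _), zero_smul]

theorem hasDerivAt_action (hφ : ContMDiff 𝓘(ℝ, ℂ) 𝓘(ℝ, Euc n) ∞ φ) (hg₂ : IsFlat g₂)
    (hg₁ : IsConformal g₁) (A : OneForm M)
    {ψ : (x : M) → Twisted n L σ φ x} (hψ : IsSmoothTwisted σ φ ψ)
    (hψ_odd : ∀ x c, HasParity 1 (ψ x c)) {s : (x : M) → Spinor σ x ⊗[ℝ] Grassmann L}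
    (hs : IsSmoothSpinor σ s) (hs_odd : ∀ x, HasParity 1 (s x))
    {Ξ : ℝ → FieldAlong n L φ} {Ψ : ℝ → (x : M) → Twisted n L σ φ x}
    (h : IsSusyVariation g₁ σ φ ψ s Ξ Ψ) (hol : IsHolomorphicSpinor σ s) :
    HasDerivAt (fun t => action g₁ σ hg₂ A φ (Ξ t) (Ψ t)) 0 0 := by
  have hq : ∀ x, qTerm g₁ σ g₂ φ ψ s x = 0 := by
    intro x
    obtain ⟨hx, hai⟩ := flatChart_spec hg₂ (φ x)
    rw [qTerm_eq σ hai hφ ψ hs hx, obstruction]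
    simp [(isHolomorphicSpinor_iff σ hs).1 hol x]
  have h1 := hasDerivAt_surfaceIntegral hg₁
    (contMDiff_lagrangian σ hφ h.smooth_map h.smooth_spinor hg₂ hg₁ A h.odd_spinor)
    (w := gradedDivergence g₁ (current σ g₂ g₁ ψ s)) fun x => by
      have h2 := hasDerivAt_lagrangian σ hφ hg₂ hg₁ A hψ hψ_odd hs hs_odd h x
      rwa [hq, smul_zero, add_zero] at h2
  rwa [surfaceIntegral_gradedDivergence hg₁ fun ℓ =>
    contMDiff_current σ hφ hg₂ hg₁ hψ hs ℓ] at h1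

end Action

end SusyDirac

end

open SusyDirac in
theorem mainTheorem2 {M : Type*} [TopologicalSpace M] [T2Space M] [CompactSpace M]
    [ChartedSpace ℂ M] [IsManifold 𝓘(ℂ) ω M]
    {n L : ℕ} {Y : Type*} [TopologicalSpace Y] [ChartedSpace (Euc n) Y]
    [IsManifold 𝓘(ℝ, Euc n) ∞ Y]
    (g₁ : SurfaceMetric M) (hg₁ : IsConformal g₁) (σ : SpinStructure M)
    (g₂ : TargetMetric n Y) (hg₂ : IsFlat g₂) (A : OneForm M)
    (φ : M → Y) (hφ : ContMDiff 𝓘(ℝ, ℂ) 𝓘(ℝ, Euc n) ∞ φ)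
    (ψ : (x : M) → Twisted n L σ φ x) (hψ : IsSmoothTwisted σ φ ψ)
    (hψ_odd : ∀ x c, HasParity 1 (ψ x c))
    (s : (x : M) → Spinor σ x ⊗[ℝ] Grassmann L) (hs : IsSmoothSpinor σ s)
    (hs_odd : ∀ x, HasParity 1 (s x)) :
    IsSusyVariation g₁ σ φ ψ s (fun t => t • susyMap σ φ ψ s)
        (fun t x => ψ x + t • susySpinor g₁ σ φ s x) ∧
      (∃ J : (x : M) → TangentSpace 𝓘(ℝ, ℂ) x ⊗[ℝ] Grassmann L,
        (∀ ℓ : Grassmann L →ₗ[ℝ] ℝ, ContMDiff 𝓘(ℝ, ℂ) 𝓘(ℝ, ℂ).tangent ∞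
          (fun x => (⟨x, component ℓ (J x)⟩ : TangentBundle 𝓘(ℝ, ℂ) M))) ∧
        (∀ x, HasParity 0 (J x)) ∧
        ∀ Ξ Ψ, IsSusyVariation g₁ σ φ ψ s Ξ Ψ → ∀ x,
          HasDerivAt (fun t => lagrangian g₁ σ hg₂ A φ (Ξ t) (Ψ t) x)
            (gradedDivergence g₁ J x + (4 : ℝ) • qTerm g₁ σ g₂ φ ψ s x) 0) ∧
      ((∀ x i, qCov σ g₁ s x i = 0) ↔ IsHolomorphicSpinor σ s) ∧
      ∀ Ξ Ψ, IsSusyVariation g₁ σ φ ψ s Ξ Ψ →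
        (∀ t, action g₁ σ hg₂ A φ (Ξ t) (Ψ t) ∈ parityPart L 0) ∧
          (IsHolomorphicSpinor σ s →
            HasDerivAt (fun t => action g₁ σ hg₂ A φ (Ξ t) (Ψ t)) 0 0) := by
  refine ⟨isSusyVariation_linear σ g₁ hφ hg₂ hψ hψ_odd hs hs_odd,
    -- The current depends on the variation only through its initial data φ, ψ and s, so one J
    -- serves all variations.
    ⟨current σ g₂ g₁ ψ s, contMDiff_current σ hφ hg₂ hg₁ hψ hs,
      hasParity_current σ g₁ hg₂ hφ hψ_odd hs_odd, fun Ξ Ψ h x =>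
        hasDerivAt_lagrangian σ hφ hg₂ hg₁ A hψ hψ_odd hs hs_odd h x⟩,
    forall_qCov_eq_zero_iff_isHolomorphicSpinor σ g₁ hs, fun Ξ Ψ h => ⟨fun t => ?_,
      hasDerivAt_action σ hφ hg₂ hg₁ A hψ hψ_odd hs hs_odd h⟩⟩
  exact surfaceIntegral_mem hg₁ _ (lagrangian_even σ hφ hg₂ hg₁ A
    (smoothAlongAt_slice h.smooth_map t) (h.even_map t)
    (isSmoothTwisted_slice σ h.smooth_spinor t) (h.odd_spinor t))
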